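/- **Setting.** Let $\Sigma$ be a finite signature of relation and constant symbols and let $\mathbb D$ be a $\Sigma$-structure with countably infinite domain. First-order logic is with equality. $\mathbb D$ is *oligomorphic* if for every $n$ the automorphism group of $\mathbb D$ has finitely many orbits on $\mathbb D^n$; it is *decidable* if the function $n\mapsto$ (number of orbits on $\mathbb D^n$) is computable and it is decidable whether a given first-order formula over $\Sigma$ is satisfied in $\mathbb D$ by some valuation of its free variables. It is *representable* if there are a finite alphabet $A$ and an injective map $\mathrm{enc}:\mathbb D\to A^*$ such that the set of codes of elements, the set of codes of constants, and, for every relation symbol, the set of tuples of codes of the tuples in the relation are decidable. An infinite word $x=x_1x_2\cdots\in\mathbb D^\omega$ is written on a tape as $\mathrm{enc}(x_1)\sharp\,\mathrm{enc}(x_2)\sharp\cdots$, with $\sharp\notin A$. A *non-deterministic register transducer* (NRT) over $\mathbb D$ has a finite set $Q$ of states with an initial state $q_0$ and a set $F\subseteq Q$ of final states, a finite set $R$ of registers, a constant symbol $c_r$ for each $r\in R$, and a finite set of transitions $(p,\varphi,q,\mathsf{upd},v)$, where $p,q\in Q$, $\varphi$ is a quantifier-free formula with variables in $R\uplus\{\mathsf{input}\}$,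 $\mathsf{upd}:R\to\{\mathsf{keep},\mathsf{set},\mathsf{guess}\}$ and $v\in R^*$. In state $p$ with register contents $\bar d\in\mathbb D^R$, reading $a\in\mathbb D$, the transition may be taken if $\varphi$ holds for $\bar d$ and $\mathsf{input}=a$; it leads to state $q$ and register contents $\bar d'$ with $\bar d'(r)=\bar d(r)$ if $\mathsf{upd}(r)=\mathsf{keep}$, $\bar d'(r)=a$ if $\mathsf{upd}(r)=\mathsf{set}$, and $\bar d'(r)$ arbitrary if $\mathsf{upd}(r)=\mathsf{guess}$; it outputs the word $\bar d'(v_1)\cdots\bar d'(v_{|v|})$. A run over an infinite input word is accepting if it starts in $q_0$ with register contents $(c_r^{\mathbb D})_r$ and visits $F$ infinitely often. A partial function $f:\mathbb D^\omega\rightharpoonup\mathbb D^\omega$ is *defined by* the NRT if its graph equals the set of pairs (input word, finite or infinite output word) of accepting runs. **Continuity.** Write $|x\wedge y|$ for the length of the longest common prefix. $f$ is *continuous* if for all $x\in\mathrm{dom}(f)$ and $i\in\mathbb N$ there is $j$ such that for all $y\in\mathrm{dom}(f)$, $|x\wedge y|\ge j$ implies $|f(x)\wedge f(y)|\ge i$.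 For $m:\mathbb N\to\mathbb N$, $f$ is *$m$-continuous* if for all $i$ and all $x,y\in\mathrm{dom}(f)$, $|x\wedge y|\ge m(i)$ implies $|f(x)\wedge f(y)|\ge i$. $f$ is *uniformly continuous* if it is $m$-continuous for some $m:\mathbb N\to\mathbb N$. **Computability.** Consider deterministic Turing machines with a read-only one-way input tape, which starts with a start marker followed by the encoding of the input word, a two-way working tape, and a write-only one-way output tape. A machine $M$ *computes* $f$ if for every $x\in\mathrm{dom}(f)$ the limit content of the output tape on input $x$ is the encoding of $f(x)$. Let $M(x,k)$ denote the (possibly infinite) output data word that $M$ writes on input $x$ while its input head has not gone beyond the encoding of the first $k$ data values of $x$. For $m:\mathbb N\to\mathbb N$, $f$ is *$m$-computable* if some $M$ computes $f$ and satisfies $|M(x,m(i))|\ge i$ for all $i\in\mathbb N$ and $x\in\mathrm{dom}(f)$. $f$ is *computable* if some $M$ computes it, and *uniformly computable* if it is $m$-computable for some computable $m$. **Theorem.** Let $\mathbb D$ be a decidable oligomorphic structure with a representation $\mathrm{enc}$, let $f:\mathbb D^\omega\rightharpoonup\mathbb D^\omega$ be a partial function defined by an NRT over $\mathbb D$, and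 let $m:\mathbb N\to\mathbb N$ be a total function. Then 1. $f$ is computable if and only if $f$ is continuous; 2. $f$ is uniformly computable if and only if $f$ is uniformly continuous; 3. $f$ is $m$-computable if and only if $f$ is $m$-continuous. -/

import Mathlib

open FirstOrder

namespace DataWord

/-! ### Oligomorphic and decidable structures -/

section Structures

variable (L : Language) (D : Type*) [L.Structure D]

/-- A signature that consists of relation symbols and constant symbols only. -/
def IsRelConst (L : Language) : Prop :=
  ∀ n : ℕ, IsEmpty (L.Functions (n + 1))

/-- Two `n`-tuples are equivalent if an automorphism of `D` maps one to the other. -/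
def orbitSetoid (n : ℕ) : Setoid (Fin n → D) where
  r v w := ∃ μ : D ≃[L] D, ∀ i, μ (v i) = w i
  iseqv :=
    { refl := fun _ => ⟨Language.Equiv.refl L D, fun _ => rfl⟩
      symm := fun {v w} ⟨μ, h⟩ => ⟨μ.symm, fun i => by
        rw [← h i]; exact μ.toEquiv.symm_apply_apply (v i)⟩
      trans := fun {u v w} ⟨μ, h⟩ ⟨ν, k⟩ => ⟨ν.comp μ, fun i => by
        rw [← k i, ← h i]; rfl⟩ }

/-- The set of orbits of `n`-tuples under the automorphism group of `D`. -/
abbrev Orbits (n : ℕ) : Type _ := Quotient (orbitSetoid L D n)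

/-- `D` is oligomorphic: for every `n` there are finitely many orbits of `n`-tuples. -/
def Oligomorphic : Prop := ∀ n : ℕ, Finite (Orbits L D n)

/-- The Ryll-Nardzewski function: the number of orbits of `n`-tuples. -/
noncomputable def ryllNardzewski (n : ℕ) : ℕ := Nat.card (Orbits L D n)

end Structures

section Codes

variable {L : Language} [Encodable (Σ n, L.Functions n)] [Encodable (Σ n, L.Relations n)]

/-- Gödel number of a term (free variables are indexed by `ℕ`), relative to a numbering of the
symbols of the signature. -/
def termCode {n : ℕ} : L.Term (ℕ ⊕ Fin n) → ℕ
  | .var (.inl i) => Nat.pair 0 i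
  | .var (.inr j) => Nat.pair 1 j
  | .func (l := l) g ts =>
      Nat.pair 2 (Nat.pair (Encodable.encode (⟨l, g⟩ : Σ n, L.Functions n))
        (Encodable.encode (List.ofFn fun i => termCode (ts i))))

/-- Gödel number of a first-order formula. -/
def formulaCode : {n : ℕ} → L.BoundedFormula ℕ n → ℕ
  | _, .falsum => Nat.pair 0 0
  | _, .equal t₁ t₂ => Nat.pair 1 (Nat.pair (termCode t₁) (termCode t₂))
  | _, .rel (l := l) R ts =>
      Nat.pair 2 (Nat.pair (Encodable.encode (⟨l, R⟩ : Σ n, L.Relations n))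
        (Encodable.encode (List.ofFn fun i => termCode (ts i))))
  | _, .imp φ ψ => Nat.pair 3 (Nat.pair (formulaCode φ) (formulaCode ψ))
  | _, .all φ => Nat.pair 4 (formulaCode φ)

end Codes

/-- The satisfiability problem over `D` is decidable: given (the code of) a first-order formula, one
can decide whether some valuation of its free variables makes it true in `D`. -/
def DecidableSat (L : Language) [Encodable (Σ n, L.Functions n)] [Encodable (Σ n, L.Relations n)]
    (D : Type*) [L.Structure D] : Prop :=
  ComputablePred fun c : ℕ =>
    ∃ φ : L.Formula ℕ, formulaCode φ = c ∧ ∃ v : ℕ → D, φ.Realize v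

/-- `D` is decidable: its Ryll-Nardzewski function is computable and first-order satisfiability over
`D` is decidable. -/
def DecidableStructure (L : Language) [Encodable (Σ n, L.Functions n)]
    [Encodable (Σ n, L.Relations n)] (D : Type*) [L.Structure D] : Prop :=
  Computable (ryllNardzewski L D) ∧ DecidableSat L D

/-- An effective representation of `D` by finite words over the finite alphabet `Fin size`: the
words that encode a data value, the words that encode a constant, and the tuples of words that
encode a tuple in a given relation form decidable sets. -/
structure Representation (L : Language) (D : Type*) [L.Structure D] where
  /-- size of the alphabet -/
  size : ℕ
  /-- the encoding -/
  enc : D → List (Fin size)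
  enc_injective : Function.Injective enc
  decidable_range : ComputablePred fun w : List (Fin size) => ∃ d, enc d = w
  decidable_constants : ComputablePred fun w : List (Fin size) => ∃ c : L.Constants, enc (c : D) = w
  decidable_rel : ∀ (k : ℕ) (P : L.Relations k),
    ComputablePred fun w : Fin k → List (Fin size) =>
      ∃ v : Fin k → D, Language.Structure.RelMap P v ∧ ∀ i, enc (v i) = w i

/-! ### Register transducers -/

/-- The operation that a transition performs on a register. -/
inductive RegOp
  | keep
  | set
  | guess

/-- A transition of a register transducer with states `Q` and registers `R`. Tests are
quantifier-free formulas over `R ⊎ {input}`; the variable `some r` is the register `r`, the variable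
`none` is the current input data value. -/
structure Transition (L : Language) (Q R : Type*) where
  source : Q
  test : L.Formula (Option R)
  test_isQF : test.IsQF
  target : Q
  update : R → RegOp
  output : List R

/-- A non-deterministic register transducer; `Q` and `R` are required to be finite where it is
used. -/
structure NRT (L : Language) (Q R : Type*) where
  /-- the transitions -/
  Δ : Set (Transition L Q R)
  finite_Δ : Δ.Finite
  /-- the initial state -/
  q₀ : Q
  /-- the constants that initialise the registers -/
  c₀ : R → L.Constants
  /-- the final states -/
  F : Set Q

/-- The infinite sequence `v 0, v 1, …` of finite words has concatenation `w`, where `w` is a finite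
word (`Sum.inl`) or an infinite word (`Sum.inr`). -/
def Produces {D : Type*} (v : ℕ → List D) : List D ⊕ (ℕ → D) → Prop
  | .inl u => ∃ N, ∀ n ≥ N, ((List.range n).map v).flatten = u
  | .inr y =>
      (∀ n, ∃ l, ((List.range n).map v).flatten = (List.range l).map y) ∧
        ∀ l, ∃ n, l ≤ ((List.range n).map v).flatten.length

namespace NRT

variable {L : Language} {Q R D : Type*} [L.Structure D]

/-- `C'` is a successor configuration of `C` by reading `d` and producing `w`. -/
def Step (T : NRT L Q R) (C : Q × (R → D)) (d : D) (w : List D) (C' : Q × (R → D)) : Prop :=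
  ∃ t ∈ T.Δ, t.source = C.1 ∧ t.target = C'.1 ∧
    t.test.Realize (fun a : Option R => a.elim d C.2) ∧
    (∀ r, t.update r = RegOp.keep → C'.2 r = C.2 r) ∧
    (∀ r, t.update r = RegOp.set → C'.2 r = d) ∧
    w = t.output.map C'.2

/-- The semantics of `T`: some accepting run of `T` over the infinite word `x` produces `w`. -/
def Rel (T : NRT L Q R) (x : ℕ → D) (w : List D ⊕ (ℕ → D)) : Prop :=
  ∃ (C : ℕ → Q × (R → D)) (v : ℕ → List D),
    C 0 = (T.q₀, fun r => (T.c₀ r : D)) ∧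
    (∀ n, T.Step (C n) (x n) (v n) (C (n + 1))) ∧
    (∃ᶠ n in Filter.atTop, (C n).1 ∈ T.F) ∧
    Produces v w

/-- The partial function `f` on infinite words is defined by `T`: the relation recognised by `T` is
the graph of `f`. -/
def Defines (T : NRT L Q R) (f : (ℕ → D) →. (ℕ → D)) : Prop :=
  ∀ (x : ℕ → D) (w : List D ⊕ (ℕ → D)), T.Rel x w ↔ ∃ y ∈ f x, w = .inr y

end NRT

/-! ### Continuity -/

/-- The longest common prefix of `x` and `y` has length at least `k`. -/
def Agree {A : Type*} (k : ℕ) (x y : ℕ → A) : Prop := ∀ i < k, x i = y i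

section Continuity

variable {A : Type*} (f : (ℕ → A) →. (ℕ → A))

/-- `f` is continuous at every point of its domain. -/
def IsContinuous : Prop :=
  ∀ x, ∀ x' ∈ f x, ∀ i, ∃ j, ∀ y, ∀ y' ∈ f y, Agree j x y → Agree i x' y'

/-- `m` is a modulus of continuity of `f`. -/
def IsMContinuous (m : ℕ → ℕ) : Prop :=
  ∀ i, ∀ x, ∀ x' ∈ f x, ∀ y, ∀ y' ∈ f y, Agree (m i) x y → Agree i x' y'

/-- `f` is uniformly continuous. -/
def IsUniformlyContinuous : Prop := ∃ m : ℕ → ℕ, IsMContinuous f m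

end Continuity

/-! ### Computability -/

section Encoding

variable {D : Type*} {n : ℕ} (enc : D → List (Fin n))

/-- The encoding `enc d₁ ♯ ⋯ enc dₖ ♯` of the first `k` letters of the infinite word `x`; the
separator `♯` is `none`. -/
def encPrefix (x : ℕ → D) (k : ℕ) : List (Option (Fin n)) :=
  ((List.range k).map fun i => (enc (x i)).map some ++ [none]).flatten

/-- The content of the input tape. Cell `0` is a start marker (`none`); it is followed by the
encoding of the infinite word `x`, that is, cell `p + 1` holds the symbol number `p` of
`enc d₁ ♯ enc d₂ ♯ ⋯`. (The encoding of `p + 1` letters has more than `p` symbols.) -/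
def inputCell (x : ℕ → D) : ℕ → Option (Option (Fin n))
  | 0 => none
  | p + 1 => (encPrefix enc x (p + 1))[p]?

end Encoding

/-- What a machine with states `Q` and working alphabet `Γ` does in one step. -/
structure Action (n : ℕ) (Q Γ : Type) where
  /-- the next state -/
  state : Q
  /-- the symbol written on the current cell of the working tape -/
  write : Γ
  /-- the move of the head on the working tape (`none`: it stays) -/
  move : Option Turing.Dir
  /-- whether the input head moves one cell to the right -/
  advance : Bool
  /-- the symbol appended to the output tape, if any; `some none` appends `♯` -/
  output : Option (Option (Fin n))

/-- A deterministic Turing machine with a read-only one-way input tape and a write-only one-way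
output tape, both over the alphabet `Fin n ⊎ {♯}` (with a start marker on the input tape), and a
two-way working tape over a finite alphabet `Γ`, whose blank symbol is `default`. -/
structure Machine (n : ℕ) where
  /-- the states -/
  Q : Type
  /-- the working alphabet -/
  Γ : Type
  [finite_Q : Finite Q]
  [finite_Γ : Finite Γ]
  [inhabited_Γ : Inhabited Γ]
  /-- the initial state -/
  q₀ : Q
  /-- the transition function; it depends on the state, the current input symbol and the current
  symbol of the working tape -/
  δ : Q → Option (Option (Fin n)) → Γ → Action n Q Γ

namespace Machine

attribute [instance] Machine.finite_Q Machine.finite_Γ Machine.inhabited_Γ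

variable {D : Type*} {n : ℕ}

/-- A configuration: state, working tape, position of the input head, content of the output tape. -/
structure Config (M : Machine n) where
  state : M.Q
  tape : Turing.Tape M.Γ
  pos : ℕ
  out : List (Option (Fin n))

/-- One step of the machine on the input word `x`. -/
def next (M : Machine n) (enc : D → List (Fin n)) (x : ℕ → D) (c : M.Config) : M.Config :=
  let a := M.δ c.state (inputCell enc x c.pos) c.tape.head
  { state := a.state
    tape := a.move.elim (c.tape.write a.write) fun dir => (c.tape.write a.write).move dir
    pos := if a.advance then c.pos + 1 else c.pos
    out := c.out ++ a.output.toList }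

/-- The configuration of the machine on the input word `x` after `t` steps. -/
def run (M : Machine n) (enc : D → List (Fin n)) (x : ℕ → D) : ℕ → M.Config
  | 0 => ⟨M.q₀, default, 0, []⟩
  | t + 1 => M.next enc x (M.run enc x t)

/-- `M` computes `f`: for every `x` in the domain of `f`, the limit content of the output tape
is the encoding of the infinite word `f x`. -/
def Computes (M : Machine n) (enc : D → List (Fin n)) (f : (ℕ → D) →. (ℕ → D)) : Prop :=
  ∀ x, ∀ y ∈ f x,
    (∀ t, ∃ l, (M.run enc x t).out <+: encPrefix enc y l) ∧
    ∀ l, ∃ t, encPrefix enc y l <+: (M.run enc x t).out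

/-- The output written on `x` while the input head has not gone beyond the encoding of the first `k`
data values of `x` contains at least `i` (complete) data values. This output may be infinite, if
the head never goes further. -/
def OutputLengthGE (M : Machine n) (enc : D → List (Fin n)) (x : ℕ → D) (k i : ℕ) : Prop :=
  ∃ t, (M.run enc x t).pos ≤ (encPrefix enc x k).length ∧ i ≤ (M.run enc x t).out.count none

end Machine

section Computability

variable {L : Language} {D : Type*} [L.Structure D] (ρ : Representation L D)
  (f : (ℕ → D) →. (ℕ → D))

/-- `f` is computable. -/
def IsComputable : Prop := ∃ M : Machine ρ.size, M.Computes ρ.enc f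

/-- `f` is `m`-computable: some machine that computes `f` writes at least `i` data values while it
has access to the first `m i` data values of the input only. -/
def IsMComputable (m : ℕ → ℕ) : Prop :=
  ∃ M : Machine ρ.size, M.Computes ρ.enc f ∧
    ∀ i, ∀ x, (f x).Dom → M.OutputLengthGE ρ.enc x (m i) i

/-- `f` is uniformly computable: it is `m`-computable for some computable `m`. -/
def IsUniformlyComputable : Prop := ∃ m : ℕ → ℕ, Computable m ∧ IsMComputable ρ f m

end Computability

end DataWord

/-! Computability implies continuity because a machine that has written `i` letters has only seen a
finite part of the input, and its behaviour so far depends on that part alone. Separators and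
injectivity of `enc` turn equal output tapes into equal letters, with the same modulus
(`Machine.Computes.agree`).

For the converse the transducer becomes a `RegSys`, and disagreement of outputs is expressed by
finite runs: `Mis D K j τ i` says that two finite runs with the same first `j` input letters, the
first one starting with the transitions `τ`, differ at output position `i`, and both can be
prolonged by `K` visits to final states. Oligomorphicity enters through the fact that witnesses of
automorphism-invariant properties are bounded (`exists_bound_of_invariant`). This yields a `K` such
that `K` visits guarantee an infinite accepting prolongation (`exists_live_bound`,
`Live.exists_accepts`), so mismatches are genuine disagreements of `f` (`isMContinuous_iff`). It
also bounds the length of the runs that witness a mismatch (`exists_mis_bound`). For given `j`, `τ`,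
`i` there remain finitely many transition sequences; with data values replaced by variables, shared
on the common input, each asks for the satisfiability of one formula without parameters. Hence
mismatches are decidable (`computablePred_mis`). The bounds are constants of the machine and need
not be computed.

The machine searches for a finite run on the letters read so far that outputs a letter at position
`i` and excludes mismatches (`search`). Such a letter is correct, since otherwise this run and an
accepting run on the actual input would form a mismatch (`search_sound`). If `f` is continuous, `τ`
is the transition sequence of the guessed run up to position `j`, and the search succeeds by a König
argument (`exists_not_mis`): otherwise the same infinite transition sequence would carry an
accepting run at whose input `f` is discontinuous. If `f` is `m`-continuous, `τ = []` suffices, and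
the machine reads on only while a mismatch exists for the current `j` and `i`. It thus respects
every modulus of continuity without consulting any of them. For uniform continuity the least
mismatch-free `j` is a computable modulus. -/

namespace DataWord

/-! ### Running partial recursive functions on a machine with input and output -/

section Compile

open Turing StateTransition Relation
open Turing.PartrecToTM2 (Λ' Cont' K' trNormal trList)

/-- The stack program of Mathlib for partial recursive functions, modified so that the symbol on
top of the main stack is in the store when the program halts. -/
def trPeek (q : Λ') : TM2.Stmt (fun _ : K' => PartrecToTM2.Γ') Λ' (Option PartrecToTM2.Γ') :=
  if q = Λ'.ret Cont'.halt then .peek K'.main (fun _ s => s) .halt else PartrecToTM2.tr q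

/-- The two programs differ only at the label `ret halt`, which a terminating computation meets
exactly in its last step. So the known computation can be copied up to that step. -/
theorem reaches_trPeek {c : ToPartrec.Code} {v v' : List ℕ} (h : v' ∈ c.eval v) :
    Reaches (TM2.step trPeek)
      ⟨some (trNormal c Cont'.halt), none, K'.elim (trList v) [] [] []⟩
      ⟨none, (trList v').head?, K'.elim (trList v') [] [] []⟩ := by
  have h1 : PartrecToTM2.halt v' ∈ eval (TM2.step PartrecToTM2.tr) (PartrecToTM2.init c v) := by
    rw [PartrecToTM2.tr_eval]
    exact (Part.mem_map_iff _).2 ⟨v', h, rfl⟩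
  obtain ⟨h2, -⟩ := mem_eval.1 h1
  have key : ∀ a, Reaches (TM2.step PartrecToTM2.tr) a (PartrecToTM2.halt v') → a.l ≠ none →
      Reaches (TM2.step trPeek) a ⟨none, (trList v').head?, K'.elim (trList v') [] [] []⟩ := by
    intro a ha
    induction ha using ReflTransGen.head_induction_on with
    | refl => intro h; exact absurd rfl h
    | @head a b hab hb ih =>
      intro _
      obtain ⟨l, s, S⟩ := a
      cases l with
      | none => cases hab
      | some l =>
        by_cases hl : l = Λ'.ret Cont'.halt
        · subst hl
          simp only [TM2.step, PartrecToTM2.tr_ret_halt, TM2.stepAux, Option.mem_def,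
            Option.some.injEq] at hab
          subst hab
          have hS : S = K'.elim (trList v') [] [] [] := by
            rcases ReflTransGen.cases_head hb with h | ⟨d, hd, -⟩
            · simpa [PartrecToTM2.halt] using h
            · cases hd
          subst hS
          refine ReflTransGen.single ?_
          simp [TM2.step, trPeek]
        · refine ReflTransGen.head (b := b) ?_ (ih ?_)
          · have : trPeek l = PartrecToTM2.tr l := if_neg hl
            simpa [TM2.step, this] using hab
          · rintro hbl
            obtain ⟨lb, sb, Sb⟩ := b
            simp only at hbl
            subst hbl
            -- No other label halts, so the successor still has a label and the induction hypothesis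
            -- applies.
            have hnone : ∀ (q : Λ') s S, q ≠ Λ'.ret Cont'.halt →
                (TM2.stepAux (PartrecToTM2.tr q) s S).l ≠ none := by
              intro q s S hq
              cases q with
              | ret k =>
                cases k with
                | halt => exact absurd rfl hq
                | _ => simp [PartrecToTM2.tr, PartrecToTM2.pop']
              | _ =>
                simp only [PartrecToTM2.tr, PartrecToTM2.pop', PartrecToTM2.push', TM2.stepAux,
                  PartrecToTM2.peek']
                repeat' first
                  | (simp only [cond_eq_ite]; split_ifs)
                  | simp
            refine hnone l s S hl ?_
            simp only [TM2.step, Option.mem_def, Option.some.injEq] at hab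
            rw [hab]
  exact key _ h2 (by simp)

/-- The finite set of labels used to run the programs `c i`. -/
noncomputable def compileLabels {ι : Type} [Fintype ι] (c : ι → ToPartrec.Code) : Finset Λ' :=
  insert (Λ'.ret Cont'.halt)
    (Finset.univ.biUnion fun i => PartrecToTM2.codeSupp (c i) Cont'.halt)

theorem supports_compileLabels {ι : Type} [Fintype ι] (c : ι → ToPartrec.Code) :
    TM2.Supports trPeek (compileLabels c) := by
  refine ⟨Finset.mem_insert_self _ _, fun q hq => ?_⟩
  by_cases h : q = Λ'.ret Cont'.halt
  · rw [show trPeek q = _ from if_pos h]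
    trivial
  · rw [show trPeek q = _ from if_neg h]
    rw [compileLabels, Finset.mem_insert] at hq
    obtain ⟨i, -, hi⟩ := Finset.mem_biUnion.1 (hq.resolve_left h)
    refine PartrecToTM2.codeSupp_supports ?_ q hi
    exact (Finset.subset_biUnion_of_mem (fun i => PartrecToTM2.codeSupp (c i) Cont'.halt)
      (Finset.mem_univ i)).trans (Finset.subset_insert _ _)

/-- The single tape program that simulates `trPeek`. -/
abbrev tapeProg := TM2to1.tr trPeek

/-- The elementary program that simulates `trPeek`. -/
abbrev tapeMachine := TM1to0.tr tapeProg

/-- The tape alphabet. -/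
abbrev TapeSymbol := TM2to1.Γ' K' (fun _ : K' => PartrecToTM2.Γ')

/-- The tape holds the list `v`, with the head at the bottom marker. -/
def HoldsList (v : List ℕ) (T : Tape TapeSymbol) : Prop :=
  ∃ L : ListBlank (∀ _ : K', Option PartrecToTM2.Γ'),
    (∀ k, L.map (proj k) = ListBlank.mk ((K'.elim (trList v) [] [] [] k).map some).reverse) ∧
      T = Tape.mk' ∅ (TM2to1.addBottom L)

/-- The label at which the simulation of the program `c` starts. -/
def startLabel (c : ToPartrec.Code) : TM1to0.Λ' tapeProg :=
  (some (tapeProg (TM2to1.Λ'.normal (trNormal c Cont'.halt))), none)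

/-- The tape format is the same before and after the call, so calls can be chained. The first symbol
of the result is left in the state, where a finite control can see it. -/
theorem tapeMachine_reaches {c : ToPartrec.Code} {v v' : List ℕ} (h : v' ∈ c.eval v)
    {T : Tape TapeSymbol} (hT : HoldsList v T) :
    ∃ T', HoldsList v' T' ∧ Reaches (TM0.step tapeMachine)
      ⟨startLabel c, T⟩ ⟨(none, (trList v').head?), T'⟩ := by
  obtain ⟨L, hL, rfl⟩ := hT
  obtain ⟨b, hb, hr⟩ := tr_reaches (TM2to1.tr_respects trPeek)
    (TM2to1.TrCfg.mk (q := some (trNormal c Cont'.halt)) (v := none) L hL) (reaches_trPeek h)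
  obtain @⟨_, _, _, L', hL'⟩ := hb
  obtain ⟨b', hb', hr'⟩ := tr_reaches (TM1to0.tr_respects tapeProg) rfl hr
  subst hb'
  exact ⟨_, ⟨L', hL', rfl⟩, hr'⟩

/-- The finite set of labels of the elementary program used to run the programs `c i`. -/
noncomputable def machineLabels {ι : Type} [Fintype ι] (c : ι → ToPartrec.Code) :
    Finset (TM1to0.Λ' tapeProg) :=
  TM1to0.trStmts tapeProg (TM2to1.trSupp trPeek (compileLabels c))

theorem supports_machineLabels {ι : Type} [Fintype ι] (c : ι → ToPartrec.Code) :
    TM0.Supports tapeMachine (machineLabels c : Set (TM1to0.Λ' tapeProg)) :=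
  TM1to0.tr_supports _ (TM2to1.tr_supports _ (supports_compileLabels c))

theorem startLabel_mem {ι : Type} [Fintype ι] (c : ι → ToPartrec.Code) (i : ι) :
    startLabel (c i) ∈ machineLabels c := by
  classical
  have h1 : trNormal (c i) Cont'.halt ∈ compileLabels c :=
    Finset.mem_insert_of_mem (Finset.mem_biUnion.2 ⟨i, Finset.mem_univ i,
      PartrecToTM2.codeSupp_self _ _ (PartrecToTM2.trStmts₁_self _)⟩)
  refine Finset.mem_product.2 ⟨?_, Finset.mem_univ _⟩
  refine Finset.some_mem_insertNone.2 (Finset.mem_biUnion.2 ⟨_, ?_, TM1.stmts₁_self⟩)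
  exact Finset.mem_biUnion.2 ⟨_, h1, Finset.mem_insert_self _ _⟩

end Compile

end DataWord

/-! ### A finite control that calls computable functions on a number stored on the tape. -/

namespace DataWord

section Control

open Turing StateTransition Relation
open Turing.PartrecToTM2 (K' trList)

/-- Configurations of a finite control that calls computable functions on a natural number. -/
structure CtlCfg (n : ℕ) (Φ : Type) where
  phase : Φ
  mem : ℕ
  pos : ℕ
  out : List (Option (Fin n))

/-- One step of the control: in phase `φ` the function `F φ` is applied to the memory; the parity of
the result and the current input symbol determine the next phase and what is done with the input
head and the output. -/
def ctlStep {n : ℕ} {Φ : Type} (F : Φ → ℕ → ℕ)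
    (δ : Φ → Option (Option (Fin n)) → Bool → Φ × Bool × Option (Option (Fin n)))
    (cell : ℕ → Option (Option (Fin n))) (c : CtlCfg n Φ) : CtlCfg n Φ :=
  let r := δ c.phase (cell c.pos) (F c.phase c.mem).bodd
  ⟨r.1, F c.phase c.mem, if r.2.1 then c.pos + 1 else c.pos, c.out ++ r.2.2.toList⟩

/-- Numbers are stored in binary with the least significant digit first, and zero has no digits. The
peeked symbol therefore reveals the parity. -/
theorem head?_trList_singleton (s : ℕ) :
    ((trList [s]).head? == some PartrecToTM2.Γ'.bit1) = s.bodd := by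
  have key : ∀ p : PosNum, ((PartrecToTM2.trPosNum p ++ [PartrecToTM2.Γ'.cons]).head? ==
      some PartrecToTM2.Γ'.bit1) = (p : ℕ).bodd := by
    intro p
    cases p with
    | one => rfl
    | bit0 p => simp [PartrecToTM2.trPosNum, Nat.bodd_add]
    | bit1 p => simp [PartrecToTM2.trPosNum, Nat.bodd_add]
  have h : ((s : Num) : ℕ) = s := Num.to_of_nat s
  have h2 : trList [s] = PartrecToTM2.trNum (s : Num) ++ [PartrecToTM2.Γ'.cons] := rfl
  rw [h2]
  conv_rhs => rw [← h]
  cases hs : (s : Num) with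
  | zero => rfl
  | pos p => simpa [PartrecToTM2.trNum] using key p

instance : Finite TapeSymbol :=
  have : Finite K' := ⟨⟨fun | .main => 0 | .rev => 1 | .aux => 2 | .stack => (3 : Fin 4),
    fun | 0 => .main | 1 => .rev | 2 => .aux | 3 => .stack, fun k => by cases k <;> rfl,
    fun i => by fin_cases i <;> rfl⟩⟩
  inferInstanceAs (Finite (Bool × (K' → Option PartrecToTM2.Γ')))

/-- The machine that runs the programs `c i` on a list kept on its tape, as directed by `δ`. -/
noncomputable def driver {n : ℕ} {ι : Type} [Fintype ι] (c : ι → ToPartrec.Code)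
    (δ : ι → Option (Option (Fin n)) → Option PartrecToTM2.Γ' →
      ι × Bool × Option (Option (Fin n))) (i₀ : ι) : Machine n :=
  open scoped Classical in
  { Q := Option (ι × machineLabels c)
    Γ := TapeSymbol
    q₀ := none
    δ := fun q b a => match q with
      | none => ⟨some (i₀, ⟨startLabel (c i₀), startLabel_mem c i₀⟩), (true, fun _ => none), none,
          false, none⟩
      | some (i, q) => match tapeMachine q.1 a with
        | none =>
          let r := δ i b q.1.2
          ⟨some (r.1, ⟨startLabel (c r.1), startLabel_mem c r.1⟩), a, none, r.2.1, r.2.2⟩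
        | some (q', s) =>
          let q'' := if h : q' ∈ machineLabels c then ⟨q', h⟩ else q
          match s with
          | .move d => ⟨some (i, q''), a, some d, false, none⟩
          | .write a' => ⟨some (i, q''), a', none, false, none⟩ }

variable {n : ℕ} {ι : Type} [Fintype ι] {c : ι → ToPartrec.Code}
  {δ : ι → Option (Option (Fin n)) → Option PartrecToTM2.Γ' → ι × Bool × Option (Option (Fin n))}
  {i₀ : ι} {D : Type*} {enc : D → List (Fin n)} {x : ℕ → D}

/-- The configuration of `driver` with the given components. -/
def driverCfg (c : ι → ToPartrec.Code) (δ : ι → Option (Option (Fin n)) → Option PartrecToTM2.Γ' →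
      ι × Bool × Option (Option (Fin n))) (i₀ : ι) (q : Option (ι × machineLabels c))
    (T : Tape TapeSymbol) (pos : ℕ) (out : List (Option (Fin n))) : (driver c δ i₀).Config :=
  ⟨q, T, pos, out⟩

/-- The configuration of `driver` in which the program `c i` is started. -/
noncomputable def driverStart (c : ι → ToPartrec.Code)
    (δ : ι → Option (Option (Fin n)) → Option PartrecToTM2.Γ' →
      ι × Bool × Option (Option (Fin n))) (i₀ : ι) (i : ι)
    (T : Tape TapeSymbol) (pos : ℕ) (out : List (Option (Fin n))) : (driver c δ i₀).Config :=
  driverCfg c δ i₀ (some (i, ⟨startLabel (c i), startLabel_mem c i⟩)) T pos out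

theorem driver_next_of_step {i : ι} {q q' : TM1to0.Λ' tapeProg} {T T' : Tape TapeSymbol}
    (hq : q ∈ machineLabels c) (h : (⟨q', T'⟩ : TM0.Cfg _ _) ∈ TM0.step tapeMachine ⟨q, T⟩)
    (pos : ℕ) (out : List (Option (Fin n))) :
    ∃ hq' : q' ∈ machineLabels c,
      (driver c δ i₀).next enc x (driverCfg c δ i₀ (some (i, ⟨q, hq⟩)) T pos out) =
        driverCfg c δ i₀ (some (i, ⟨q', hq'⟩)) T' pos out := by
  have hq' : q' ∈ machineLabels c := TM0.step_supports _ (supports_machineLabels c) h hq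
  refine ⟨hq', ?_⟩
  obtain ⟨⟨p, s⟩, hp, he⟩ := Option.map_eq_some_iff.1 h
  cases s with
  | move d =>
    simp only [TM0.Cfg.mk.injEq] at he
    obtain ⟨rfl, rfl⟩ := he
    simp [Machine.next, driverCfg, driver, hp, hq']
    exact congrArg (fun T => driverCfg c δ i₀ (some (i, ⟨p, hq'⟩)) (Tape.move d T) pos out)
      (Tape.write_self T)
  | write a =>
    simp only [TM0.Cfg.mk.injEq] at he
    obtain ⟨rfl, rfl⟩ := he
    simp [Machine.next, driverCfg, driver, hp, hq']
    rfl

/-- During a call the input head and the output tape do not change. This is recorded for all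
intermediate times because the limit output concerns every time. -/
theorem driver_run_of_reaches {i : ι} {a b : TM0.Cfg TapeSymbol (TM1to0.Λ' tapeProg)}
    (h : Reaches (TM0.step tapeMachine) a b) (ha : a.q ∈ machineLabels c) {t pos : ℕ}
    {out : List (Option (Fin n))}
    (ht : (driver c δ i₀).run enc x t = driverCfg c δ i₀ (some (i, ⟨a.q, ha⟩)) a.Tape pos out) :
    ∃ (hb : b.q ∈ machineLabels c) (k : ℕ),
      (driver c δ i₀).run enc x (t + k) = driverCfg c δ i₀ (some (i, ⟨b.q, hb⟩)) b.Tape pos out ∧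
      ∀ k' ≤ k, ((driver c δ i₀).run enc x (t + k')).pos = pos ∧
        ((driver c δ i₀).run enc x (t + k')).out = out := by
  induction h with
  | refl => exact ⟨ha, 0, ht, fun k' hk => by
      obtain rfl : k' = 0 := by omega
      rw [Nat.add_zero, ht]; exact ⟨rfl, rfl⟩⟩
  | @tail b d _ hbd ih =>
    obtain ⟨hb, k, hk, hk'⟩ := ih
    obtain ⟨hd, hn⟩ := driver_next_of_step (δ := δ) (i₀ := i₀) (enc := enc) (x := x) (i := i)
      hb hbd pos out
    have h1 : (driver c δ i₀).run enc x (t + (k + 1)) = driverCfg c δ i₀ (some (i, ⟨d.q, hd⟩)) d.Tape pos out := by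
      rw [← hn, ← hk]; rfl
    refine ⟨hd, k + 1, h1, fun k' hle => ?_⟩
    rcases Nat.lt_or_ge k k' with h | h
    · obtain rfl : k' = k + 1 := by omega
      rw [h1]; exact ⟨rfl, rfl⟩
    · exact hk' k' h

theorem driver_cycle {i : ι} {v v' : List ℕ} (hv : v' ∈ (c i).eval v) {T : Tape TapeSymbol}
    (hT : HoldsList v T) {t pos : ℕ} {out : List (Option (Fin n))}
    (ht : (driver c δ i₀).run enc x t =
      driverStart c δ i₀ i T pos out) :
    ∃ T' k, HoldsList v' T' ∧
      (∀ k' ≤ k, ((driver c δ i₀).run enc x (t + k')).pos = pos ∧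
        ((driver c δ i₀).run enc x (t + k')).out = out) ∧
      let r := δ i (inputCell enc x pos) (trList v').head?
      (driver c δ i₀).run enc x (t + k + 1) =
        driverStart c δ i₀ r.1 T' (if r.2.1 then pos + 1 else pos) (out ++ r.2.2.toList) := by
  obtain ⟨T', hT', hr⟩ := tapeMachine_reaches hv hT
  obtain ⟨hb, k, hk, hk'⟩ := driver_run_of_reaches hr (startLabel_mem c i) ht
  refine ⟨T', k, hT', hk', ?_⟩
  have : (driver c δ i₀).run enc x (t + k + 1) =
    (driver c δ i₀).next enc x ((driver c δ i₀).run enc x (t + k)) := rfl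
  rw [this, hk]
  exact congrArg (fun T => driverStart c δ i₀ (δ i (inputCell enc x pos) (trList v').head?).1 T
    (if (δ i (inputCell enc x pos) (trList v').head?).2.1 then pos + 1 else pos)
    (out ++ (δ i (inputCell enc x pos) (trList v').head?).2.2.toList)) (Tape.write_self T')

theorem holdsList_nil : HoldsList [] ((default : Tape TapeSymbol).write (true, fun _ => none)) := by
  refine ⟨∅, fun k => ?_, ?_⟩
  · cases k <;> rfl
  · rfl

/-- Each control step is one call followed by one step that looks at the parity of the result and at
the input symbol. The two parts say that the machine visits every stage of the control and shows
nothing else in between. -/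
theorem exists_machine_of_control {Φ : Type} [Finite Φ] (F : Φ → ℕ → ℕ)
    (hF : ∀ φ, Computable (F φ))
    (δ : Φ → Option (Option (Fin n)) → Bool → Φ × Bool × Option (Option (Fin n))) (φ₀ : Φ) :
    ∃ M : Machine n, ∀ {D : Type*} (enc : D → List (Fin n)) (x : ℕ → D),
      (∀ m, ∃ t, (M.run enc x t).pos = ((ctlStep F δ (inputCell enc x))^[m] ⟨φ₀, 0, 0, []⟩).pos ∧
        (M.run enc x t).out = ((ctlStep F δ (inputCell enc x))^[m] ⟨φ₀, 0, 0, []⟩).out) ∧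
      (∀ t, ∃ m, (M.run enc x t).pos = ((ctlStep F δ (inputCell enc x))^[m] ⟨φ₀, 0, 0, []⟩).pos ∧
        (M.run enc x t).out = ((ctlStep F δ (inputCell enc x))^[m] ⟨φ₀, 0, 0, []⟩).out) := by
  classical
  have := Fintype.ofFinite Φ
  have hcode : ∀ φ, ∃ c : ToPartrec.Code, ∀ s : ℕ, c.eval [s] = pure [F φ s] := by
    intro φ
    have h1 : Nat.Partrec' (fun v : List.Vector ℕ 1 => (F φ v.head : Part ℕ)) := by
      have h2 : Partrec fun v : List.Vector ℕ 1 => (F φ v.head : Part ℕ) :=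
        ((hF φ).comp Computable.vector_head).partrec
      exact Nat.Partrec'.part_iff.2 h2
    obtain ⟨c, hc⟩ := ToPartrec.Code.exists_code h1
    refine ⟨c, fun s => ?_⟩
    have := hc ⟨[s], rfl⟩
    simpa [List.Vector.head] using this
  choose code hcode using hcode
  -- The additional phase `none` turns the empty list on the fresh tape into `[0]`, the initial
  -- memory.
  let c : Option Φ → ToPartrec.Code := fun o => o.elim ToPartrec.Code.zero code
  let δ' : Option Φ → Option (Option (Fin n)) → Option PartrecToTM2.Γ' →
      Option Φ × Bool × Option (Option (Fin n)) := fun o b s =>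
    o.elim (some φ₀, false, none) fun φ =>
      let r := δ φ b (s == some PartrecToTM2.Γ'.bit1)
      (some r.1, r.2)
  refine ⟨driver c δ' none, fun {D} enc x => ?_⟩
  set M := driver c δ' none
  set A := fun m => (ctlStep F δ (inputCell enc x))^[m] ⟨φ₀, 0, 0, []⟩ with hA
  -- The bound `t ≥ m` makes the description of the times up to `t` cover all times as `m` grows.
  have key : ∀ m, ∃ t ≥ m, (∃ T, HoldsList [(A m).mem] T ∧ M.run enc x t =
      driverStart c δ' none (some (A m).phase) T (A m).pos (A m).out) ∧ ∀ s ≤ t, ∃ m', (M.run enc x s).pos = (A m').pos ∧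
          (M.run enc x s).out = (A m').out := by
    intro m
    induction m with
    | zero =>
      have h1 : M.run enc x 1 = driverStart c δ' none none
          ((default : Tape TapeSymbol).write (true, fun _ => none)) 0 [] := rfl
      obtain ⟨T', k, hT', hk, hr⟩ := driver_cycle (v := []) (v' := [0]) (i := none) (δ := δ')
        (i₀ := none) (by simp [c]) holdsList_nil h1
      refine ⟨1 + k + 1, by omega, ⟨T', hT', ?_⟩, fun s hs => ⟨0, ?_⟩⟩
      · exact hr
      · rcases Nat.eq_zero_or_pos s with rfl | h
        · exact ⟨rfl, rfl⟩
        · rcases Nat.lt_or_ge (1 + k) s with h' | h'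
          · obtain rfl : s = 1 + k + 1 := by omega
            constructor
            · exact congrArg Machine.Config.pos hr
            · exact congrArg Machine.Config.out hr
          · obtain ⟨s, rfl⟩ := Nat.exists_eq_add_of_le h
            exact hk s (by omega)
    | succ m ih =>
      obtain ⟨t, htm, ⟨T, hT, hr⟩, hs⟩ := ih
      have hAm : A (m + 1) = ctlStep F δ (inputCell enc x) (A m) :=
        Function.iterate_succ_apply' _ _ _
      obtain ⟨T', k, hT', hk, hr'⟩ := driver_cycle (v := [(A m).mem])
        (v' := [F (A m).phase (A m).mem]) (i := some (A m).phase) (δ := δ')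
        (i₀ := none) (by simp [c, hcode]) hT hr
      have hfin : M.run enc x (t + k + 1) = driverStart c δ' none (some (A (m + 1)).phase) T'
          (A (m + 1)).pos (A (m + 1)).out := by
        rw [hAm]
        simp only [δ', Option.elim_some, head?_trList_singleton] at hr'
        exact hr'
      refine ⟨t + k + 1, by omega, ⟨T', ?_, hfin⟩, fun s hst => ?_⟩
      · rw [hAm]; exact hT'
      · rcases Nat.lt_or_ge t s with h | h
        · rcases Nat.lt_or_ge (t + k) s with h' | h'
          · obtain rfl : s = t + k + 1 := by omega
            exact ⟨m + 1, by rw [hfin]; rfl, by rw [hfin]; rfl⟩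
          · obtain ⟨s, rfl⟩ := Nat.exists_eq_add_of_le h.le
            exact ⟨m, hk s (by omega)⟩
        · exact hs s h
  constructor
  · intro m
    obtain ⟨t, -, ⟨T, -, hr⟩, -⟩ := key m
    exact ⟨t, by rw [hr]; rfl, by rw [hr]; rfl⟩
  · intro t
    obtain ⟨t', htt, -, hs⟩ := key t
    exact hs t htt

end Control

end DataWord

/-! ### Input-output algorithms whose states lie in an arbitrary `Primcodable` type. -/

namespace DataWord

section InputOutput

variable {n : ℕ} {σ : Type}

/-- Configurations of an algorithm with internal states in `σ` that reads input symbols and writes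
output symbols. -/
structure IOCfg (n : ℕ) (σ : Type) where
  st : σ
  pos : ℕ
  out : List (Option (Fin n))

/-- One step: output `o st`, advance the input head if `a st`, then update the state depending on
the symbol under the input head. -/
def ioStep (o : σ → Option (Option (Fin n))) (a : σ → Bool)
    (upd : σ × Option (Option (Fin n)) → σ) (cell : ℕ → Option (Option (Fin n)))
    (c : IOCfg n σ) : IOCfg n σ :=
  let p := if a c.st then c.pos + 1 else c.pos
  ⟨upd (c.st, cell p), p, c.out ++ (o c.st).toList⟩

/-- The phases in which a finite control performs one step of `ioStep`. -/
inductive IOPhase (n : ℕ)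
  | boot
  | emit (j : Fin (n + 1))
  | adv
  | read
  | upd (b : Option (Option (Fin n)))

instance : Finite (IOPhase n) := by
  refine Finite.of_injective (β := Fin (n + 1) ⊕ Option (Option (Fin n)) ⊕ Fin 3)
    (fun | .boot => .inr (.inr 0) | .emit j => .inl j | .adv => .inr (.inr 1)
         | .read => .inr (.inr 2) | .upd b => .inr (.inl b)) ?_
  intro x y h
  cases x <;> cases y <;> simp_all

/-- The memory content encodes a state, except for its parity. -/
def memState [Primcodable σ] (s₀ : σ) (m : ℕ) : σ := (Encodable.decode m.div2).getD s₀

/-- The functions computed in the various phases. -/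
def ioFun [Primcodable σ] (s₀ : σ) (o : σ → Option (Option (Fin n))) (a : σ → Bool)
    (upd : σ × Option (Option (Fin n)) → σ) : IOPhase n → ℕ → ℕ
  | .boot, _ => 2 * Encodable.encode s₀
  | .emit j, m => bif decide (o (memState s₀ m) = some (finSuccEquiv n j)) then 2 * m.div2 + 1
      else 2 * m.div2
  | .adv, m => bif a (memState s₀ m) then 2 * m.div2 + 1 else 2 * m.div2
  | .read, m => m
  | .upd b, m => 2 * Encodable.encode (upd (memState s₀ m, b))

/-- The control that performs one step of `ioStep` in a cycle of phases. -/
def ioControl : IOPhase n → Option (Option (Fin n)) → Bool →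
    IOPhase n × Bool × Option (Option (Fin n))
  | .boot, _, _ => (.emit 0, false, none)
  | .emit j, _, t => (if h : (j : ℕ) + 1 < n + 1 then .emit ⟨j + 1, h⟩ else .adv, false,
      if t then some (finSuccEquiv n j) else none)
  | .adv, _, t => (.read, t, none)
  | .read, b, _ => (.upd b, false, none)
  | .upd _, _, _ => (.emit 0, false, none)

theorem computable_ioFun [Primcodable σ] (s₀ : σ) {o : σ → Option (Option (Fin n))} {a : σ → Bool}
    {upd : σ × Option (Option (Fin n)) → σ} (ho : Computable o) (ha : Computable a)
    (hupd : Computable upd) (φ : IOPhase n) : Computable (ioFun s₀ o a upd φ) := by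
  have hmem : Computable (memState s₀) :=
    Computable.option_getD (Computable.decode.comp Computable.nat_div2) (Computable.const s₀)
  have h0 : Computable fun m : ℕ => 2 * m.div2 :=
    Primrec.nat_double.to_comp.comp Computable.nat_div2
  have h1 : Computable fun m : ℕ => 2 * m.div2 + 1 :=
    Primrec.nat_double_succ.to_comp.comp Computable.nat_div2
  cases φ with
  | boot => exact Computable.const _
  | emit j =>
    refine Computable.cond ?_ h1 h0
    exact ((Primrec.eq (α := Option (Option (Fin n)))).decide.to_comp).comp (ho.comp hmem)
      (Computable.const _)
  | adv => exact Computable.cond (ha.comp hmem) h1 h0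
  | read => exact Computable.id
  | upd b =>
    exact Primrec.nat_double.to_comp.comp (Computable.encode.comp
      (hupd.comp (hmem.pair (Computable.const b))))

/-- The control receives one bit per call, so the memory holds twice the code of the state plus an
answer bit. The `n + 1` possible output symbols are queried one after another, then the move of the
head; the input symbol reaches the update through the phase. Since the symbol may appear in the
middle of such a cycle, the second part compares outputs by the prefix order only. -/
theorem exists_machine_of_io [Primcodable σ] (s₀ : σ) {o : σ → Option (Option (Fin n))}
    {a : σ → Bool} {upd : σ × Option (Option (Fin n)) → σ} (ho : Computable o) (ha : Computable a)
    (hupd : Computable upd) :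
    ∃ M : Machine n, ∀ {D : Type*} (enc : D → List (Fin n)) (x : ℕ → D),
      (∀ m, ∃ t, (M.run enc x t).pos = ((ioStep o a upd (inputCell enc x))^[m] ⟨s₀, 0, []⟩).pos ∧
        (M.run enc x t).out = ((ioStep o a upd (inputCell enc x))^[m] ⟨s₀, 0, []⟩).out) ∧
      (∀ t, ∃ m, (M.run enc x t).out <+:
        ((ioStep o a upd (inputCell enc x))^[m] ⟨s₀, 0, []⟩).out) := by
  obtain ⟨M, hM⟩ := exists_machine_of_control (n := n) (ioFun s₀ o a upd)
    (computable_ioFun s₀ ho ha hupd) ioControl .boot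
  refine ⟨M, fun {D} enc x => ?_⟩
  obtain ⟨h1, h2⟩ := hM enc x
  set cell := inputCell enc x
  set A := fun m => (ctlStep (ioFun s₀ o a upd) ioControl cell)^[m] ⟨.boot, 0, 0, []⟩ with hA
  set B := fun m => (ioStep o a upd cell)^[m] ⟨s₀, 0, []⟩ with hB
  have hAs : ∀ m, A (m + 1) = ctlStep (ioFun s₀ o a upd) ioControl cell (A m) :=
    fun m => Function.iterate_succ_apply' _ _ _
  have hBs : ∀ m, B (m + 1) = ioStep o a upd cell (B m) :=
    fun m => Function.iterate_succ_apply' _ _ _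
  have hmono : ∀ m k, (A m).out <+: (A (m + k)).out := by
    intro m k
    induction k with
    | zero => exact List.prefix_rfl
    | succ k ih =>
      refine ih.trans ?_
      rw [← Nat.add_assoc, hAs]
      exact List.prefix_append _ _
  -- In phase `emit j` the output symbol has already been written exactly when its index is below
  -- `j`. At most one index matches, so it is written once.
  have hemit : ∀ (s : σ) (k p : ℕ) (out : List (Option (Fin n))),
      (∃ m, A k = ⟨.emit 0, m, p, out⟩ ∧ m.div2 = Encodable.encode s) →
      ∀ j, (hj : j < n + 1) → ∃ m, A (k + j) = ⟨.emit ⟨j, hj⟩, m, p,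
        out ++ if ∃ i : Fin (n + 1), i.1 < j ∧ o s = some (finSuccEquiv n i) then (o s).toList
          else []⟩ ∧ m.div2 = Encodable.encode s := by
    rintro s k p out ⟨m, hk, hm⟩ j hj
    induction j with
    | zero => exact ⟨m, by simpa using hk, hm⟩
    | succ j ih =>
      obtain ⟨m', hk', hm'⟩ := ih (by omega)
      have hs : memState s₀ m' = s := by simp [memState, hm']
      refine ⟨ioFun s₀ o a upd (.emit ⟨j, by omega⟩) m', ?_, ?_⟩
      · rw [← Nat.add_assoc, hAs, hk']
        simp only [ctlStep, ioControl, CtlCfg.mk.injEq]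
        refine ⟨by simp [hj], trivial, by simp, ?_⟩
        simp only [ioFun, hs, List.append_assoc, List.append_cancel_left_eq]
        by_cases h : o s = some (finSuccEquiv n ⟨j, by omega⟩)
        · have hn : ¬ ∃ i : Fin (n + 1), i.1 < j ∧ o s = some (finSuccEquiv n i) := by
            rintro ⟨i, hi, he⟩
            rw [h, Option.some.injEq, EmbeddingLike.apply_eq_iff_eq] at he
            simp [← he] at hi
          have hy : ∃ i : Fin (n + 1), i.1 < j + 1 ∧ o s = some (finSuccEquiv n i) :=
            ⟨⟨j, by omega⟩, by simp, h⟩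
          rw [if_neg hn, if_pos hy]
          simp [h]
        · have hiff : (∃ i : Fin (n + 1), i.1 < j + 1 ∧ o s = some (finSuccEquiv n i)) ↔
              ∃ i : Fin (n + 1), i.1 < j ∧ o s = some (finSuccEquiv n i) := by
            constructor
            · rintro ⟨i, hi, he⟩
              refine ⟨i, ?_, he⟩
              rcases Nat.lt_succ_iff_lt_or_eq.1 hi with h' | h'
              · exact h'
              · exact absurd (he.trans (by rw [show i = ⟨j, by omega⟩ from Fin.ext h'])) h
            · rintro ⟨i, hi, he⟩
              exact ⟨i, by omega, he⟩
          simp only [hiff]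
          simp [h]
      · simp only [ioFun]
        cases decide (o (memState s₀ m') = some (finSuccEquiv n ⟨j, by omega⟩)) <;> simp [hm']
  -- The length `n + 4` consists of `n + 1` queries for the output symbol and one step each for
  -- `adv`, `read` and `upd`.
  have hcycle : ∀ (k : ℕ) (c : IOCfg n σ),
      (∃ m, A k = ⟨.emit 0, m, c.pos, c.out⟩ ∧ m.div2 = Encodable.encode c.st) →
      ∃ m, A (k + (n + 4)) = ⟨.emit 0, m, (ioStep o a upd cell c).pos,
        (ioStep o a upd cell c).out⟩ ∧ m.div2 = Encodable.encode (ioStep o a upd cell c).st := by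
    intro k c hk
    obtain ⟨m, hm, hm2⟩ := hemit c.st k c.pos c.out hk n (by omega)
    have hs : ∀ m : ℕ, m.div2 = Encodable.encode c.st → memState s₀ m = c.st := by
      intro m h; simp [memState, h]
    obtain ⟨m1, h1, h1'⟩ : ∃ m, A (k + n + 1) = ⟨.adv, m, c.pos, c.out ++ (o c.st).toList⟩ ∧
        m.div2 = Encodable.encode c.st := by
      refine ⟨ioFun s₀ o a upd (.emit ⟨n, by omega⟩) m, ?_, ?_⟩
      · rw [hAs, hm]
        simp only [ctlStep, ioControl, CtlCfg.mk.injEq]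
        refine ⟨by simp, trivial, by simp, ?_⟩
        simp only [ioFun, hs m hm2, List.append_assoc, List.append_cancel_left_eq]
        by_cases h : o c.st = some (finSuccEquiv n ⟨n, by omega⟩)
        · have hn : ¬ ∃ i : Fin (n + 1), i.1 < n ∧ o c.st = some (finSuccEquiv n i) := by
            rintro ⟨i, hi, he⟩
            rw [h, Option.some.injEq, EmbeddingLike.apply_eq_iff_eq] at he
            simp [← he] at hi
          rw [if_neg hn]
          simp [h]
        · cases ho : o c.st with
          | none => simp
          | some b =>
            have hy : ∃ i : Fin (n + 1), i.1 < n ∧ some b = some (finSuccEquiv n i) := by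
              refine ⟨(finSuccEquiv n).symm b, ?_, by simp⟩
              rcases Nat.lt_succ_iff_lt_or_eq.1 ((finSuccEquiv n).symm b).2 with h' | h'
              · exact h'
              · exfalso
                apply h
                have : (⟨n, by omega⟩ : Fin (n + 1)) = (finSuccEquiv n).symm b := Fin.ext h'.symm
                rw [ho, this]; simp
            rw [if_pos hy]
            rw [ho] at h
            simp [h]
      · simp only [ioFun]
        cases decide (o (memState s₀ m) = some (finSuccEquiv n ⟨n, by omega⟩)) <;> simp [hm2]
    obtain ⟨m2, h2, h2'⟩ : ∃ m, A (k + n + 1 + 1) = ⟨.read, m, if a c.st then c.pos + 1 else c.pos,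
        c.out ++ (o c.st).toList⟩ ∧ m.div2 = Encodable.encode c.st := by
      refine ⟨ioFun s₀ o a upd .adv m1, ?_, ?_⟩
      · rw [hAs, h1]
        simp only [ctlStep, ioControl, CtlCfg.mk.injEq]
        refine ⟨trivial, trivial, ?_, by simp⟩
        simp only [ioFun, hs m1 h1']
        cases a c.st <;> simp
      · simp only [ioFun]
        cases a (memState s₀ m1) <;> simp [h1']
    have h3 : A (k + n + 1 + 1 + 1) =
        ⟨.upd (cell (if a c.st then c.pos + 1 else c.pos)), m2,
          if a c.st then c.pos + 1 else c.pos, c.out ++ (o c.st).toList⟩ := by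
      rw [hAs, h2]
      simp [ctlStep, ioControl, ioFun]
    refine ⟨2 * Encodable.encode (ioStep o a upd cell c).st, ?_, by simp⟩
    rw [show k + (n + 4) = k + n + 1 + 1 + 1 + 1 by omega, hAs, h3]
    simp [ctlStep, ioControl, ioFun, hs m2 h2', ioStep]
  have key : ∀ m, ∃ k ≥ m, ∃ m', A k = ⟨.emit 0, m', (B m).pos, (B m).out⟩ ∧
      m'.div2 = Encodable.encode (B m).st := by
    intro m
    induction m with
    | zero => exact ⟨1, by omega, 2 * Encodable.encode s₀, rfl, by simp [hB]⟩
    | succ m ih =>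
      obtain ⟨k, hk, hm⟩ := ih
      rw [hBs]
      exact ⟨k + (n + 4), by omega, hcycle k (B m) hm⟩
  constructor
  · intro m
    obtain ⟨k, -, m', hk, -⟩ := key m
    obtain ⟨t, ht1, ht2⟩ := h1 k
    refine ⟨t, ht1.trans ?_, ht2.trans ?_⟩
    · exact congrArg CtlCfg.pos hk
    · exact congrArg CtlCfg.out hk
  · intro t
    obtain ⟨m, -, hm⟩ := h2 t
    obtain ⟨k, hk, m', hk', -⟩ := key m
    refine ⟨m, ?_⟩
    rw [hm]
    obtain ⟨d, rfl⟩ := Nat.exists_eq_add_of_le hk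
    have := hmono m d
    rwa [hk'] at this

end InputOutput

end DataWord

/-! ### Algorithms that read and write whole letters. -/

namespace DataWord

section Online

variable {n : ℕ}

/-- States of the algorithm that works letter by letter: codes of the letters read so far, number of
letters written, search counter, part of the current letter, pending output, and whether a letter is
being read. -/
abbrev OnlineState (n : ℕ) : Type :=
  List ℕ × ℕ × ℕ × List (Fin n) × List (Option (Fin n)) × Bool

/-- The end of a letter has been read. -/
def onlineSeparator (s : OnlineState n) : OnlineState n :=
  (s.1 ++ [Encodable.encode s.2.2.2.1], s.2.1, s.2.2.1, [], [], false)

/-- A symbol of a letter has been read. -/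
def onlineSymbol (s : OnlineState n) (a : Fin n) : OnlineState n :=
  (s.1, s.2.1, s.2.2.1, s.2.2.2.1 ++ [a], [], true)

/-- No letter has been found. -/
def onlineFail (rd : ℕ × ℕ → Bool) (s : OnlineState n) : OnlineState n :=
  (s.1, s.2.1, s.2.2.1 + 1, [], [], rd (s.1.length, s.2.1))

/-- A letter to be written has been found. -/
def onlineLetter (s : OnlineState n) (w : List (Fin n)) : OnlineState n :=
  (s.1, s.2.1 + 1, 0, [], w.map some ++ [none], false)

/-- A pending symbol is written. -/
def onlineFlush (s : OnlineState n) : OnlineState n :=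
  (s.1, s.2.1, s.2.2.1, s.2.2.2.1, s.2.2.2.2.1.tail, s.2.2.2.2.2)

/-- The reaction to an input symbol while a letter is being read. -/
def onlineRead (s : OnlineState n) (b : Option (Option (Fin n))) : OnlineState n :=
  Option.casesOn b s fun b => Option.casesOn b (onlineSeparator s) (onlineSymbol s)

/-- The search for the next letter to be written. -/
def onlineSearch (chk : List ℕ × ℕ × ℕ → Option (List (Fin n))) (rd : ℕ × ℕ → Bool)
    (s : OnlineState n) : OnlineState n :=
  Option.casesOn (chk (s.1, s.2.1, s.2.2.1)) (onlineFail rd s) (onlineLetter s)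

/-- The update function of the algorithm that works letter by letter. -/
def onlineUpd (chk : List ℕ × ℕ × ℕ → Option (List (Fin n))) (rd : ℕ × ℕ → Bool)
    (p : OnlineState n × Option (Option (Fin n))) : OnlineState n :=
  bif p.1.2.2.2.2.1.head?.isSome then onlineFlush p.1
  else bif p.1.2.2.2.2.2 then onlineRead p.1 p.2 else onlineSearch chk rd p.1

theorem computable_onlineSeparator : Computable (onlineSeparator (n := n)) := by
  have s2 := Computable.snd (α := List ℕ) (β := ℕ × ℕ × List (Fin n) × List (Option (Fin n)) × Bool)
  have s3 := Computable.snd.comp s2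
  exact (Computable.list_concat.comp Computable.fst
    (Computable.encode.comp (Computable.fst.comp (Computable.snd.comp s3)))).pair
    ((Computable.fst.comp s2).pair ((Computable.fst.comp s3).pair (Computable.const ([], [], false))))

theorem computable_onlineSymbol : Computable₂ (onlineSymbol (n := n)) := by
  have s1 := Computable.fst (α := OnlineState n) (β := Fin n)
  have s2 := Computable.snd.comp s1
  have s3 := Computable.snd.comp s2
  exact (Computable.fst.comp s1).pair ((Computable.fst.comp s2).pair ((Computable.fst.comp s3).pair
    ((Computable.list_concat.comp (Computable.fst.comp (Computable.snd.comp s3)) Computable.snd).pair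
      (Computable.const ([], true)))))

theorem computable_onlineFail {rd : ℕ × ℕ → Bool} (hrd : Computable rd) :
    Computable (onlineFail (n := n) rd) := by
  have s1 := Computable.fst (α := List ℕ) (β := ℕ × ℕ × List (Fin n) × List (Option (Fin n)) × Bool)
  have s2 := Computable.snd (α := List ℕ) (β := ℕ × ℕ × List (Fin n) × List (Option (Fin n)) × Bool)
  have i := Computable.fst.comp s2
  have s3 := Computable.snd.comp s2
  exact s1.pair (i.pair ((Computable.succ.comp (Computable.fst.comp s3)).pair
    ((Computable.const []).pair ((Computable.const []).pair
      (hrd.comp ((Computable.list_length.comp s1).pair i))))))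

theorem computable_onlineLetter : Computable₂ (onlineLetter (n := n)) := by
  have s1 := Computable.fst (α := OnlineState n) (β := List (Fin n))
  have s2 := Computable.snd.comp s1
  have h : Computable fun w : List (Fin n) => w.map some ++ [none] :=
    Computable.list_concat.comp (Primrec.list_map Primrec.id
      (Primrec.option_some.comp Primrec.snd).to₂).to_comp (Computable.const none)
  exact (Computable.fst.comp s1).pair ((Computable.succ.comp (Computable.fst.comp s2)).pair
    ((Computable.const 0).pair ((Computable.const []).pair
      ((h.comp Computable.snd).pair (Computable.const false)))))

theorem computable_onlineFlush : Computable (onlineFlush (n := n)) := by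
  have s2 := Computable.snd (α := List ℕ) (β := ℕ × ℕ × List (Fin n) × List (Option (Fin n)) × Bool)
  have s3 := Computable.snd.comp s2
  have s4 := Computable.snd.comp s3
  have s5 := Computable.snd.comp s4
  exact Computable.fst.pair ((Computable.fst.comp s2).pair ((Computable.fst.comp s3).pair
    ((Computable.fst.comp s4).pair ((Primrec.list_tail.to_comp.comp (Computable.fst.comp s5)).pair
      (Computable.snd.comp s5)))))

theorem Computable.option_option_casesOn {α β : Type*} [Primcodable α] [Primcodable β] {f : α → α}
    {g : α → β → α} (hf : Computable f) (hg : Computable₂ g) :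
    Computable₂ fun (s : α) (b : Option (Option β)) =>
      (Option.casesOn b s fun b => Option.casesOn b (f s) (g s) : α) := by
  have s1 : Computable fun p : (α × Option (Option β)) × Option β => p.1.1 :=
    Computable.fst.comp Computable.fst
  have h := Computable.option_casesOn
    (o := fun p : (α × Option (Option β)) × Option β => p.2)
    (f := fun p => f p.1.1) (g := fun p a => g p.1.1 a) Computable.snd
    (hf.comp s1) (hg.comp (s1.comp Computable.fst) Computable.snd)
  exact Computable.option_casesOn (o := fun p : α × Option (Option β) => p.2)
    (f := fun p => p.1) (g := fun p b => (Option.casesOn b (f p.1) (fun a => g p.1 a) : α))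
    Computable.snd Computable.fst (show Computable _ from h)

theorem computable_onlineRead : Computable₂ (onlineRead (n := n)) :=
  Computable.option_option_casesOn computable_onlineSeparator computable_onlineSymbol

theorem computable_onlineSearch {chk : List ℕ × ℕ × ℕ → Option (List (Fin n))} {rd : ℕ × ℕ → Bool}
    (hchk : Computable chk) (hrd : Computable rd) : Computable (onlineSearch chk rd) := by
  have s2 := Computable.snd (α := List ℕ) (β := ℕ × ℕ × List (Fin n) × List (Option (Fin n)) × Bool)
  exact Computable.option_casesOn (o := fun s : OnlineState n => chk (s.1, s.2.1, s.2.2.1))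
    (hchk.comp (Computable.fst.pair ((Computable.fst.comp s2).pair
      (Computable.fst.comp (Computable.snd.comp s2)))))
    (computable_onlineFail hrd) (g := onlineLetter) computable_onlineLetter

theorem computable_onlineUpd {chk : List ℕ × ℕ × ℕ → Option (List (Fin n))} {rd : ℕ × ℕ → Bool}
    (hchk : Computable chk) (hrd : Computable rd) : Computable (onlineUpd chk rd) := by
  have s1 := Computable.fst (α := OnlineState n) (β := Option (Option (Fin n)))
  have s5 := Computable.snd.comp (Computable.snd.comp (Computable.snd.comp (Computable.snd.comp s1)))
  exact Computable.cond (Primrec.option_isSome.to_comp.comp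
      (Primrec.list_head?.to_comp.comp (Computable.fst.comp s5)))
    (computable_onlineFlush.comp s1)
    (Computable.cond (Computable.snd.comp s5) computable_onlineRead
      ((computable_onlineSearch hchk hrd).comp s1))

/-- Configurations of an online algorithm: number of letters read, number of letters written, search
counter, content of the output tape. -/
structure LetterCfg (n : ℕ) where
  read : ℕ
  written : ℕ
  counter : ℕ
  out : List (Option (Fin n))

/-- The codes of the first `j` letters of `x`. -/
def letterCodes {D : Type*} (enc : D → List (Fin n)) (x : ℕ → D) (j : ℕ) : List ℕ :=
  (List.range j).map fun s => Encodable.encode (enc (x s))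

@[simp] theorem length_letterCodes {D : Type*} (enc : D → List (Fin n)) (x : ℕ → D) (j : ℕ) :
    (letterCodes enc x j).length = j := by
  simp [letterCodes]

theorem letterCodes_succ {D : Type*} (enc : D → List (Fin n)) (x : ℕ → D) (j : ℕ) :
    letterCodes enc x (j + 1) = letterCodes enc x j ++ [Encodable.encode (enc (x j))] := by
  simp [letterCodes, List.range_succ]

/-- One step of an online algorithm: write a letter if `chk` finds one, otherwise increase the search
counter and read a letter if `rd` says so. -/
def letterStep (chk : List ℕ × ℕ × ℕ → Option (List (Fin n))) (rd : ℕ × ℕ → Bool)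
    {D : Type*} (enc : D → List (Fin n)) (x : ℕ → D) (c : LetterCfg n) : LetterCfg n :=
  match chk (letterCodes enc x c.read, c.written, c.counter) with
  | some w => ⟨c.read, c.written + 1, 0, c.out ++ (w.map some ++ [none])⟩
  | none => ⟨if rd (c.read, c.written) then c.read + 1 else c.read, c.written, c.counter + 1, c.out⟩

section EncPrefix

variable {D : Type*} (enc : D → List (Fin n)) (x : ℕ → D)

theorem encPrefix_succ (k : ℕ) :
    encPrefix enc x (k + 1) = encPrefix enc x k ++ ((enc (x k)).map some ++ [none]) := by
  simp [encPrefix, List.range_succ]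

theorem encPrefix_prefix {k l : ℕ} (h : k ≤ l) : encPrefix enc x k <+: encPrefix enc x l := by
  induction l, h using Nat.le_induction with
  | base => exact List.prefix_rfl
  | succ l _ ih => rw [encPrefix_succ]; exact ih.trans (List.prefix_append _ _)

theorem le_length_encPrefix (k : ℕ) : k ≤ (encPrefix enc x k).length := by
  induction k with
  | zero => simp
  | succ k ih => rw [encPrefix_succ]; simp; omega

/-- The definition looks the cell up in the encoding of `p + 1` letters; any other prefix that is
long enough agrees with it. -/
theorem inputCell_succ {p k : ℕ} (h : p < (encPrefix enc x k).length) :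
    inputCell enc x (p + 1) = (encPrefix enc x k)[p]? := by
  have h1 : p < (encPrefix enc x (p + 1)).length := le_length_encPrefix enc x (p + 1)
  simp only [inputCell]
  rcases le_total k (p + 1) with hk | hk
  · obtain ⟨t, ht⟩ := encPrefix_prefix enc x hk
    rw [← ht, List.getElem?_append_left h]
  · obtain ⟨t, ht⟩ := encPrefix_prefix enc x hk
    rw [← ht, List.getElem?_append_left h1]

end EncPrefix

/-- A letter step is expanded into symbol steps by two loops, one emptying the queue of pending
symbols and one filling the buffer up to the next separator. The head position is tracked exactly
between letter steps because the moduli count letters read. -/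
theorem exists_machine_of_online {chk : List ℕ × ℕ × ℕ → Option (List (Fin n))} {rd : ℕ × ℕ → Bool}
    (hchk : Computable chk) (hrd : Computable rd) :
    ∃ M : Machine n, ∀ {D : Type*} (enc : D → List (Fin n)) (x : ℕ → D),
      (∀ k, ∃ t, (M.run enc x t).pos =
          (encPrefix enc x ((letterStep chk rd enc x)^[k] ⟨0, 0, 0, []⟩).read).length ∧
        (M.run enc x t).out = ((letterStep chk rd enc x)^[k] ⟨0, 0, 0, []⟩).out) ∧
      (∀ t, ∃ k, (M.run enc x t).out <+:
        ((letterStep chk rd enc x)^[k] ⟨0, 0, 0, []⟩).out) := by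
  let o : OnlineState n → Option (Option (Fin n)) := fun s => s.2.2.2.2.1.head?
  let a : OnlineState n → Bool := fun s => s.2.2.2.2.1.head?.isNone && s.2.2.2.2.2
  have s5 : Computable fun s : OnlineState n => s.2.2.2.2 :=
    Computable.snd.comp (Computable.snd.comp (Computable.snd.comp Computable.snd))
  have ho : Computable o := Primrec.list_head?.to_comp.comp (Computable.fst.comp s5)
  have ha : Computable a := by
    have h : Primrec fun o : Option (Option (Fin n)) => o.isNone :=
      (Primrec.not.comp Primrec.option_isSome).of_eq fun o => by cases o <;> rfl
    exact Primrec.and.to_comp.comp (h.to_comp.comp ho) (Computable.snd.comp s5)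
  obtain ⟨M, hM⟩ := exists_machine_of_io (([], 0, 0, [], [], false) : OnlineState n) ho ha
    (computable_onlineUpd hchk hrd)
  refine ⟨M, fun {D} enc x => ?_⟩
  obtain ⟨h1, h2⟩ := hM enc x
  set step := ioStep o a (onlineUpd chk rd) (inputCell enc x) with hstep
  set B := fun m => step^[m] ⟨([], 0, 0, [], [], false), 0, []⟩ with hB
  set A := fun k => (letterStep chk rd enc x)^[k] ⟨0, 0, 0, []⟩ with hA
  have hAs : ∀ m, A (m + 1) = letterStep chk rd enc x (A m) :=
    fun m => Function.iterate_succ_apply' _ _ _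
  have hBs : ∀ m, B (m + 1) = step (B m) := fun m => Function.iterate_succ_apply' _ _ _
  have hmono : ∀ m k, (B m).out <+: (B (m + k)).out := by
    intro m k
    induction k with
    | zero => exact List.prefix_rfl
    | succ k ih =>
      refine ih.trans ?_
      rw [← Nat.add_assoc, hBs]
      exact List.prefix_append _ _
  have hflush : ∀ (q : List (Option (Fin n))) u i c buf p out m,
      B m = ⟨(u, i, c, buf, q, false), p, out⟩ →
      B (m + q.length) = ⟨(u, i, c, buf, [], false), p, out ++ q⟩ := by
    intro q
    induction q with
    | nil => intro u i c buf p out m h; simpa using h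
    | cons s q ih =>
      intro u i c buf p out m h
      have : B (m + 1) = ⟨(u, i, c, buf, q, false), p, out ++ [s]⟩ := by
        rw [hBs, h]; simp [hstep, ioStep, o, a, onlineUpd, onlineFlush]
      have := ih _ _ _ _ _ _ _ this
      rw [List.length_cons, Nat.add_comm q.length, ← Nat.add_assoc, this]
      simp
  have hread : ∀ (w2 w1 : List (Fin n)) u i c p out m,
      B m = ⟨(u, i, c, w1, [], true), p, out⟩ →
      (∀ k, (hk : k < w2.length) → inputCell enc x (p + k + 1) = some (some w2[k])) →
      B (m + w2.length) = ⟨(u, i, c, w1 ++ w2, [], true), p + w2.length, out⟩ := by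
    intro w2
    induction w2 with
    | nil => intro w1 u i c p out m h _; simpa using h
    | cons s w2 ih =>
      intro w1 u i c p out m h hc
      have h0 := hc 0 (by simp)
      have : B (m + 1) = ⟨(u, i, c, w1 ++ [s], [], true), p + 1, out⟩ := by
        rw [hBs, h]
        simp only [Nat.add_zero, List.getElem_cons_zero] at h0
        simp [hstep, ioStep, o, a, onlineUpd, onlineRead, onlineSymbol, h0]
      have := ih _ _ _ _ _ _ _ this fun k hk => by
        have := hc (k + 1) (by simpa using hk)
        rw [show p + 1 + k + 1 = p + (k + 1) + 1 by omega]
        simpa using this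
      rw [List.length_cons, Nat.add_comm w2.length, ← Nat.add_assoc, this]
      simp only [List.append_assoc, List.cons_append, List.nil_append, IOCfg.mk.injEq, true_and,
        and_true]
      omega
  -- Between letter steps the head rests on the last separator read. Cell `0` is the start marker,
  -- so the number of that cell is the length of the encoding read.
  have key : ∀ k, ∃ m ≥ k, B m = ⟨(letterCodes enc x (A k).read, (A k).written, (A k).counter, [], [],
      false), (encPrefix enc x (A k).read).length, (A k).out⟩ := by
    intro k
    induction k with
    | zero => exact ⟨0, le_rfl, rfl⟩
    | succ k ih =>
      obtain ⟨m, hmk, hm⟩ := ih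
      rw [hAs]
      have hnext := hBs m
      rw [hm] at hnext
      cases hchk : chk (letterCodes enc x (A k).read, (A k).written, (A k).counter) with
      | some w =>
        have h3 : B (m + 1) = ⟨(letterCodes enc x (A k).read, (A k).written + 1, 0, [],
            w.map some ++ [none], false), (encPrefix enc x (A k).read).length, (A k).out⟩ := by
          rw [hnext]; simp [hstep, ioStep, o, a, onlineUpd, onlineSearch, onlineLetter, hchk]
        refine ⟨_, ?_, (hflush _ _ _ _ _ _ _ _ h3).trans ?_⟩
        · omega
        · simp [letterStep, hchk]
      | none =>
        have h3 : B (m + 1) = ⟨(letterCodes enc x (A k).read, (A k).written, (A k).counter + 1, [],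
            [], rd ((A k).read, (A k).written)), (encPrefix enc x (A k).read).length, (A k).out⟩ := by
          rw [hnext]; simp [hstep, ioStep, o, a, onlineUpd, onlineSearch, onlineFail, hchk]
        cases hrd : rd ((A k).read, (A k).written) with
        | false =>
          refine ⟨m + 1, by omega, h3.trans ?_⟩
          simp [letterStep, hchk, hrd]
        | true =>
          rw [hrd] at h3
          set j := (A k).read with hj
          have hcell : ∀ k', k' < (enc (x j)).length + 1 →
              inputCell enc x ((encPrefix enc x j).length + k' + 1) =
                ((enc (x j)).map some ++ [none])[k']? := by
            intro k' hk'
            rw [inputCell_succ (k := j + 1)]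
            · rw [encPrefix_succ, List.getElem?_append_right (by omega)]
              simp
            · rw [encPrefix_succ]; simp; omega
          have h4 := hread (enc (x j)) _ _ _ _ _ _ _ h3 fun k' hk' => by
            rw [hcell k' (by omega), List.getElem?_append_left (by simpa using hk')]
            simp [hk']
          have h5 := hBs (m + 1 + (enc (x j)).length)
          rw [h4] at h5
          have h6 := hcell (enc (x j)).length (by omega)
          rw [List.getElem?_append_right (by simp)] at h6
          refine ⟨_, ?_, h5.trans ?_⟩
          · omega
          · simp only [List.length_map, Nat.sub_self, List.getElem?_cons_zero] at h6
            have h7 : letterStep chk rd enc x (A k) =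
                ⟨j + 1, (A k).written, (A k).counter + 1, (A k).out⟩ := by
              simp [letterStep, ← hj, hchk, hrd]
            rw [h7]
            simp [hstep, ioStep, o, a, onlineUpd, onlineRead, onlineSeparator, h6, encPrefix_succ,
              letterCodes_succ]
            omega
  constructor
  · intro k
    obtain ⟨m, -, hm⟩ := key k
    obtain ⟨t, ht1, ht2⟩ := h1 m
    exact ⟨t, ht1.trans (congrArg IOCfg.pos hm), ht2.trans (congrArg IOCfg.out hm)⟩
  · intro t
    obtain ⟨m, hm⟩ := h2 t
    obtain ⟨k, hk, hk'⟩ := key m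
    obtain ⟨d, rfl⟩ := Nat.exists_eq_add_of_le hk
    have := hmono m d
    rw [hk'] at this
    exact ⟨m, hm.trans this⟩

end Online

end DataWord

/-! ### The output of a machine depends only on the part of the input that it has read. -/

namespace DataWord

section Locality

variable {D : Type*} {n : ℕ} {enc : D → List (Fin n)}

theorem encPrefix_congr {x y : ℕ → D} {k : ℕ} (h : Agree k x y) :
    encPrefix enc x k = encPrefix enc y k := by
  unfold encPrefix
  congr 1
  exact List.map_congr_left fun i hi => by rw [h i (List.mem_range.1 hi)]

theorem inputCell_congr {x y : ℕ → D} {k : ℕ} (h : Agree k x y) {p : ℕ}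
    (hp : p ≤ (encPrefix enc x k).length) : inputCell enc x p = inputCell enc y p := by
  have he := encPrefix_congr (enc := enc) h
  cases p with
  | zero => rfl
  | succ p => rw [inputCell_succ enc x hp, inputCell_succ enc y (he ▸ hp), he]

theorem Machine.run_pos_mono (M : Machine n) (x : ℕ → D) {s t : ℕ} (h : s ≤ t) :
    (M.run enc x s).pos ≤ (M.run enc x t).pos := by
  induction t, h using Nat.le_induction with
  | base => exact le_rfl
  | succ t _ ih =>
    refine ih.trans ?_
    simp only [Machine.run, Machine.next]
    split <;> omega

/-- The head never moves left, so a bound on its position at time `t` covers every cell inspected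
before. -/
theorem Machine.run_congr (M : Machine n) {x y : ℕ → D} {k : ℕ} (h : Agree k x y) {t : ℕ}
    (ht : (M.run enc x t).pos ≤ (encPrefix enc x k).length) : M.run enc x t = M.run enc y t := by
  induction t with
  | zero => rfl
  | succ t ih =>
    have hp := (M.run_pos_mono (enc := enc) x (Nat.le_succ t)).trans ht
    simp only [Machine.run, Machine.next]
    rw [← ih hp, inputCell_congr h hp]

theorem count_encPrefix (x : ℕ → D) (k : ℕ) : (encPrefix enc x k).count none = k := by
  induction k with
  | zero => rfl
  | succ k ih =>
    have : ((enc (x k)).map some).count none = 0 := List.count_eq_zero.2 (by simp)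
    rw [encPrefix_succ, List.count_append, List.count_append, ih, this]
    simp

/-- A prefix of an encoding that has at least `i` separators extends the encoding of `i` letters. -/
theorem encPrefix_prefix_of_count {x : ℕ → D} {l i : ℕ} {u : List (Option (Fin n))}
    (hu : u <+: encPrefix enc x l) (hi : i ≤ u.count none) : encPrefix enc x i <+: u := by
  have hil : i ≤ l := hi.trans ((List.IsPrefix.sublist hu).count_le none |>.trans_eq (count_encPrefix x l))
  rcases List.prefix_or_prefix_of_prefix (encPrefix_prefix enc x hil) hu with h | h
  · exact h
  · cases i with
    | zero => simp [encPrefix]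
    | succ i =>
      rw [encPrefix_succ, ← List.append_assoc] at h ⊢
      -- A proper prefix of the encoding of `i + 1` letters misses the last separator and has too
      -- few of them.
      rcases (List.prefix_concat_iff.1 h) with h' | h'
      · rw [h']
      · have h1 := (List.IsPrefix.sublist h').count_le none
        have : ((enc (x i)).map some).count none = 0 := List.count_eq_zero.2 (by simp)
        rw [List.count_append, count_encPrefix, this] at h1
        omega

/-- The separators make the encoding uniquely parsable, and injectivity of `enc` recovers the
letters. -/
theorem agree_of_encPrefix (henc : Function.Injective enc) {x y : ℕ → D} {i l : ℕ}
    (h : encPrefix enc x i <+: encPrefix enc y l) : Agree i x y := by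
  induction i with
  | zero => exact fun j hj => absurd hj (Nat.not_lt_zero j)
  | succ i ih =>
    have hi := ih ((encPrefix_prefix enc x (Nat.le_succ i)).trans h)
    have h1 : encPrefix enc y (i + 1) <+: encPrefix enc x (i + 1) :=
      encPrefix_prefix_of_count h (count_encPrefix x (i + 1)).ge
    rw [encPrefix_succ, encPrefix_succ, encPrefix_congr hi, List.prefix_append_right_inj,
      List.prefix_concat_iff] at h1
    have h2 : enc (y i) = enc (x i) := by
      rcases h1 with h1 | h1
      · simpa [List.map_inj_right (Option.some_injective _)] using h1
      · have := h1.subset (List.mem_append_right _ (List.mem_singleton_self none))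
        simp at this
    intro j hj
    rcases Nat.lt_succ_iff_lt_or_eq.1 hj with hj | rfl
    · exact hi j hj
    · exact (henc h2).symm

variable {f : (ℕ → D) →. (ℕ → D)} {M : Machine n}

theorem Machine.Computes.agree (henc : Function.Injective enc) (hM : M.Computes enc f)
    {x y x' y' : ℕ → D} (hx : x' ∈ f x) (hy : y' ∈ f y) {k i t : ℕ} (h : Agree k x y)
    (ht : (M.run enc x t).pos ≤ (encPrefix enc x k).length)
    (hi : i ≤ (M.run enc x t).out.count none) : Agree i x' y' := by
  obtain ⟨l, hl⟩ := (hM x x' hx).1 t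
  obtain ⟨l', hl'⟩ := (hM y y' hy).1 t
  rw [← M.run_congr h ht] at hl'
  exact agree_of_encPrefix henc ((encPrefix_prefix_of_count hl hi).trans hl')

end Locality

/-! ### Computability implies continuity. -/

section Converse

variable {L : Language} {D : Type*} [L.Structure D] {ρ : Representation L D}
  {f : (ℕ → D) →. (ℕ → D)}

theorem IsComputable.isContinuous (h : IsComputable ρ f) : IsContinuous f := by
  obtain ⟨M, hM⟩ := h
  intro x x' hx i
  obtain ⟨t, ht⟩ := (hM x x' hx).2 i
  have hi := (List.IsPrefix.sublist ht).count_le none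
  rw [count_encPrefix] at hi
  -- Every letter occupies at least one cell, so the position of the head bounds the number of
  -- letters on which the output so far depends.
  exact ⟨(M.run ρ.enc x t).pos, fun y y' hy hxy => hM.agree ρ.enc_injective hx hy hxy
    (le_length_encPrefix ρ.enc x _) hi⟩

theorem IsMComputable.isMContinuous {m : ℕ → ℕ} (h : IsMComputable ρ f m) : IsMContinuous f m := by
  obtain ⟨M, hM, hm⟩ := h
  intro i x x' hx y y' hy hxy
  obtain ⟨t, ht, hi⟩ := hm i x (Part.dom_iff_mem.2 ⟨x', hx⟩)
  exact hM.agree ρ.enc_injective hx hy hxy ht hi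

theorem IsUniformlyComputable.isUniformlyContinuous (h : IsUniformlyComputable ρ f) :
    IsUniformlyContinuous f := by
  obtain ⟨m, -, hm⟩ := h
  exact ⟨m, hm.isMContinuous⟩

end Converse

end DataWord

/-! ### Compactness from oligomorphicity. -/

namespace DataWord

section Orbits

variable {L : Language} {D : Type*} [L.Structure D]

/-- Pigeonhole principle: some orbit contains infinitely many of the tuples. -/
theorem exists_infinite_orbit (hD : Oligomorphic L D) {X : Type*} [Finite X] (v : ℕ → X → D) :
    ∃ N₀, ∀ N, ∃ N' ≥ N, ∃ μ : D ≃[L] D, ∀ x, μ (v N' x) = v N₀ x := by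
  obtain ⟨m, ⟨ε⟩⟩ := Finite.exists_equiv_fin X
  have := hD m
  let c : ℕ → Orbits L D m := fun N => Quotient.mk (orbitSetoid L D m) (v N ∘ ε.symm)
  obtain ⟨o, ho⟩ := Finite.exists_infinite_fiber c
  have hinf : (c ⁻¹' {o}).Infinite := Set.infinite_coe_iff.1 ho
  obtain ⟨N₀, hN₀⟩ := hinf.nonempty
  refine ⟨N₀, fun N => ?_⟩
  obtain ⟨N', hN', hle⟩ := hinf.exists_gt N
  obtain ⟨μ, hμ⟩ := Quotient.exact (s := orbitSetoid L D m) (hN'.trans hN₀.symm : c N' = c N₀)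
  exact ⟨N', hle.le, μ, fun x => by simpa using hμ (ε x)⟩

/-- Over an oligomorphic structure, the witnesses of an invariant property can be bounded. -/
theorem exists_bound_of_invariant (hD : Oligomorphic L D) {X : Type*} [Finite X]
    {S : ℕ → (X → D) → Prop} (hS : ∀ (μ : D ≃[L] D) l v, S l v → S l (μ ∘ v)) :
    ∃ K, ∀ v, (∃ l, S l v) → ∃ l ≤ K, S l v := by
  by_contra! h
  choose v hv hn using h
  choose l hl using hv
  obtain ⟨N₀, hN₀⟩ := exists_infinite_orbit hD v
  -- The tuple `v N'` was chosen without witnesses up to `N'`, yet it inherits from `v N₀` the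
  -- witness `l N₀ ≤ N'`.
  obtain ⟨N', hN', μ, hμ⟩ := hN₀ (l N₀)
  have : v N' = μ.symm ∘ v N₀ := by
    funext x
    simp only [Function.comp_apply, ← hμ x]
    exact (μ.toEquiv.symm_apply_apply _).symm
  exact hn N' (l N₀) hN' (this ▸ hS _ _ _ (hl N₀))

/-- König's lemma for invariant properties of sequences of tuples over an oligomorphic structure. -/
theorem exists_limit_of_invariant (hD : Oligomorphic L D) {X : Type*} [Finite X]
    {P : ℕ → (ℕ → X → D) → Prop} (hinv : ∀ (μ : D ≃[L] D) n v, P n v → P n fun s => μ ∘ v s)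
    (hanti : ∀ n v, P (n + 1) v → P n v) (hloc : ∀ n v w, (∀ s < n, v s = w s) → P n v → P n w)
    (hne : ∀ n, ∃ v, P n v) : ∃ v, ∀ n, P n v := by
  have hanti' : ∀ {m n} v, m ≤ n → P n v → P m v := by
    intro m n v hmn
    induction n, hmn using Nat.le_induction with
    | base => exact id
    | succ n _ ih => exact fun h => ih (hanti n v h)
  -- The nodes of the tree with solutions of every depth above them. Infinitely many children are
  -- possible, but only finitely many up to automorphism.
  let E : ℕ → (ℕ → X → D) → Prop := fun n v => ∀ N, ∃ w, P N w ∧ ∀ s < n, w s = v s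
  have hE : ∀ n v, E n v → ∃ w, E (n + 1) w ∧ ∀ s < n, w s = v s := by
    intro n v h
    choose w hw hwv using h
    -- The prefixes of length `n + 1` of the solutions recur in one orbit. Moving deep solutions by
    -- automorphisms gives them all the prefix of `w N₀`, which still extends `v`.
    obtain ⟨N₀, hN₀⟩ := exists_infinite_orbit hD fun N (p : Fin (n + 1) × X) => w N p.1 p.2
    refine ⟨w N₀, fun N => ?_, hwv N₀⟩
    obtain ⟨N', hN', μ, hμ⟩ := hN₀ N
    refine ⟨fun s => μ ∘ w N' s, hinv _ _ _ (hanti' _ hN' (hw N')), fun s hs => ?_⟩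
    exact funext fun x => hμ (⟨s, hs⟩, x)
  choose! g hg hgv using hE
  obtain ⟨v₀, -⟩ := hne 0
  let V : ℕ → ℕ → X → D := fun n => Nat.rec v₀ (fun n v => g n v) n
  have hV : ∀ n, E n (V n) := by
    intro n
    induction n with
    | zero => exact fun N => (hne N).imp fun w hw => ⟨hw, fun s hs => absurd hs (Nat.not_lt_zero s)⟩
    | succ n ih => exact hg n _ ih
  have hVs : ∀ m n, m ≤ n → ∀ s < m, V n s = V m s := by
    intro m n hmn
    induction n, hmn using Nat.le_induction with
    | base => exact fun _ _ => rfl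
    | succ n hmn ih => exact fun s hs => (hgv n _ (hV n) s (hs.trans_le hmn)).trans (ih s hs)
  refine ⟨fun s => V (s + 1) s, fun n => ?_⟩
  obtain ⟨w, hw, hwv⟩ := hV n n
  exact hloc n w _ (fun s hs => (hwv s hs).trans (hVs (s + 1) n hs s (Nat.lt_succ_self s))) hw

end Orbits

end DataWord

/-! ### Register automata with numbered transitions, and finite runs. -/

namespace DataWord

/-- A register automaton with output whose transitions and registers are numbered. A rule relates
the old contents of the registers (`Sum.inl r`), the input data value (`Sum.inr none`) and the new
contents of the registers (`Sum.inr (some r)`). -/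
structure RegSys (L : Language) (Q : Type*) (nT k : ℕ) where
  src : Fin nT → Q
  tgt : Fin nT → Q
  q₀ : Q
  acc : Fin nT → Bool
  rule : Fin nT → L.Formula (Fin k ⊕ Option (Fin k))
  rule_isQF : ∀ t, (rule t).IsQF
  out : Fin nT → List (Fin k)
  init : Fin k → L.Constants

/-- A label of a run: a transition, the input data value, and the new contents of the registers. -/
abbrev Lbl (nT k : ℕ) (A : Type*) : Type _ := Fin nT × A × (Fin k → A)

namespace RegSys

variable {L : Language} {Q D : Type*} [L.Structure D] {nT k : ℕ} (σ : RegSys L Q nT k)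

/-- The transition `t` can be taken. -/
def Step (t : Fin nT) (r : Fin k → D) (d : D) (r' : Fin k → D) : Prop :=
  (σ.rule t).Realize (Sum.elim r fun o => o.elim d r')

/-- The configuration reached by a list of labels. -/
def after : Q × (Fin k → D) → List (Lbl nT k D) → Q × (Fin k → D)
  | C, [] => C
  | _, l :: e => after (σ.tgt l.1, l.2.2) e

/-- The list of labels is a run from the given configuration. -/
def Valid : Q × (Fin k → D) → List (Lbl nT k D) → Prop
  | _, [] => True
  | C, l :: e => σ.src l.1 = C.1 ∧ σ.Step l.1 C.2 l.2.1 l.2.2 ∧ Valid (σ.tgt l.1, l.2.2) e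

/-- The output of a list of labels. -/
def outs {A : Type*} (e : List (Lbl nT k A)) : List A := e.flatMap fun l => (σ.out l.1).map l.2.2

/-- The number of visits to final states. -/
def visits (e : List (Fin nT)) : ℕ := e.countP σ.acc

/-- The transitions of a list of labels. -/
def trs {A : Type*} (e : List (Lbl nT k A)) : List (Fin nT) := e.map Prod.fst

/-- The input of a list of labels. -/
def ins {A : Type*} (e : List (Lbl nT k A)) : List A := e.map fun l => l.2.1

/-- Application of a function to the data values of a label. -/
def mapLbl {A B : Type*} (μ : A → B) (l : Lbl nT k A) : Lbl nT k B := (l.1, μ l.2.1, μ ∘ l.2.2)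

variable {σ}

@[simp] theorem valid_nil (C : Q × (Fin k → D)) : σ.Valid C [] := trivial

@[simp] theorem after_nil (C : Q × (Fin k → D)) : σ.after C [] = C := rfl

@[simp] theorem outs_nil {A : Type*} : σ.outs ([] : List (Lbl nT k A)) = [] := rfl

@[simp] theorem visits_nil : σ.visits [] = 0 := rfl

theorem after_append (C : Q × (Fin k → D)) (e e' : List (Lbl nT k D)) :
    σ.after C (e ++ e') = σ.after (σ.after C e) e' := by
  induction e generalizing C with
  | nil => rfl
  | cons l e ih => exact ih _

theorem valid_append {C : Q × (Fin k → D)} {e e' : List (Lbl nT k D)} :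
    σ.Valid C (e ++ e') ↔ σ.Valid C e ∧ σ.Valid (σ.after C e) e' := by
  induction e generalizing C with
  | nil => simp
  | cons l e ih => simp [Valid, ih, after, and_assoc]

@[simp] theorem outs_append {A : Type*} (e e' : List (Lbl nT k A)) :
    σ.outs (e ++ e') = σ.outs e ++ σ.outs e' := by simp [outs]

@[simp] theorem outs_cons {A : Type*} (l : Lbl nT k A) (e : List (Lbl nT k A)) :
    σ.outs (l :: e) = (σ.out l.1).map l.2.2 ++ σ.outs e := by simp [outs]

@[simp] theorem visits_append (e e' : List (Fin nT)) :
    σ.visits (e ++ e') = σ.visits e + σ.visits e' := by simp [visits]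

@[simp] theorem trs_append {A : Type*} (e e' : List (Lbl nT k A)) :
    trs (e ++ e') = trs e ++ trs e' := by simp [trs]

@[simp] theorem ins_append {A : Type*} (e e' : List (Lbl nT k A)) :
    ins (e ++ e') = ins e ++ ins e' := by simp [ins]

@[simp] theorem length_trs {A : Type*} (e : List (Lbl nT k A)) : (trs e).length = e.length := by
  simp [trs]

@[simp] theorem length_ins {A : Type*} (e : List (Lbl nT k A)) : (ins e).length = e.length := by
  simp [ins]

theorem outs_map {A B : Type*} (μ : A → B) (e : List (Lbl nT k A)) :
    σ.outs (e.map (mapLbl μ)) = (σ.outs e).map μ := by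
  induction e with
  | nil => rfl
  | cons l e ih => simp [ih, mapLbl]

@[simp] theorem trs_map {A B : Type*} (μ : A → B) (e : List (Lbl nT k A)) :
    trs (e.map (mapLbl μ)) = trs e := by
  simp [trs, mapLbl, Function.comp_def]

theorem ins_map {A B : Type*} (μ : A → B) (e : List (Lbl nT k A)) :
    ins (e.map (mapLbl μ)) = (ins e).map μ := by
  simp [ins, mapLbl, Function.comp_def]

variable (μ : D ≃[L] D)

/-- Automorphisms preserve formulas, hence they act on runs. All uses of oligomorphicity rest on
this. -/
theorem step_map {t : Fin nT} {r : Fin k → D} {d : D} {r' : Fin k → D} (h : σ.Step t r d r') :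
    σ.Step t (μ ∘ r) (μ d) (μ ∘ r') := by
  unfold Step at *
  rw [← Language.StrongHomClass.realize_formula μ] at h
  convert h using 1
  funext x
  rcases x with x | _ | x <;> rfl

theorem valid_map {C : Q × (Fin k → D)} {e : List (Lbl nT k D)} (h : σ.Valid C e) :
    σ.Valid (C.1, μ ∘ C.2) (e.map (mapLbl μ)) := by
  induction e generalizing C with
  | nil => trivial
  | cons l e ih => exact ⟨h.1, step_map μ h.2.1, ih h.2.2⟩

theorem after_map (C : Q × (Fin k → D)) (e : List (Lbl nT k D)) :
    σ.after (C.1, μ ∘ C.2) (e.map (mapLbl μ)) = ((σ.after C e).1, μ ∘ (σ.after C e).2) := by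
  induction e generalizing C with
  | nil => rfl
  | cons l e ih => exact ih (σ.tgt l.1, l.2.2)

/-! ### Uniform bounds on lengths of runs. -/

section Bounds

variable [Finite Q] (σ)

/-- A run with at least `m` visits to final states starts in the configuration. -/
def Live (m : ℕ) (C : Q × (Fin k → D)) : Prop :=
  ∃ e : List (Lbl nT k D), σ.Valid C e ∧ m ≤ σ.visits (trs e)

variable {σ} in
theorem Live.mono {m m' : ℕ} (h : m ≤ m') {C : Q × (Fin k → D)} (hC : σ.Live m' C) : σ.Live m C :=
  hC.imp fun _ he => ⟨he.1, h.trans he.2⟩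

variable {σ} in
theorem Live.map {m : ℕ} {C : Q × (Fin k → D)} (hC : σ.Live m C) :
    σ.Live m (C.1, μ ∘ C.2) := by
  obtain ⟨e, he, hm⟩ := hC
  exact ⟨_, valid_map μ he, by simpa using hm⟩

/-- Not being live at some level is invariant under automorphisms, so for each of the finitely many
states the least failing level is bounded. -/
theorem exists_live_bound (hD : Oligomorphic L D) :
    ∃ K, ∀ C : Q × (Fin k → D), σ.Live K C → ∀ m, σ.Live m C := by
  have h (q : Q) : ∃ K, ∀ r : Fin k → D, (∃ m, ¬ σ.Live m (q, r)) → ∃ m ≤ K, ¬ σ.Live m (q, r) := by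
    refine exists_bound_of_invariant hD fun μ m r hr hl => hr ?_
    have := hl.map μ.symm
    convert this using 2
    funext x
    exact (μ.toEquiv.symm_apply_apply _).symm
  choose K hK using h
  obtain ⟨B, hB⟩ := (Set.finite_range K).bddAbove
  refine ⟨B, fun C hC m => ?_⟩
  by_contra hm
  obtain ⟨m', hm', hn⟩ := hK C.1 C.2 ⟨m, hm⟩
  exact hn (hC.mono (hm'.trans (hB ⟨_, rfl⟩)))

theorem exists_short_live (hD : Oligomorphic L D) (m : ℕ) :
    ∃ B, ∀ C : Q × (Fin k → D), σ.Live m C →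
      ∃ e : List (Lbl nT k D), σ.Valid C e ∧ m ≤ σ.visits (trs e) ∧ e.length ≤ B := by
  have h (q : Q) : ∃ B, ∀ r : Fin k → D,
      (∃ l, ∃ e : List (Lbl nT k D), σ.Valid (q, r) e ∧ m ≤ σ.visits (trs e) ∧ e.length = l) →
      ∃ l ≤ B, ∃ e : List (Lbl nT k D), σ.Valid (q, r) e ∧ m ≤ σ.visits (trs e) ∧ e.length = l := by
    refine exists_bound_of_invariant hD fun μ l r ⟨e, h1, h2, h3⟩ => ?_
    exact ⟨_, valid_map μ h1, by simpa using h2, by simpa using h3⟩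
  choose B hB using h
  obtain ⟨b, hb⟩ := (Set.finite_range B).bddAbove
  refine ⟨b, fun C ⟨e, he, hm⟩ => ?_⟩
  obtain ⟨l, hl, e', h1, h2, h3⟩ := hB C.1 C.2 ⟨_, e, he, hm, rfl⟩
  exact ⟨e', h1, h2, h3.le.trans (hl.trans (hb ⟨_, rfl⟩))⟩

/-- The invariant property concerns the register contents at both ends jointly, so the shortened run
joins exactly the same two configurations. Its input may change. -/
theorem exists_short_silent (hD : Oligomorphic L D) :
    ∃ B, ∀ (C : Q × (Fin k → D)) (e : List (Lbl nT k D)), σ.Valid C e → σ.outs e = [] →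
      ∃ e' : List (Lbl nT k D), σ.Valid C e' ∧ σ.outs e' = [] ∧ σ.after C e' = σ.after C e ∧
        e'.length ≤ B := by
  have h (q : Q × Q) : ∃ B, ∀ r : Fin k ⊕ Fin k → D,
      (∃ l, ∃ e : List (Lbl nT k D), σ.Valid (q.1, r ∘ Sum.inl) e ∧ σ.outs e = [] ∧
        σ.after (q.1, r ∘ Sum.inl) e = (q.2, r ∘ Sum.inr) ∧ e.length = l) →
      ∃ l ≤ B, ∃ e : List (Lbl nT k D), σ.Valid (q.1, r ∘ Sum.inl) e ∧ σ.outs e = [] ∧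
        σ.after (q.1, r ∘ Sum.inl) e = (q.2, r ∘ Sum.inr) ∧ e.length = l := by
    refine exists_bound_of_invariant hD fun μ l r ⟨e, h1, h2, h3, h4⟩ => ?_
    refine ⟨e.map (mapLbl μ), valid_map μ h1, by simp [outs_map, h2], ?_, by simpa using h4⟩
    rw [Function.comp_assoc, after_map μ (q.1, r ∘ Sum.inl), h3]
    rfl
  choose B hB using h
  obtain ⟨b, hb⟩ := (Set.finite_range B).bddAbove
  refine ⟨b, fun C e he ho => ?_⟩
  obtain ⟨l, hl, e', h1, h2, h3, h4⟩ := hB (C.1, (σ.after C e).1)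
    (Sum.elim C.2 (σ.after C e).2) ⟨_, e, he, ho, rfl, rfl⟩
  exact ⟨e', h1, h2, h3, h4.le.trans (hl.trans (hb ⟨_, rfl⟩))⟩

/-- A bounded run suffices to write the first `c` data values of the output of a given run and to
join it afterwards. -/
theorem exists_short_output (hD : Oligomorphic L D) :
    ∃ B, ∀ (c : ℕ) (C : Q × (Fin k → D)) (e : List (Lbl nT k D)), σ.Valid C e →
      c ≤ (σ.outs e).length → ∃ a a' b, e = a' ++ b ∧ σ.Valid C a ∧ σ.after C a = σ.after C a' ∧
        a.length ≤ c * B ∧ (σ.outs a).take c = (σ.outs e).take c := by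
  obtain ⟨B, hB⟩ := exists_short_silent σ hD
  refine ⟨B + 1, fun c => ?_⟩
  induction c using Nat.strong_induction_on with
  | _ c ih =>
    intro C e he hc
    rcases Nat.eq_zero_or_pos c with rfl | hpos
    · exact ⟨[], [], e, rfl, trivial, rfl, by simp, by simp⟩
    have hsplit : ∀ e : List (Lbl nT k D), σ.outs e ≠ [] →
        ∃ s l b, e = s ++ l :: b ∧ σ.outs s = [] ∧ σ.out l.1 ≠ [] := by
      intro e
      induction e with
      | nil => simp
      | cons l e ih' =>
        intro h
        by_cases hl : σ.out l.1 = []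
        · obtain ⟨s, l', b, rfl, h1, h2⟩ := ih' (by simpa [hl] using h)
          exact ⟨l :: s, l', b, rfl, by simp [hl, h1], h2⟩
        · exact ⟨[], l, e, rfl, rfl, hl⟩
    -- Cut at the first label with output: the silent part is shortened, this label is kept, and at
    -- least one output letter less remains to be produced.
    obtain ⟨s, l, b, rfl, hs, hl⟩ := hsplit e (by rintro h; simp [h] at hc; omega)
    rw [valid_append] at he
    obtain ⟨s', h1, h2, h3, h4⟩ := hB C s he.1 hs
    have hlp := List.length_pos_iff.2 hl
    obtain ⟨a, a', b', rfl, g1, g2, g3, g4⟩ := ih (c - (σ.out l.1).length) (by omega)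
      (σ.tgt l.1, l.2.2) b he.2.2.2 (by simp [hs] at hc; omega)
    refine ⟨s' ++ l :: a, s ++ l :: a', b', by simp, ?_, ?_, ?_, ?_⟩
    · rw [valid_append, h3]
      exact ⟨h1, he.2.1, he.2.2.1, g1⟩
    · rw [after_append, after_append]
      exact g2
    · obtain ⟨d, hd⟩ : ∃ d, c = d + 1 := ⟨c - 1, by omega⟩
      have : (c - (σ.out l.1).length) * (B + 1) ≤ d * (B + 1) := Nat.mul_le_mul_right _ (by omega)
      rw [hd, Nat.add_mul]
      simp only [List.length_append, List.length_cons]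
      omega
    · rw [outs_append s', outs_append s, outs_cons, outs_cons, h2, hs]
      simp only [List.nil_append, List.take_append, List.length_map, g4]

end Bounds

end RegSys

end DataWord

/-! ### Infinite runs. -/

namespace DataWord

namespace RegSys

variable {L : Language} {Q D : Type*} [L.Structure D] {nT k : ℕ} (σ : RegSys L Q nT k)

/-- The finite prefix of length `n` of an infinite word. -/
def pre {A : Type*} (e : ℕ → A) (n : ℕ) : List A := (List.range n).map e

@[simp] theorem length_pre {A : Type*} (e : ℕ → A) (n : ℕ) : (pre e n).length = n := by simp [pre]

theorem pre_succ {A : Type*} (e : ℕ → A) (n : ℕ) : pre e (n + 1) = pre e n ++ [e n] := by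
  simp [pre, List.range_succ]

theorem pre_add {A : Type*} (e : ℕ → A) (m n : ℕ) :
    pre e (m + n) = pre e m ++ pre (fun s => e (m + s)) n := by
  simp [pre, List.range_add]

theorem pre_take {A : Type*} (e : ℕ → A) {m n : ℕ} (h : m ≤ n) : (pre e n).take m = pre e m := by
  obtain ⟨d, rfl⟩ := Nat.exists_eq_add_of_le h
  rw [pre_add, List.take_left' (length_pre e m)]

theorem pre_inj {A : Type*} {e e' : ℕ → A} {n : ℕ} :
    pre e n = pre e' n ↔ ∀ s < n, e s = e' s := by
  simp [pre]

theorem pre_map {A B : Type*} (g : A → B) (e : ℕ → A) (n : ℕ) :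
    (pre e n).map g = pre (fun s => g (e s)) n := by simp [pre, Function.comp_def]

theorem exists_pre_eq {A : Type*} (e : List A) (e' : ℕ → A) :
    ∃ g : ℕ → A, pre g e.length = e ∧ ∀ s, g (e.length + s) = e' s := by
  refine ⟨fun s => if h : s < e.length then e[s] else e' (s - e.length), ?_, by simp⟩
  refine List.ext_getElem (by simp) fun s h1 h2 => ?_
  simp [pre, h2]

/-- The configuration before the step number `n` of a sequence of labels. -/
def conf (C : Q × (Fin k → D)) (e : ℕ → Lbl nT k D) : ℕ → Q × (Fin k → D)
  | 0 => C
  | n + 1 => (σ.tgt (e n).1, (e n).2.2)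

/-- The label can be appended to a run that ends in the given configuration. -/
def Enabled (C : Q × (Fin k → D)) (l : Lbl nT k D) : Prop :=
  σ.src l.1 = C.1 ∧ σ.Step l.1 C.2 l.2.1 l.2.2

/-- An infinite sequence of labels is an accepting run from the configuration. -/
def Accepts (C : Q × (Fin k → D)) (e : ℕ → Lbl nT k D) : Prop :=
  (∀ n, σ.Valid C (pre e n)) ∧ ∀ n, ∃ m ≥ n, σ.acc (e m).1

variable {σ}

theorem after_pre (C : Q × (Fin k → D)) (e : ℕ → Lbl nT k D) (n : ℕ) :
    σ.after C (pre e n) = σ.conf C e n := by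
  cases n with
  | zero => rfl
  | succ n => rw [pre_succ, after_append]; rfl

theorem valid_pre {C : Q × (Fin k → D)} {e : ℕ → Lbl nT k D} {n : ℕ} :
    σ.Valid C (pre e n) ↔ ∀ s < n, σ.Enabled (σ.conf C e s) (e s) := by
  induction n with
  | zero => simp [pre]
  | succ n ih =>
    rw [pre_succ, valid_append, ih, after_pre, Nat.forall_lt_succ_right]
    simp [Valid, Enabled]

theorem Valid.of_prefix {C : Q × (Fin k → D)} {e e' : List (Lbl nT k D)} (h : σ.Valid C e')
    (he : e <+: e') : σ.Valid C e := by
  obtain ⟨b, rfl⟩ := he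
  exact (valid_append.1 h).1

theorem pre_prefix {A : Type*} (e : ℕ → A) {m n : ℕ} (h : m ≤ n) : pre e m <+: pre e n := by
  obtain ⟨d, rfl⟩ := Nat.exists_eq_add_of_le h
  exact ⟨_, (pre_add e m d).symm⟩

theorem Accepts.exists_append {C : Q × (Fin k → D)} {e : List (Lbl nT k D)}
    {e' : ℕ → Lbl nT k D} (he : σ.Valid C e) (he' : σ.Accepts (σ.after C e) e') :
    ∃ g : ℕ → Lbl nT k D, σ.Accepts C g ∧ pre g e.length = e := by
  obtain ⟨g, hg, hg'⟩ := exists_pre_eq e e'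
  refine ⟨g, ⟨fun n => ?_, fun n => ?_⟩, hg⟩
  · have : σ.Valid C (pre g (e.length + n)) := by
      rw [pre_add, hg, valid_append]
      simp only [hg']
      exact ⟨he, he'.1 n⟩
    exact this.of_prefix (pre_prefix g (Nat.le_add_left _ _))
  · obtain ⟨m, hm, ha⟩ := he'.2 n
    exact ⟨e.length + m, by omega, by rwa [hg']⟩

theorem exists_first_visit {m : ℕ} : ∀ e : List (Lbl nT k D), m + 1 ≤ σ.visits (trs e) →
    ∃ a l b, e = a ++ l :: b ∧ σ.acc l.1 ∧ m ≤ σ.visits (trs b)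
  | [], h => by simp [trs] at h
  | l :: e, h => by
    by_cases hl : σ.acc l.1
    · refine ⟨[], l, e, rfl, hl, ?_⟩
      simpa [trs, visits, hl] using h
    · obtain ⟨a, l', b, rfl, h1, h2⟩ := exists_first_visit e (by simpa [trs, visits, hl] using h)
      exact ⟨l :: a, l', b, rfl, h1, h2⟩

/-- Being live at level `K` implies being live at level `K + 1`. After the first visit of such a run
`K` visits are left, so the configuration reached is live again and the construction can be repeated
for ever. -/
theorem Live.exists_accepts {K : ℕ} (hK : ∀ C : Q × (Fin k → D), σ.Live K C → ∀ m, σ.Live m C)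
    {C : Q × (Fin k → D)} (hC : σ.Live K C) : ∃ e : ℕ → Lbl nT k D, σ.Accepts C e := by
  let nxt : Lbl nT k D → Q × (Fin k → D) := fun l => (σ.tgt l.1, l.2.2)
  let Y : ℕ → Q × (Fin k → D) → Prop := fun h C => ∃ e l, e.length = h ∧ σ.Valid C (e ++ [l]) ∧
    σ.acc l.1 ∧ σ.Live K (σ.after C (e ++ [l]))
  have hY : ∀ C, σ.Live K C → ∃ h, Y h C := by
    intro C hC
    obtain ⟨e, he, hm⟩ := hK C hC (K + 1)
    obtain ⟨a, l, b, rfl, hl, hb⟩ := exists_first_visit e hm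
    rw [← List.singleton_append, ← List.append_assoc, valid_append] at he
    exact ⟨_, a, l, rfl, he.1, hl, b, he.2, hb⟩
  classical
  -- The distance to the next visit that leads to a live configuration. Choosing one label at a time
  -- so that it decreases unless a visit occurs forces infinitely many visits.
  let μ : {C // σ.Live K C} → ℕ := fun C => Nat.find (hY C.1 C.2)
  have hstep : ∀ C : {C // σ.Live K C}, ∃ l, σ.Enabled C.1 l ∧ ∃ h : σ.Live K (nxt l),
      σ.acc l.1 ∨ μ ⟨nxt l, h⟩ < μ C := by
    intro C
    obtain ⟨e, l, hlen, hv, ha, hl⟩ := Nat.find_spec (hY C.1 C.2)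
    cases e with
    | nil => exact ⟨l, ⟨hv.1, hv.2.1⟩, hl, Or.inl ha⟩
    | cons l' e =>
      have hlive : σ.Live K (nxt l') := by
        obtain ⟨b, hb, hm⟩ := hl
        refine ⟨(e ++ [l]) ++ b, valid_append.2 ⟨hv.2.2, hb⟩, ?_⟩
        rw [trs_append, visits_append]
        omega
      refine ⟨l', ⟨hv.1, hv.2.1⟩, hlive, Or.inr ?_⟩
      refine (Nat.find_le (h := hY (nxt l') hlive) ⟨e, l, rfl, hv.2.2, ha, hl⟩).trans_lt ?_
      simp only [List.length_cons] at hlen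
      show e.length < Nat.find (hY C.1 C.2)
      omega
  choose g hg hlive hdesc using hstep
  let c : ℕ → {C // σ.Live K C} := fun n => Nat.rec ⟨C, hC⟩ (fun _ c => ⟨nxt (g c), hlive c⟩) n
  let e : ℕ → Lbl nT k D := fun n => g (c n)
  have hconf : ∀ n, σ.conf C e n = (c n).1 := fun n => by cases n <;> rfl
  refine ⟨e, fun n => valid_pre.2 fun s _ => hconf s ▸ hg (c s), fun n => ?_⟩
  suffices ∀ b n, μ (c n) = b → ∃ m ≥ n, σ.acc (e m).1 from this _ n rfl
  intro b
  induction b using Nat.strong_induction_on with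
  | _ b ih =>
    intro n hn
    rcases hdesc (c n) with h | h
    · exact ⟨n, le_rfl, h⟩
    · obtain ⟨m, hm, ha⟩ := ih _ (hn ▸ h) (n + 1) rfl
      exact ⟨m, by omega, ha⟩

theorem Accepts.exists_visits {C : Q × (Fin k → D)} {e : ℕ → Lbl nT k D} (he : σ.Accepts C e)
    (n m : ℕ) : ∃ N, m ≤ σ.visits (trs (pre (fun s => e (n + s)) N)) := by
  induction m with
  | zero => exact ⟨0, Nat.zero_le _⟩
  | succ m ih =>
    obtain ⟨N, hN⟩ := ih
    obtain ⟨M, hM, ha⟩ := he.2 (n + N)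
    obtain ⟨d, rfl⟩ := Nat.exists_eq_add_of_le hM
    refine ⟨N + d + 1, ?_⟩
    rw [pre_succ, pre_add, trs_append, trs_append, visits_append, visits_append]
    have : σ.visits (trs [e (n + (N + d))]) = 1 := by
      rw [← Nat.add_assoc]; simp [trs, visits, ha]
    omega

end RegSys

end DataWord

/-! ### Continuity in terms of mismatches of finite runs. -/

namespace DataWord

namespace RegSys

variable {L : Language} {Q D : Type*} [L.Structure D] {nT k : ℕ} (σ : RegSys L Q nT k)

/-- The initial configuration. -/
def start (D : Type*) [L.Structure D] : Q × (Fin k → D) := (σ.q₀, fun r => (σ.init r : D))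

/-- The infinite word `y` is the output of the sequence of labels. -/
def Writes (e : ℕ → Lbl nT k D) (y : ℕ → D) : Prop :=
  (∀ n i a, (σ.outs (pre e n))[i]? = some a → y i = a) ∧ ∀ i, ∃ n, i < (σ.outs (pre e n)).length

/-- The input word of a sequence of labels. -/
def inWord (e : ℕ → Lbl nT k D) : ℕ → D := fun n => (e n).2.1

/-- The partial function that the automaton defines. -/
structure DefinesFun (f : (ℕ → D) →. (ℕ → D)) : Prop where
  exists_mem : ∀ {e : ℕ → Lbl nT k D}, σ.Accepts (σ.start D) e → ∃ y ∈ f (inWord e), σ.Writes e y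
  exists_run : ∀ {x y : ℕ → D}, y ∈ f x →
    ∃ e : ℕ → Lbl nT k D, σ.Accepts (σ.start D) e ∧ inWord e = x ∧ σ.Writes e y

/-- The run `e` writes the letter `a` at position `i`; its prolongation `e'` visits final states
`K` times. -/
structure Half (K j i : ℕ) (e e' : List (Lbl nT k D)) (a : D) : Prop where
  valid : σ.Valid (σ.start D) (e ++ e')
  le_length : j ≤ e.length
  visits : K ≤ σ.visits (trs e')
  outs : (σ.outs e)[i]? = some a

/-- Two runs whose inputs agree on the first `j` letters write different letters at position `i`; the
transitions of the first run begin with `τ`. -/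
def Mis (D : Type*) [L.Structure D] (K j : ℕ) (τ : List (Fin nT)) (i : ℕ) : Prop :=
  ∃ (e₁ e₁' e₂ e₂' : List (Lbl nT k D)) (a b : D), σ.Half K j i e₁ e₁' a ∧ σ.Half K j i e₂ e₂' b ∧
    τ <+: trs e₁ ∧ (ins e₁).take j = (ins e₂).take j ∧ a ≠ b

variable {σ} {f : (ℕ → D) →. (ℕ → D)} {K j i : ℕ}

theorem Half.mono {j' : ℕ} (hj : j' ≤ j) {e e' : List (Lbl nT k D)} {a : D}
    (h : σ.Half K j i e e' a) : σ.Half K j' i e e' a :=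
  ⟨h.valid, hj.trans h.le_length, h.visits, h.outs⟩

/-- Once reading has excluded all mismatches, further reading keeps them excluded; so a mismatch
after `j` letters shows that `j` lies below every modulus value for later positions. -/
theorem Mis.mono {j' : ℕ} {τ : List (Fin nT)} (hj : j' ≤ j) (h : σ.Mis D K j τ i) :
    σ.Mis D K j' τ i := by
  obtain ⟨e₁, e₁', e₂, e₂', a, b, h1, h2, h3, h4, h5⟩ := h
  refine ⟨e₁, e₁', e₂, e₂', a, b, h1.mono hj, h2.mono hj, h3, ?_, h5⟩
  have := congrArg (List.take j') h4
  rwa [List.take_take, List.take_take, min_eq_left hj] at this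

theorem ins_pre_take {e : ℕ → Lbl nT k D} {n : ℕ} (h : j ≤ n) :
    (ins (pre e n)).take j = pre (inWord e) j := by
  unfold ins
  rw [pre_map, pre_take _ h]
  rfl

theorem Accepts.exists_half {e : ℕ → Lbl nT k D} (he : σ.Accepts (σ.start D) e) {y : ℕ → D}
    (hy : σ.Writes e y) (K j i : ℕ) :
    ∃ n ≥ j, ∃ e', σ.Half K j i (pre e n) e' (y i) := by
  obtain ⟨m, hm⟩ := hy.2 i
  obtain ⟨N, hN⟩ := he.exists_visits (max m j) K
  refine ⟨max m j, le_max_right _ _, pre (fun s => e (max m j + s)) N, ⟨?_, ?_, hN, ?_⟩⟩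
  · rw [← pre_add]; exact he.1 _
  · simp
  · obtain ⟨d, hd⟩ := Nat.exists_eq_add_of_le (le_max_left m j)
    have h : i < (σ.outs (pre e (max m j))).length := by
      rw [hd, pre_add, outs_append, List.length_append]; omega
    rw [List.getElem?_eq_getElem h]
    exact congrArg some (hy.1 _ i _ (List.getElem?_eq_getElem h)).symm

/-- The choice of `K` turns the finite prolongation into an infinite accepting one, so the letter of
the finite run is a letter of a value of `f`. -/
theorem Half.exists_run (hK : ∀ C : Q × (Fin k → D), σ.Live K C → ∀ m, σ.Live m C)
    (hf : σ.DefinesFun f) {e e' : List (Lbl nT k D)} {a : D} (h : σ.Half K j i e e' a) :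
    ∃ g, pre g e.length = e ∧ ∃ y ∈ f (inWord g), y i = a := by
  have hv := valid_append.1 h.valid
  obtain ⟨g', hg'⟩ := Live.exists_accepts hK ⟨e', hv.2, h.visits⟩
  obtain ⟨g, hg, hge⟩ := Accepts.exists_append hv.1 hg'
  obtain ⟨y, hy, hw⟩ := hf.exists_mem hg
  exact ⟨g, hge, y, hy, hw.1 e.length i a (hge.symm ▸ h.outs)⟩

/-- The modulus of continuity in terms of mismatches of runs. -/
theorem isMContinuous_iff (hK : ∀ C : Q × (Fin k → D), σ.Live K C → ∀ m, σ.Live m C)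
    (hf : σ.DefinesFun f) {m : ℕ → ℕ} :
    IsMContinuous f m ↔ ∀ i, ∀ i' < i, ¬ σ.Mis D K (m i) [] i' := by
  constructor
  · rintro h i i' hi ⟨e₁, e₁', e₂, e₂', a, b, h1, h2, -, h4, h5⟩
    obtain ⟨g₁, hg₁, y₁, hy₁, rfl⟩ := h1.exists_run hK hf
    obtain ⟨g₂, hg₂, y₂, hy₂, rfl⟩ := h2.exists_run hK hf
    rw [← hg₁, ← hg₂, ins_pre_take h1.le_length, ins_pre_take h2.le_length, pre_inj] at h4
    exact h5 (h i _ y₁ hy₁ _ y₂ hy₂ h4 i' hi)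
  · intro h i x₁ y₁ hy₁ x₂ y₂ hy₂ hx i' hi
    by_contra hne
    obtain ⟨e₁, he₁, rfl, hw₁⟩ := hf.exists_run hy₁
    obtain ⟨e₂, he₂, rfl, hw₂⟩ := hf.exists_run hy₂
    obtain ⟨n₁, hn₁, e₁', h1⟩ := he₁.exists_half hw₁ K (m i) i'
    obtain ⟨n₂, hn₂, e₂', h2⟩ := he₂.exists_half hw₂ K (m i) i'
    refine h i i' hi ⟨_, e₁', _, e₂', _, _, h1, h2, List.nil_prefix, ?_, hne⟩
    rw [ins_pre_take hn₁, ins_pre_take hn₂, pre_inj]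
    exact hx

theorem trs_pre (e : ℕ → Lbl nT k D) (n : ℕ) : trs (pre e n) = pre (fun s => (e s).1) n :=
  pre_map _ _ _

/-- If a continuous function is defined at the input of an accepting run, then a finite part of the
run determines the letter number `i` of the output. -/
theorem exists_not_mis (hD : Oligomorphic L D)
    (hK : ∀ C : Q × (Fin k → D), σ.Live K C → ∀ m, σ.Live m C)
    (hf : σ.DefinesFun f) (hc : IsContinuous f) {e : ℕ → Lbl nT k D}
    (he : σ.Accepts (σ.start D) e) (i : ℕ) :
    ∃ j, ¬ σ.Mis D K j (trs (pre e j)) i := by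
  by_contra! hmis
  obtain ⟨y, hy, hw⟩ := hf.exists_mem he
  obtain ⟨p, hp⟩ := hw.2 i
  -- The transitions are those of `e` and only the data values vary. A limit run then visits final
  -- states as often as `e` does.
  let lab : (ℕ → Option (Fin k) → D) → ℕ → Lbl nT k D :=
    fun v s => ((e s).1, v s none, fun r => v s (some r))
  have hmap : ∀ (μ : D ≃[L] D) v, lab (fun s => μ ∘ v s) = fun s => mapLbl μ (lab v s) := fun _ _ => rfl
  have hstart : ∀ μ : D ≃[L] D, ((σ.start D).1, μ ∘ (σ.start D).2) = σ.start D := by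
    intro μ
    refine Prod.ext rfl (funext fun r => ?_)
    exact Language.HomClass.map_constants μ (σ.init r)
  -- The mismatch is required only from `p` on, where these transitions have produced position `i`
  -- whatever the data values are. This makes the property depend on the first `n` labels only and
  -- descend from `n + 1` to `n`.
  let P : ℕ → (ℕ → Option (Fin k) → D) → Prop := fun n v =>
    σ.Valid (σ.start D) (pre (lab v) n) ∧ (p ≤ n → ∃ e₂ e₂' a b, σ.Half K n i e₂ e₂' b ∧
      (σ.outs (pre (lab v) n))[i]? = some a ∧ pre (inWord (lab v)) n = (ins e₂).take n ∧ a ≠ b)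
  have hout : ∀ v n, p ≤ n → ∃ a, ∀ d, (σ.outs (pre (lab v) (n + d)))[i]? = some a := by
    intro v n hn
    have hlen : ∀ n, (σ.outs (pre (lab v) n)).length = (σ.outs (pre e n)).length := by
      intro n
      induction n with
      | zero => rfl
      | succ n ih => simp [pre_succ, ih, lab]
    have h1 : i < (σ.outs (pre (lab v) p)).length := by rw [hlen]; exact hp
    obtain ⟨d', rfl⟩ := Nat.exists_eq_add_of_le hn
    refine ⟨(σ.outs (pre (lab v) p))[i], fun d => ?_⟩
    rw [Nat.add_assoc, pre_add, outs_append, List.getElem?_append_left h1,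
      List.getElem?_eq_getElem h1]
  have hinv : ∀ (μ : D ≃[L] D) n v, P n v → P n fun s => μ ∘ v s := by
    rintro μ n v ⟨h1, h2⟩
    refine ⟨?_, fun hn => ?_⟩
    · have := valid_map μ h1
      rwa [hstart, pre_map] at this
    · obtain ⟨e₂, e₂', a, b, h3, h4, h5, h6⟩ := h2 hn
      refine ⟨e₂.map (mapLbl μ), e₂'.map (mapLbl μ), μ a, μ b, ⟨?_, ?_, ?_, ?_⟩, ?_, ?_, ?_⟩
      · have := valid_map μ h3.valid
        rwa [hstart, List.map_append] at this
      · simpa using h3.le_length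
      · simpa using h3.visits
      · simp [outs_map, h3.outs]
      · rw [hmap, ← pre_map, outs_map]
        simp [h4]
      · rw [ins_map, ← List.map_take, ← h5, pre_map]
        rfl
      · exact fun h => h6 (μ.toEquiv.injective h)
  have hanti : ∀ n v, P (n + 1) v → P n v := by
    rintro n v ⟨h1, h2⟩
    refine ⟨h1.of_prefix (pre_prefix _ (Nat.le_succ n)), fun hn => ?_⟩
    obtain ⟨e₂, e₂', a, b, h3, h4, h5, h6⟩ := h2 (Nat.le_succ_of_le hn)
    obtain ⟨a', ha'⟩ := hout v n hn
    have := (ha' 1).symm.trans h4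
    refine ⟨e₂, e₂', a, b, h3.mono (Nat.le_succ n), (ha' 0).trans this, ?_, h6⟩
    have := congrArg (List.take n) h5
    rwa [pre_take _ (Nat.le_succ n), List.take_take, min_eq_left (Nat.le_succ n)] at this
  have hloc : ∀ n v w, (∀ s < n, v s = w s) → P n v → P n w := by
    rintro n v w hvw ⟨h1, h2⟩
    have h : pre (lab v) n = pre (lab w) n := pre_inj.2 fun s hs => by simp only [lab, hvw s hs]
    have h' : pre (inWord (lab v)) n = pre (inWord (lab w)) n :=
      pre_inj.2 fun s hs => by simp only [lab, inWord, hvw s hs]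
    simp only [P]
    rw [← h, ← h']
    exact ⟨h1, h2⟩
  have hne : ∀ n, ∃ v, P n v := by
    intro n
    -- The data values of the first run of the mismatch serve as `v`; its first `max n p`
    -- transitions are those of `e`.
    obtain ⟨e₁, e₁', e₂, e₂', a, b, h1, h2, h3, h4, h5⟩ := hmis (max n p)
    obtain ⟨g, hg, -⟩ := exists_pre_eq e₁ e
    let v : ℕ → Option (Fin k) → D := fun s o => o.elim (g s).2.1 (g s).2.2
    have hlen : max n p ≤ e₁.length := h1.le_length
    have hgv : pre (lab v) (max n p) = pre g (max n p) := by
      rw [pre_inj]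
      intro s hs
      rw [← hg, trs_pre, trs_pre] at h3
      have : ((e s).1 = (g s).1) := by
        have h6 := (List.prefix_iff_eq_take.1 h3)
        rw [length_pre, pre_take _ hlen, pre_inj] at h6
        exact h6 s hs
      simp only [lab, v, this]
      rfl
    have hpre : pre g (max n p) <+: e₁ := by
      rw [← hg]; exact pre_prefix g hlen
    have hP : P (max n p) v := by
      refine ⟨?_, fun _ => ⟨e₂, e₂', a, b, h2, ?_, ?_, h5⟩⟩
      · rw [hgv]
        exact (h1.valid.of_prefix (List.prefix_append _ _)).of_prefix hpre
      · obtain ⟨c, hc'⟩ := hout v (max n p) (le_max_right _ _)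
        have hc0 := hc' 0
        rw [Nat.add_zero, hgv] at hc0
        rw [hgv, hc0]
        obtain ⟨t, ht⟩ := hpre
        have := h1.outs
        rw [← ht, outs_append, List.getElem?_append_left (List.getElem?_eq_some_iff.1 hc0).1,
          hc0] at this
        exact this
      · rw [← h4, ← hg, ins_pre_take hlen, pre_inj]
        intro s hs
        have := pre_inj.1 hgv s hs
        simp only [inWord, this]
    have hmono : ∀ d, P (n + d) v → P n v := by
      intro d
      induction d with
      | zero => exact id
      | succ d ih => exact fun h => ih (hanti _ v h)
    obtain ⟨d, hd⟩ := Nat.exists_eq_add_of_le (le_max_left n p)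
    exact ⟨v, hmono d (hd ▸ hP)⟩
  obtain ⟨v, hv⟩ := exists_limit_of_invariant hD hinv hanti hloc hne
  -- Thus `f` is defined at the limit input, and the mismatches refute its continuity there.
  have hacc : σ.Accepts (σ.start D) (lab v) := ⟨fun n => (hv n).1, he.2⟩
  obtain ⟨y', hy', hw'⟩ := hf.exists_mem hacc
  obtain ⟨j, hj⟩ := hc _ y' hy' (i + 1)
  obtain ⟨e₂, e₂', a, b, h1, h2, h3, h4⟩ := (hv (max p j)).2 (le_max_left _ _)
  obtain ⟨g, hg, y₂, hy₂, rfl⟩ := h1.exists_run hK hf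
  rw [← hg, ins_pre_take h1.le_length, pre_inj] at h3
  have := hj _ y₂ hy₂ (fun s hs => h3 s (hs.trans_le (le_max_right _ _))) i (Nat.lt_succ_self i)
  exact h4 ((hw'.1 _ i a h2).symm.trans this)

end RegSys

end DataWord

/-! ### Bounds on the runs that witness a mismatch. -/

namespace DataWord

namespace RegSys

variable {L : Language} {Q D : Type*} [L.Structure D] {nT k : ℕ} {σ : RegSys L Q nT k}

theorem valid_start_take {C : Q × (Fin k → D)} {e : List (Lbl nT k D)} (h : σ.Valid C e) (j : ℕ) :
    σ.Valid C (e.take j) ∧ σ.Valid (σ.after C (e.take j)) (e.drop j) := by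
  rw [← valid_append, List.take_append_drop]
  exact h

/-- Only the first `j` labels have to be kept, since inputs are compared there only. The rest up to
the output of position `i` and the final prolongation are replaced by short runs. -/
theorem exists_half_bound [Finite Q] (σ : RegSys L Q nT k) (hD : Oligomorphic L D) (K : ℕ) :
    ∃ B, ∀ (j i : ℕ) (e e' : List (Lbl nT k D)) (a : D), σ.Half K j i e e' a →
      ∃ g g', σ.Half K j i g g' a ∧ g.take j = e.take j ∧ g.length ≤ j + (i + 1) * B ∧
        g'.length ≤ j + (i + 1) * B := by
  obtain ⟨B₀, hB₀⟩ := exists_short_output σ hD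
  obtain ⟨B₁, hB₁⟩ := exists_short_live σ hD K
  refine ⟨B₀ + B₁, fun j i e e' a h => ?_⟩
  obtain ⟨hv, hv'⟩ := valid_append.1 h.valid
  obtain ⟨h1, h2⟩ := valid_start_take hv j
  set p := e.take j with hp
  set r := e.drop j with hr
  have he : e = p ++ r := (List.take_append_drop j e).symm
  have hpl : p.length = j := by simp [hp, h.le_length]
  have hi : i < (σ.outs e).length := (List.getElem?_eq_some_iff.1 h.outs).1
  have hout := h.outs
  rw [he, outs_append] at hi hout
  rw [List.length_append] at hi
  -- The number of letters still missing after `p`; truncated subtraction gives `0` if position `i`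
  -- has been written already.
  obtain ⟨g, g', b, hr', g1, g2, g3, g4⟩ := hB₀ (i + 1 - (σ.outs p).length) _ r h2 (by omega)
  have hend : σ.after (σ.start D) e = σ.after (σ.after (σ.start D) (p ++ g)) b := by
    rw [he, hr', after_append, after_append (σ.after (σ.start D) p), ← g2,
      after_append (σ.start D) p g]
  have hlive : σ.Live K (σ.after (σ.start D) (p ++ g)) := by
    refine ⟨b ++ e', ?_, ?_⟩
    · rw [valid_append, ← hend]
      rw [hr', valid_append, ← g2, ← after_append] at h2
      exact ⟨h2.2, hv'⟩
    · rw [trs_append, visits_append]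
      exact h.visits.trans (Nat.le_add_left _ _)
  obtain ⟨w, w1, w2, w3⟩ := hB₁ _ hlive
  have hle : (i + 1 - (σ.outs p).length) * B₀ ≤ (i + 1) * B₀ := Nat.mul_le_mul_right _ (by omega)
  have hle' : 1 * B₁ ≤ (i + 1) * B₁ := Nat.mul_le_mul_right _ (by omega)
  rw [Nat.mul_add]
  refine ⟨p ++ g, w, ⟨?_, ?_, w2, ?_⟩, ?_, ?_, ?_⟩
  · rw [valid_append, valid_append]
    exact ⟨⟨h1, g1⟩, w1⟩
  · simp [hpl]
  · rw [outs_append]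
    rcases lt_or_ge i (σ.outs p).length with hip | hip
    · rw [List.getElem?_append_left hip] at hout ⊢
      exact hout
    · rw [List.getElem?_append_right hip] at hout ⊢
      have := congrArg (·[i - (σ.outs p).length]?) g4
      simp only [List.getElem?_take] at this
      rw [if_pos (by omega), if_pos (by omega)] at this
      exact this.trans hout
  · exact List.take_left' hpl
  · rw [List.length_append]; omega
  · omega

/-- Mismatches are witnessed by short runs. -/
theorem exists_mis_bound [Finite Q] (σ : RegSys L Q nT k) (hD : Oligomorphic L D) (K : ℕ) :
    ∃ B, ∀ (j : ℕ) (τ : List (Fin nT)) (i : ℕ), τ.length ≤ j → σ.Mis D K j τ i →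
      ∃ (e₁ e₁' e₂ e₂' : List (Lbl nT k D)) (a b : D), σ.Half K j i e₁ e₁' a ∧
        σ.Half K j i e₂ e₂' b ∧ τ <+: trs e₁ ∧ (ins e₁).take j = (ins e₂).take j ∧ a ≠ b ∧
        ∀ e ∈ [e₁, e₁', e₂, e₂'], e.length ≤ j + (i + 1) * B := by
  obtain ⟨B, hB⟩ := exists_half_bound σ hD K
  refine ⟨B, fun j τ i hτ => ?_⟩
  rintro ⟨e₁, e₁', e₂, e₂', a, b, h1, h2, h3, h4, h5⟩
  obtain ⟨g₁, g₁', p1, p2, p3, p4⟩ := hB j i e₁ e₁' a h1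
  obtain ⟨g₂, g₂', q1, q2, q3, q4⟩ := hB j i e₂ e₂' b h2
  refine ⟨g₁, g₁', g₂, g₂', a, b, p1, q1, ?_, ?_, h5, by simp [p3, p4, q3, q4]⟩
  · have : τ <+: (trs e₁).take j := by
      rw [List.prefix_iff_eq_take] at h3 ⊢
      rw [List.take_take, min_eq_left hτ, ← h3]
    rw [trs, ← List.map_take, ← p2, List.map_take] at this
    exact this.trans (List.take_prefix _ _)
  · rw [ins, ins, ← List.map_take, ← List.map_take] at h4 ⊢
    rw [p2, q2, h4]

end RegSys

end DataWord

/-! ### From register transducers to numbered register automata. -/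

namespace DataWord

section Rename

variable {L : Language} {X Y D : Type*} [L.Structure D]

/-- Renaming of the free variables of a formula. -/
def rename (g : X → Y) (φ : L.Formula X) : L.Formula Y :=
  Language.BoundedFormula.mapTermRel (g := id) (fun _ t => t.relabel (Sum.map g id)) (fun _ => id)
    (fun _ => id) φ

theorem realize_rename (g : X → Y) (φ : L.Formula X) (v : Y → D) :
    (rename g φ).Realize v ↔ φ.Realize (v ∘ g) := by
  refine Language.BoundedFormula.realize_mapTermRel_id (fun n t xs => ?_) fun _ _ _ => rfl
  rw [Language.Term.realize_relabel]
  congr 1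
  funext x
  rcases x with x | x <;> rfl

theorem rename_isQF (g : X → Y) {φ : L.Formula X} (h : φ.IsQF) : (rename g φ).IsQF := by
  induction h with
  | falsum => exact .falsum
  | of_isAtomic h =>
    cases h with
    | equal t₁ t₂ => exact .of_isAtomic (.equal _ _)
    | rel P ts => exact .of_isAtomic (.rel _ _)
  | imp _ _ h₁ h₂ => exact .imp h₁ h₂

theorem foldr_inf_isQF {l : List (L.Formula X)} (h : ∀ φ ∈ l, φ.IsQF) :
    (l.foldr (· ⊓ ·) ⊤).IsQF := by
  induction l with
  | nil => exact .top
  | cons φ l ih => exact (h φ (by simp)).inf (ih fun ψ hψ => h ψ (by simp [hψ]))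

end Rename

section Produces

variable {D : Type*} (v : ℕ → List D)

theorem flatten_prefix {m n : ℕ} (h : m ≤ n) :
    ((List.range m).map v).flatten <+: ((List.range n).map v).flatten := by
  obtain ⟨d, rfl⟩ := Nat.exists_eq_add_of_le h
  rw [List.range_add, List.map_append, List.flatten_append]
  exact List.prefix_append _ _

/-- Either the concatenation stabilises or its length is unbounded. Hence every accepting run
contributes a pair to the relation, and for a transducer that defines a function this excludes
finite outputs. -/
theorem exists_produces : ∃ w, Produces v w := by
  by_cases h : ∃ N, ∀ n ≥ N, ((List.range n).map v).flatten = ((List.range N).map v).flatten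
  · obtain ⟨N, hN⟩ := h
    exact ⟨.inl _, N, hN⟩
  push Not at h
  have hlen : ∀ l, ∃ n, l ≤ ((List.range n).map v).flatten.length := by
    intro l
    induction l with
    | zero => exact ⟨0, Nat.zero_le _⟩
    | succ l ih =>
      obtain ⟨N, hN⟩ := ih
      obtain ⟨n, hn, hne⟩ := h N
      refine ⟨n, Nat.succ_le_of_lt (hN.trans_lt ?_)⟩
      have hp := flatten_prefix v hn
      refine lt_of_le_of_ne hp.length_le fun he => hne (hp.eq_of_length he).symm
  choose n hn using fun i => hlen (i + 1)
  refine ⟨.inr fun i => ((List.range (n i)).map v).flatten[i]'(hn i), fun m =>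
    ⟨((List.range m).map v).flatten.length, ?_⟩, hlen⟩
  refine List.ext_getElem (by simp) fun i h1 h2 => ?_
  simp only [List.getElem_map, List.getElem_range]
  rcases le_total m (n i) with h | h
  · exact (flatten_prefix v h).getElem h1
  · exact ((flatten_prefix v h).getElem (hn i)).symm

end Produces

namespace NRT

variable {L : Language} {Q R D : Type*} [L.Structure D] {nT k : ℕ}

/-- The formula that describes the effect of a transition on a register. -/
def updateRule (u : RegOp) (r : Fin k) : L.Formula (Fin k ⊕ Option (Fin k)) :=
  match u with
  | .keep => Language.Term.equal (.var (.inr (some r))) (.var (.inl r))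
  | .set => Language.Term.equal (.var (.inr (some r))) (.var (.inr none))
  | .guess => ⊤

theorem updateRule_isQF (u : RegOp) (r : Fin k) : (updateRule (L := L) u r).IsQF := by
  cases u
  · exact .of_isAtomic (.equal _ _)
  · exact .of_isAtomic (.equal _ _)
  · exact .top

open Classical in
/-- Numbering of the transitions and registers of a register transducer. -/
noncomputable def toRegSys (T : NRT L Q R) (eT : T.Δ ≃ Fin nT) (eR : R ≃ Fin k) :
    RegSys L Q nT k where
  src t := (eT.symm t).1.source
  tgt t := (eT.symm t).1.target
  q₀ := T.q₀
  acc t := decide ((eT.symm t).1.target ∈ T.F)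
  rule t := rename (fun a => a.elim (.inr none) fun r => .inl (eR r)) (eT.symm t).1.test ⊓
    ((List.finRange k).map fun r => updateRule ((eT.symm t).1.update (eR.symm r)) r).foldr (· ⊓ ·) ⊤
  rule_isQF t := (rename_isQF _ (eT.symm t).1.test_isQF).inf <| foldr_inf_isQF fun φ hφ => by
    obtain ⟨r, -, rfl⟩ := List.mem_map.1 hφ
    exact updateRule_isQF _ _
  out t := (eT.symm t).1.output.map eR
  init r := T.c₀ (eR.symm r)

variable (T : NRT L Q R) (eT : T.Δ ≃ Fin nT) (eR : R ≃ Fin k)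

theorem step_toRegSys (t : Fin nT) (r : Fin k → D) (d : D) (r' : Fin k → D) :
    (T.toRegSys eT eR).Step t r d r' ↔
      (eT.symm t).1.test.Realize (fun a : Option R => a.elim d (r ∘ eR)) ∧
      (∀ ρ, (eT.symm t).1.update ρ = RegOp.keep → r' (eR ρ) = r (eR ρ)) ∧
      (∀ ρ, (eT.symm t).1.update ρ = RegOp.set → r' (eR ρ) = d) := by
  unfold RegSys.Step toRegSys
  rw [Language.Formula.realize_inf, realize_rename]
  refine and_congr ?_ ?_
  · have : (Sum.elim r (fun o => o.elim d r') ∘ fun a : Option R =>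
        a.elim (Sum.inr none) fun r => Sum.inl (eR r)) = fun a => a.elim d (r ∘ eR) := by
      funext a
      cases a <;> rfl
    rw [this]
  · unfold Language.Formula.Realize
    rw [Language.BoundedFormula.realize_foldr_inf]
    simp only [List.mem_map, List.mem_finRange, true_and, forall_exists_index,
      forall_apply_eq_imp_iff]
    rw [← forall_and, ← eR.forall_congr_right]
    refine forall_congr' fun ρ => ?_
    rw [eR.symm_apply_apply]
    have heq (a b : Fin k ⊕ Option (Fin k)) (v : Fin k ⊕ Option (Fin k) → D) :
        (Language.Term.equal (L := L) (.var a) (.var b)).Realize v ↔ v a = v b := by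
      rw [Language.Formula.realize_equal]; rfl
    cases h : (eT.symm t).1.update ρ
    · simp only [updateRule, reduceCtorEq, false_implies, and_true, true_implies]
      exact heq _ _ _
    · simp only [updateRule, reduceCtorEq, false_implies, true_and, true_implies]
      exact heq _ _ _
    · simp [updateRule]

theorem flatten_eq_outs (e : ℕ → Lbl nT k D) (n : ℕ) :
    ((List.range n).map fun n => ((T.toRegSys eT eR).out (e n).1).map (e n).2.2).flatten =
      (T.toRegSys eT eR).outs (RegSys.pre e n) := by
  simp [RegSys.outs, RegSys.pre, List.flatMap, Function.comp_def]

theorem writes_iff (e : ℕ → Lbl nT k D) {y : ℕ → D}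
    (h : Produces (fun n => ((T.toRegSys eT eR).out (e n).1).map (e n).2.2) (.inr y)) :
    (T.toRegSys eT eR).Writes e y := by
  obtain ⟨h1, h2⟩ := h
  simp only [flatten_eq_outs] at h1 h2
  refine ⟨fun n i a hi => ?_, fun i => h2 (i + 1)⟩
  obtain ⟨l, hl⟩ := h1 n
  rw [hl] at hi
  simp only [List.getElem?_map, Option.map_eq_some_iff, List.getElem?_eq_some_iff] at hi
  obtain ⟨b, ⟨hb, hb'⟩, rfl⟩ := hi
  simp at hb'
  rw [hb']

theorem definesFun_toRegSys {f : (ℕ → D) →. (ℕ → D)} (hf : T.Defines f) :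
    (T.toRegSys eT eR).DefinesFun f where
  exists_mem {e} he := by
    obtain ⟨w, hw⟩ := exists_produces fun n => ((T.toRegSys eT eR).out (e n).1).map (e n).2.2
    have hrel : T.Rel (RegSys.inWord e) w := by
      let C := (T.toRegSys eT eR).conf ((T.toRegSys eT eR).start D) e
      refine ⟨fun n => ((C n).1, (C n).2 ∘ eR), _, ?_, fun n => ?_, ?_, hw⟩
      · refine Prod.ext rfl (funext fun r => ?_)
        show ((T.c₀ (eR.symm (eR r)) : L.Constants) : D) = _
        rw [eR.symm_apply_apply]
      · obtain ⟨h1, h2⟩ := RegSys.valid_pre.1 (he.1 (n + 1)) n (Nat.lt_succ_self n)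
        rw [step_toRegSys] at h2
        refine ⟨_, (eT.symm (e n).1).2, h1, rfl, h2.1, h2.2.1, h2.2.2, ?_⟩
        simp [C, RegSys.conf, toRegSys, Function.comp_def]
      · refine Filter.frequently_atTop.2 fun n => ?_
        obtain ⟨m, hm, ha⟩ := he.2 n
        simp only [toRegSys, decide_eq_true_eq] at ha
        -- Acceptance is attached to transitions through their targets, which shifts the time by
        -- one.
        exact ⟨m + 1, by omega, ha⟩
    obtain ⟨y, hy, rfl⟩ := (hf _ _).1 hrel
    exact ⟨y, hy, T.writes_iff eT eR e hw⟩
  exists_run {x y} hy := by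
    obtain ⟨C, v, hC, hstep, hfreq, hprod⟩ := (hf x _).2 ⟨y, hy, rfl⟩
    choose t ht hsrc htgt htest hkeep hset hout using hstep
    let e : ℕ → Lbl nT k D := fun n => (eT ⟨t n, ht n⟩, x n, (C (n + 1)).2 ∘ eR.symm)
    have hconf : ∀ n, (T.toRegSys eT eR).conf ((T.toRegSys eT eR).start D) e n =
        ((C n).1, (C n).2 ∘ eR.symm) := by
      intro n
      cases n with
      | zero => rw [hC]; rfl
      | succ n => simp [RegSys.conf, toRegSys, e, htgt]
    refine ⟨e, ⟨fun n => RegSys.valid_pre.2 fun s _ => ?_, fun n => ?_⟩, rfl, ?_⟩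
    · rw [hconf]
      refine ⟨by simp [toRegSys, e, hsrc], ?_⟩
      rw [step_toRegSys]
      simp only [e, Equiv.symm_apply_apply, Function.comp_assoc, Equiv.symm_comp_self,
        Function.comp_id, Function.comp_apply]
      exact ⟨htest s, hkeep s, hset s⟩
    · obtain ⟨m, hm, hF⟩ := Filter.frequently_atTop.1 hfreq (n + 1)
      obtain ⟨d, rfl⟩ := Nat.exists_eq_add_of_le hm
      refine ⟨n + d, by omega, ?_⟩
      have : n + 1 + d = n + d + 1 := by omega
      rw [this, ← htgt] at hF
      simpa [toRegSys, e] using hF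
    · refine T.writes_iff eT eR e ?_
      convert hprod using 1
      funext n
      simp [hout, toRegSys, e, Function.comp_def]

end NRT

end DataWord

/-! ### Closure properties of decidable predicates. -/

namespace DataWord

section ComputablePred

variable {α β γ : Type*} [Primcodable α] [Primcodable β] [Primcodable γ]

theorem _root_.ComputablePred.comp {p : β → Prop} (hp : ComputablePred p) {f : α → β}
    (hf : Computable f) : ComputablePred fun a => p (f a) := by
  obtain ⟨g, hg, rfl⟩ := ComputablePred.computable_iff.1 hp
  exact ComputablePred.computable_iff.2 ⟨_, hg.comp hf, rfl⟩

theorem _root_.ComputablePred.and {p q : α → Prop} (hp : ComputablePred p)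
    (hq : ComputablePred q) : ComputablePred fun a => p a ∧ q a := by
  obtain ⟨f, hf, rfl⟩ := ComputablePred.computable_iff.1 hp
  obtain ⟨g, hg, rfl⟩ := ComputablePred.computable_iff.1 hq
  exact ComputablePred.computable_iff.2 ⟨_, Primrec.and.to_comp.comp hf hg, by simp⟩

theorem _root_.ComputablePred.imp {p q : α → Prop} (hp : ComputablePred p)
    (hq : ComputablePred q) : ComputablePred fun a => p a → q a :=
  (hp.and hq.not).not.of_eq fun a => by tauto

theorem _root_.ComputablePred.const (p : Prop) : ComputablePred fun _ : α => p := by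
  classical
  exact ComputablePred.computable_iff.2 ⟨fun _ => decide p, Computable.const _, by simp⟩

theorem _root_.ComputablePred.eq [DecidableEq β] {f g : α → β} (hf : Computable f)
    (hg : Computable g) : ComputablePred fun a => f a = g a := by
  have h : PrimrecPred fun p : β × β => p.1 = p.2 := Primrec.eq
  exact h.computablePred.comp (hf.pair hg)

theorem _root_.ComputablePred.le {f g : α → ℕ} (hf : Computable f)
    (hg : Computable g) : ComputablePred fun a => f a ≤ g a := by
  have h : PrimrecPred fun p : ℕ × ℕ => p.1 ≤ p.2 := Primrec.nat_le
  exact h.computablePred.comp (hf.pair hg)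

theorem _root_.ComputablePred.exists_lt {p : α → ℕ → Prop}
    (hp : ComputablePred fun a : α × ℕ => p a.1 a.2) {N : α → ℕ} (hN : Computable N) :
    ComputablePred fun a => ∃ n < N a, p a n := by
  obtain ⟨g, hg, hp⟩ := ComputablePred.computable_iff.1 hp
  replace hp : ∀ a n, p a n ↔ g (a, n) := fun a n => by rw [← congrFun hp (a, n)]
  refine ComputablePred.computable_iff.2
    ⟨fun a => Nat.rec false (fun n b => b || g (a, n)) (N a), ?_, ?_⟩
  · refine Computable.nat_rec hN (Computable.const false)
      (h := fun a s => s.2 || g (a, s.1)) ?_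
    exact Primrec.or.to_comp.comp (Computable.snd.comp Computable.snd)
      (hg.comp (Computable.fst.pair (Computable.fst.comp Computable.snd)))
  · funext a
    simp only [hp, eq_iff_iff]
    induction N a with
    | zero => simp
    | succ n ih => rw [Nat.exists_lt_succ_right, ih, Bool.or_eq_true]

theorem _root_.ComputablePred.forall_lt {p : α → ℕ → Prop}
    (hp : ComputablePred fun a : α × ℕ => p a.1 a.2) {N : α → ℕ} (hN : Computable N) :
    ComputablePred fun a => ∀ n < N a, p a n :=
  (ComputablePred.exists_lt (p := fun a n => ¬ p a n) hp.not hN).not.of_eq fun a => by simp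

theorem _root_.ComputablePred.exists_mem_option {p : α → β → Prop}
    (hp : ComputablePred fun a : α × β => p a.1 a.2) {o : α → Option β} (ho : Computable o) :
    ComputablePred fun a => ∃ b, o a = some b ∧ p a b := by
  obtain ⟨g, hg, hp⟩ := ComputablePred.computable_iff.1 hp
  replace hp : ∀ a n, p a n ↔ g (a, n) := fun a n => by rw [← congrFun hp (a, n)]
  refine ComputablePred.computable_iff.2
    ⟨fun a => Option.casesOn (o a) false fun b => g (a, b), ?_, ?_⟩
  · exact Computable.option_casesOn ho (Computable.const false) (g := fun a b => g (a, b)) hg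
  · funext a
    simp only [hp, eq_iff_iff]
    cases o a <;> simp

theorem _root_.ComputablePred.exists_mem_list {p : α → β → Prop}
    (hp : ComputablePred fun a : α × β => p a.1 a.2) {l : α → List β} (hl : Computable l) :
    ComputablePred fun a => ∃ b ∈ l a, p a b := by
  refine ((ComputablePred.exists_mem_option (α := α × ℕ) (p := fun a b => p a.1 b)
    (hp.comp ((Computable.fst.comp Computable.fst).pair Computable.snd))
    (Computable.list_getElem?.comp (hl.comp Computable.fst) Computable.snd)).exists_lt
    (p := fun a n => ∃ b, (l a)[n]? = some b ∧ p a b)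
    (Computable.list_length.comp hl)).of_eq fun a => ?_
  constructor
  · rintro ⟨n, -, b, hb, h⟩
    exact ⟨b, List.mem_of_getElem? hb, h⟩
  · rintro ⟨b, hb, h⟩
    obtain ⟨n, hn, rfl⟩ := List.mem_iff_getElem.1 hb
    exact ⟨n, hn, _, List.getElem?_eq_getElem hn, h⟩

theorem _root_.Computable.fin_curry₁ {n : ℕ} {f : Fin n → α → β} (hf : ∀ i, Computable (f i)) :
    Computable fun p : α × Fin n => f p.2 p.1 := by
  refine Computable.option_some_iff.1 ((Computable.list_getElem?.comp
    ((Computable.list_ofFn hf).comp Computable.fst)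
    (Primrec.fin_val.to_comp.comp Computable.snd)).of_eq fun p => ?_)
  simp

theorem _root_.ComputablePred.fin_curry₁ {n : ℕ} {p : Fin n → α → Prop}
    (hp : ∀ i, ComputablePred (p i)) : ComputablePred fun a : α × Fin n => p a.2 a.1 := by
  choose g hg hp using fun i => ComputablePred.computable_iff.1 (hp i)
  exact ComputablePred.computable_iff.2 ⟨_, Computable.fin_curry₁ hg, by
    funext a; exact congrFun (hp a.2) a.1⟩

theorem _root_.Computable.fin_pi {n : ℕ} {f : Fin n → α → β} (hf : ∀ i, Computable (f i)) :
    Computable fun a => fun i => f i a :=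
  (Primrec.vector_get'.to_comp.comp (Computable.vector_ofFn hf)).of_eq fun a => by
    funext i; simp

end ComputablePred

/-! ### Computing with codes of formulas. -/

section Codes

variable {L : Language} [Encodable (Σ n, L.Functions n)] [Encodable (Σ n, L.Relations n)]

theorem termCode_injective {n : ℕ} : Function.Injective (termCode (L := L) (n := n)) := by
  intro t
  induction t with
  | var x =>
    intro t' h
    rcases x with x | x <;> rcases t' with (y | y) | _ <;> simp [termCode, Nat.pair_eq_pair] at h
    · rw [h]
    · rw [Fin.ext h]
  | func f ts ih =>
    intro t' h
    rcases t' with (y | y) | ⟨g, ts'⟩ <;> simp [termCode, Nat.pair_eq_pair] at h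
    obtain ⟨⟨rfl, h1⟩, h2⟩ := h
    obtain rfl := eq_of_heq h1
    congr 1
    funext i
    exact ih i (congrFun (List.ofFn_injective h2) i)

theorem formulaCode_injective {n : ℕ} : Function.Injective (formulaCode (L := L) (n := n)) := by
  intro φ
  induction φ with
  | falsum => intro ψ h; cases ψ <;> simp [formulaCode, Nat.pair_eq_pair] at h ⊢
  | equal t₁ t₂ =>
    intro ψ h
    cases ψ <;> simp [formulaCode, Nat.pair_eq_pair] at h
    rw [termCode_injective h.1, termCode_injective h.2]
  | rel P ts =>
    intro ψ h
    cases ψ <;> simp [formulaCode, Nat.pair_eq_pair] at h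
    obtain ⟨⟨rfl, h1⟩, h2⟩ := h
    obtain rfl := eq_of_heq h1
    congr 1
    funext i
    exact termCode_injective (congrFun (List.ofFn_injective h2) i)
  | imp φ₁ φ₂ ih₁ ih₂ =>
    intro ψ h
    cases ψ <;> simp [formulaCode, Nat.pair_eq_pair] at h
    rw [ih₁ h.1, ih₂ h.2]
  | all φ ih =>
    intro ψ h
    cases ψ <;> simp [formulaCode, Nat.pair_eq_pair] at h
    rw [ih h]

/-- The code of the conjunction of a list of formulas. -/
def conjCode (l : List ℕ) : ℕ :=
  l.foldr (fun a b => Nat.pair 3 (Nat.pair (Nat.pair 3 (Nat.pair a (Nat.pair 3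
    (Nat.pair b (Nat.pair 0 0))))) (Nat.pair 0 0))) (formulaCode (⊤ : L.Formula ℕ))

theorem formulaCode_conj (l : List (L.Formula ℕ)) :
    formulaCode (l.foldr (· ⊓ ·) ⊤) = conjCode (L := L) (l.map formulaCode) := by
  induction l with
  | nil => rfl
  | cons φ l ih =>
    simp only [List.foldr_cons, List.map_cons, conjCode] at ih ⊢
    rw [← ih]
    rfl

theorem primrec_conjCode : Primrec (conjCode (L := L)) := by
  refine Primrec.list_foldr (f := fun l : List ℕ => l) Primrec.id (Primrec.const _)
    (h := fun _ p => Nat.pair 3 (Nat.pair (Nat.pair 3 (Nat.pair p.1 (Nat.pair 3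
      (Nat.pair p.2 (Nat.pair 0 0))))) (Nat.pair 0 0))) ?_
  have a : Primrec fun p : List ℕ × ℕ × ℕ => p.2.1 := Primrec.fst.comp Primrec.snd
  have b : Primrec fun p : List ℕ × ℕ × ℕ => p.2.2 := Primrec.snd.comp Primrec.snd
  exact Primrec₂.natPair.comp (Primrec.const 3) (Primrec₂.natPair.comp
    (Primrec₂.natPair.comp (Primrec.const 3) (Primrec₂.natPair.comp a (Primrec₂.natPair.comp
      (Primrec.const 3) (Primrec₂.natPair.comp b (Primrec.const _))))) (Primrec.const _))

theorem primrec_termCode_relabel (hL : IsRelConst L) {X α : Type*} [Primcodable α]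
    {g : α → X → ℕ} (hg : ∀ x, Primrec fun a => g a x) (t : L.Term (X ⊕ Fin 0)) :
    Primrec fun a => termCode (t.relabel (Sum.map (g a) id)) := by
  cases t with
  | var x =>
    rcases x with x | x
    · exact Primrec₂.natPair.comp (Primrec.const 0) (hg x)
    · exact x.elim0
  | @func l f ts =>
    cases l with
    | zero =>
      refine (Primrec.const (termCode (Language.Term.func f (Fin.elim0 ·) :
        L.Term (ℕ ⊕ Fin 0)))).of_eq fun a => ?_
      simp [termCode]
    | succ l => exact (hL l).elim f

/-- The formula is fixed and only the names of its variables depend on the argument, so the code is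
assembled by pairing along the fixed shape of the formula. -/
theorem primrec_formulaCode_rename (hL : IsRelConst L) {X α : Type*} [Primcodable α]
    {g : α → X → ℕ} (hg : ∀ x, Primrec fun a => g a x) {φ : L.Formula X} (hφ : φ.IsQF) :
    Primrec fun a => formulaCode (rename (g a) φ) := by
  induction hφ with
  | falsum => exact Primrec.const _
  | of_isAtomic h =>
    cases h with
    | equal t₁ t₂ =>
      exact Primrec₂.natPair.comp (Primrec.const 1) (Primrec₂.natPair.comp
        (primrec_termCode_relabel hL hg t₁) (primrec_termCode_relabel hL hg t₂))
    | rel P ts =>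
      exact Primrec₂.natPair.comp (Primrec.const 2) (Primrec₂.natPair.comp (Primrec.const _)
        (Primrec.encode.comp (Primrec.list_ofFn fun i => primrec_termCode_relabel hL hg (ts i))))
  | imp _ _ h₁ h₂ =>
    exact Primrec₂.natPair.comp (Primrec.const 3) (Primrec₂.natPair.comp h₁ h₂)

/-- The hypothesis speaks about codes; injectivity of the coding identifies the formula behind a
code. -/
theorem DecidableSat.computablePred {D : Type*} [L.Structure D] (h : DecidableSat L D) {α : Type*}
    [Primcodable α] {φ : α → L.Formula ℕ} (hφ : Computable fun a => formulaCode (φ a)) :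
    ComputablePred fun a => ∃ v : ℕ → D, (φ a).Realize v :=
  (ComputablePred.comp h hφ).of_eq fun a => by
    constructor
    · rintro ⟨ψ, h1, h2⟩
      rwa [formulaCode_injective h1] at h2
    · exact fun h => ⟨_, rfl, h⟩

end Codes

/-! ### Evaluating quantifier-free formulas on represented data values. -/

section Names

variable {L : Language} {D : Type*} [L.Structure D] (ρ : Representation L D)

/-- Names of data values: every code of the representation of `d` names `d`. -/
structure Naming where
  val : ℕ → D
  val_encode : ∀ d, val (Encodable.encode (ρ.enc d)) = d
  computable : Computable fun n => ρ.enc (val n)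

/-- Numbers that code no data value name a default element; decidability of the range of `enc` lets
one detect them. -/
theorem nonempty_naming [Nonempty D] : Nonempty (Naming ρ) := by
  classical
  obtain ⟨d₀⟩ := ‹Nonempty D›
  let w : ℕ → List (Fin ρ.size) := fun n => (Encodable.decode n).getD []
  have hw : Computable w := Computable.option_getD Computable.decode (Computable.const [])
  let val : ℕ → D := fun n => if h : ∃ d, ρ.enc d = w n then h.choose else d₀
  have hval : ∀ n, ρ.enc (val n) = if ∃ d, ρ.enc d = w n then w n else ρ.enc d₀ := by
    intro n
    by_cases h : ∃ d, ρ.enc d = w n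
    · simp only [val, dif_pos h, if_pos h]
      exact h.choose_spec
    · simp only [val, dif_neg h, if_neg h]
  refine ⟨⟨val, fun d => ρ.enc_injective ?_, ?_⟩⟩
  · rw [hval]
    simp [w]
  · refine (Computable.cond (ρ.decidable_range.comp hw).decide hw
      (Computable.const (ρ.enc d₀))).of_eq fun n => ?_
    rw [hval, Bool.cond_decide]

variable {ρ} (ν : Naming ρ)

theorem Naming.exists_termName (hL : IsRelConst L) {X α : Type*} [Primcodable α]
    {g : α → X → ℕ} (hg : ∀ x, Computable fun a => g a x) (t : L.Term (X ⊕ Fin 0)) :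
    ∃ h : α → ℕ, Computable h ∧
      ∀ a, t.realize (Sum.elim (ν.val ∘ g a) default) = ν.val (h a) := by
  cases t with
  | var x =>
    rcases x with x | x
    · exact ⟨_, hg x, fun a => rfl⟩
    · exact x.elim0
  | @func l f ts =>
    cases l with
    | zero =>
      refine ⟨_, Computable.const (Encodable.encode (ρ.enc (Language.Structure.funMap f default))),
        fun a => ?_⟩
      rw [ν.val_encode, Language.Term.realize_func]
      exact congrArg _ (Subsingleton.elim _ _)
    | succ l => exact (hL l).elim f

/-- Atoms are decided on the words of the representation, equality by injectivity of `enc`. Names of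
the finitely many constants that occur in the formula are built in. -/
theorem Naming.computablePred_realize (hL : IsRelConst L) {X α : Type*} [Primcodable α]
    {g : α → X → ℕ} (hg : ∀ x, Computable fun a => g a x) {φ : L.Formula X} (hφ : φ.IsQF) :
    ComputablePred fun a => φ.Realize (ν.val ∘ g a) := by
  induction hφ with
  | falsum => exact (ComputablePred.const False).of_eq fun a => Iff.rfl
  | of_isAtomic h =>
    cases h with
    | equal t₁ t₂ =>
      obtain ⟨h₁, hc₁, he₁⟩ := ν.exists_termName hL hg t₁
      obtain ⟨h₂, hc₂, he₂⟩ := ν.exists_termName hL hg t₂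
      refine (ComputablePred.eq (ν.computable.comp hc₁) (ν.computable.comp hc₂)).of_eq fun a => ?_
      rw [ρ.enc_injective.eq_iff, ← he₁, ← he₂]
      rfl
    | @rel l P ts =>
      choose h hc he using fun i => ν.exists_termName hL hg (ts i)
      refine ((ρ.decidable_rel _ P).comp
        (Computable.fin_pi fun i => ν.computable.comp (hc i))).of_eq fun a => ?_
      refine Iff.trans ?_ (Language.BoundedFormula.realize_rel).symm
      simp only [he]
      constructor
      · rintro ⟨v, hv, h⟩
        convert hv using 1
        exact funext fun i => (ρ.enc_injective (h i)).symm
      · exact fun h => ⟨_, h, fun _ => rfl⟩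
  | imp _ _ h₁ h₂ => exact h₁.imp h₂

end Names

end DataWord

/-! ### Runs as lists of local steps. -/

namespace DataWord

/-- The lists of length at most `B`. -/
def allLists {β : Type*} (l : List β) (B : ℕ) : List (List β) :=
  Nat.rec [ [] ] (fun _ ls => [] :: ls.flatMap fun e => l.map fun b => b :: e) B

theorem mem_allLists {β : Type*} {l : List β} (hl : ∀ b, b ∈ l) {B : ℕ} {e : List β} (he : e.length ≤ B) :
    e ∈ allLists l B := by
  induction B generalizing e with
  | zero => simp_all [allLists]
  | succ B ih =>
    cases e with
    | nil => exact List.mem_cons_self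
    | cons b e =>
      refine List.mem_cons_of_mem _ (List.mem_flatMap.2 ⟨e, ih (by simpa using he), ?_⟩)
      exact List.mem_map.2 ⟨b, hl b, rfl⟩

section Primrec

variable {α β γ : Type*} [Primcodable α] [Primcodable β] [Primcodable γ]

theorem exists_primrec_index (β : Type*) [Primcodable β] [Finite β] :
    ∃ (n : ℕ) (e : β ≃ Fin n), Primrec e := by
  obtain ⟨n, ⟨e⟩⟩ := Finite.exists_equiv_fin β
  exact ⟨n, e, Primrec.dom_finite e⟩

/-- Finite case distinctions need no uniformity in the case. This is how the fixed formulas of the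
automaton, one for each transition, enter computations. -/
theorem _root_.Primrec.finite_cases [Finite β] {f : β → α → γ} (hf : ∀ b, Primrec (f b)) :
    Primrec fun p : α × β => f p.2 p.1 := by
  obtain ⟨n, e, he⟩ := exists_primrec_index β
  have h : Primrec₂ fun (i : Fin n) (a : α) => f (e.symm i) a :=
    Primrec.fin_curry₁.2 fun i => hf _
  exact (h.comp (he.comp Primrec.snd) Primrec.fst).of_eq fun p => by simp

theorem _root_.ComputablePred.finite_cases [Finite β] {p : β → α → Prop}
    (hp : ∀ b, ComputablePred (p b)) : ComputablePred fun a : α × β => p a.2 a.1 := by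
  obtain ⟨n, e, he⟩ := exists_primrec_index β
  refine ((ComputablePred.fin_curry₁ fun i => hp (e.symm i)).comp
    (Computable.fst.pair (he.to_comp.comp Computable.snd))).of_eq fun a => ?_
  simp

theorem _root_.Primrec.list_mapIdx {f : α → List β} {g : α → ℕ → β → γ} (hf : Primrec f)
    (hg : Primrec fun p : α × ℕ × β => g p.1 p.2.1 p.2.2) :
    Primrec fun a => (f a).mapIdx (g a) := by
  refine (Primrec.list_foldl (σ := List γ) hf (Primrec.const [])
    (h := fun a p => p.1 ++ [g a p.1.length p.2]) ?_).of_eq fun a => ?_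
  · exact Primrec.list_concat.comp (Primrec.fst.comp Primrec.snd)
      (hg.comp (Primrec.fst.pair ((Primrec.list_length.comp (Primrec.fst.comp Primrec.snd)).pair
        (Primrec.snd.comp Primrec.snd))))
  · induction f a using List.reverseRecOn with
    | nil => rfl
    | append_singleton l b ih =>
      rw [List.foldl_append, ih, List.mapIdx_append]
      simp

theorem _root_.Primrec.list_countP {p : β → Bool} (hp : Primrec p) :
    Primrec fun l : List β => l.countP p := by
  have h : PrimrecPred fun b => p b = true := by
    refine ⟨inferInstance, hp.of_eq fun b => by simp⟩
  refine (Primrec.list_length.comp (Primrec.listFilter h)).of_eq fun l => ?_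
  rw [List.countP_eq_length_filter]
  simp

theorem primrec_allLists (l : List β) : Primrec (allLists l) := by
  refine Primrec.nat_rec₁ _ ?_
  refine Primrec.list_cons.comp (Primrec.const []) ?_
  refine Primrec.list_flatMap (f := fun p : ℕ × List (List β) => p.2) Primrec.snd ?_
  exact Primrec.list_map (Primrec.const l)
    (Primrec.list_cons.comp Primrec.snd (Primrec.snd.comp Primrec.fst)).to₂

end Primrec

namespace RegSys

variable {L : Language} {Q D : Type*} [L.Structure D] {nT k : ℕ} (σ : RegSys L Q nT k)

/-- A step of a run: the previous transition, the previous contents of the registers, a label. -/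
abbrev Link (nT k : ℕ) (A : Type*) : Type _ := (Option (Fin nT) × (Fin k → A)) × Lbl nT k A

/-- The steps of a run. -/
def links {A : Type*} : Option (Fin nT) × (Fin k → A) → List (Lbl nT k A) → List (Link nT k A)
  | _, [] => []
  | p, l :: e => (p, l) :: links (some l.1, l.2.2) e

/-- The data values of a step. -/
def linkVar {A : Type*} (x : Link nT k A) : Fin k ⊕ Option (Fin k) → A :=
  Sum.elim x.1.2 fun o => o.elim x.2.2.1 x.2.2.2

open Classical in
/-- The condition for a step with the transition `t` after the transition `p`. -/
noncomputable def guard (p : Option (Fin nT)) (t : Fin nT) : L.Formula (Fin k ⊕ Option (Fin k)) :=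
  if σ.src t = p.elim σ.q₀ σ.tgt then σ.rule t else ⊥

theorem guard_isQF (p : Option (Fin nT)) (t : Fin nT) : (σ.guard p t).IsQF := by
  unfold guard
  split
  · exact σ.rule_isQF t
  · exact .falsum

/-- Validity becomes a conjunction of quantifier-free conditions on single steps. The type `A` is
left open because it is used both with variables of a formula and with names of data values. -/
theorem valid_iff_links {A : Type*} (v : A → D) (p : Option (Fin nT) × (Fin k → A))
    (e : List (Lbl nT k A)) :
    σ.Valid (p.1.elim σ.q₀ σ.tgt, v ∘ p.2) (e.map (mapLbl v)) ↔
      ∀ x ∈ links p e, (σ.guard x.1.1 x.2.1).Realize (v ∘ linkVar x) := by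
  induction e generalizing p with
  | nil => simp [links]
  | cons l e ih =>
    have h := ih (some l.1, l.2.2)
    simp only [links, List.forall_mem_cons, ← h, List.map_cons, Valid]
    rw [← and_assoc]
    refine and_congr ?_ Iff.rfl
    have hv : v ∘ linkVar (p, l) =
        Sum.elim (v ∘ p.2) fun o => o.elim (mapLbl v l).2.1 (mapLbl v l).2.2 := by
      funext x
      rcases x with x | _ | x <;> rfl
    rw [hv]
    unfold guard Step mapLbl
    by_cases hs : σ.src l.1 = p.1.elim σ.q₀ σ.tgt
    · simp [hs]
    · simp [hs]

theorem primrec_links {A : Type*} [Primcodable A] : Primrec fun p : (Option (Fin nT) × (Fin k → A)) ×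
    List (Lbl nT k A) => links p.1 p.2 := by
  have h := Primrec.list_foldl (σ := (Option (Fin nT) × (Fin k → A)) × List (Link nT k A))
    (f := fun p : (Option (Fin nT) × (Fin k → A)) × List (Lbl nT k A) => p.2)
    (g := fun p => (p.1, []))
    (h := fun _ s => ((some s.2.1, s.2.2.2), s.1.2 ++ [(s.1.1, s.2)]))
    Primrec.snd (Primrec.fst.pair (Primrec.const [])) (by
      have s := Primrec.snd (α := (Option (Fin nT) × (Fin k → A)) × List (Lbl nT k A))
        (β := ((Option (Fin nT) × (Fin k → A)) × List (Link nT k A)) × Lbl nT k A)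
      have l := Primrec.snd.comp s
      have a := Primrec.fst.comp s
      exact ((Primrec.option_some.comp (Primrec.fst.comp l)).pair
        (Primrec.snd.comp (Primrec.snd.comp l))).pair
        (Primrec.list_concat.comp (Primrec.snd.comp a) ((Primrec.fst.comp a).pair l)))
  refine (Primrec.snd.comp h).of_eq fun ⟨p, e⟩ => ?_
  suffices ∀ (p) (acc : List (Link nT k A)), (e.foldl
      (fun s l => ((some l.1, l.2.2), s.2 ++ [(s.1, l)])) (p, acc)).2 = acc ++ links p e by
    simpa using this p []
  clear p
  induction e with
  | nil => intro p acc; simp [links]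
  | cons l e ih => intro p acc; simp [links, ih]

theorem primrec_linkVar {A : Type*} [Primcodable A] (x : Fin k ⊕ Option (Fin k)) :
    Primrec fun a : Link nT k A => linkVar a x := by
  have l := Primrec.snd (α := Option (Fin nT) × (Fin k → A)) (β := Lbl nT k A)
  rcases x with r | _ | r
  · exact Primrec.fin_app.comp (Primrec.snd.comp Primrec.fst) (Primrec.const r)
  · exact Primrec.fst.comp (Primrec.snd.comp l)
  · exact Primrec.fin_app.comp (Primrec.snd.comp (Primrec.snd.comp l)) (Primrec.const r)

theorem primrec_outs {A : Type*} [Primcodable A] :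
    Primrec fun e : List (Lbl nT k A) => σ.outs e := by
  refine Primrec.list_flatMap (f := fun e : List (Lbl nT k A) => e) Primrec.id ?_
  refine Primrec.list_map (f := fun p : List (Lbl nT k A) × Lbl nT k A => σ.out p.2.1)
    ((Primrec.dom_finite σ.out).comp (Primrec.fst.comp Primrec.snd)) ?_
  exact Primrec.fin_app.comp (Primrec.snd.comp (Primrec.snd.comp (Primrec.snd.comp Primrec.fst)))
    Primrec.snd

theorem primrec_visits : Primrec σ.visits := Primrec.list_countP (Primrec.dom_finite σ.acc)

theorem primrec_trs {A : Type*} [Primcodable A] :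
    Primrec fun e : List (Lbl nT k A) => trs e :=
  Primrec.list_map Primrec.id (Primrec.fst.comp Primrec.snd).to₂

theorem primrec_ins {A : Type*} [Primcodable A] :
    Primrec fun e : List (Lbl nT k A) => ins e :=
  Primrec.list_map Primrec.id (Primrec.fst.comp (Primrec.snd.comp Primrec.snd)).to₂

end RegSys

end DataWord

/-! ### The formula that expresses a mismatch with prescribed transitions. -/

namespace DataWord

namespace RegSys

variable {L : Language} {Q D : Type*} [L.Structure D] {nT k : ℕ} (σ : RegSys L Q nT k)

/-- The variable for the input data value number `s` of the run `b`; the first `j` input data values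
are common to all runs. -/
def inVar (b j s : ℕ) : ℕ := Nat.pair (if s < j then 0 else b) (Nat.pair s 0)

/-- The variable for the register `r` before the step number `s` of the run `b`. -/
def regVar (b s : ℕ) (r : Fin k) : ℕ := Nat.pair b (Nat.pair s (r + 1))

/-- The run `b` with the transitions `ts`, with variables instead of data values. -/
def symb (b j : ℕ) (ts : List (Fin nT)) : List (Lbl nT k ℕ) :=
  ts.mapIdx fun s t => (t, inVar b j s, regVar b (s + 1))

/-- The registers contain their initial values. -/
def initFormula : L.Formula (Fin k) :=
  ((List.finRange k).map fun r =>
    Language.Term.equal (.var r) (Language.Constants.term (σ.init r))).foldr (· ⊓ ·) ⊤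

theorem realize_initFormula (r : Fin k → D) :
    σ.initFormula.Realize r ↔ (σ.q₀, r) = σ.start D := by
  unfold initFormula Language.Formula.Realize start
  rw [Language.BoundedFormula.realize_foldr_inf]
  simp only [List.mem_map, List.mem_finRange, true_and, forall_exists_index,
    forall_apply_eq_imp_iff, Prod.mk.injEq, funext_iff]
  refine forall_congr' fun i => ?_
  refine (Language.Formula.realize_equal (x := r)).trans ?_
  rw [Language.Term.realize_constants]
  exact Iff.rfl

/-- The conditions for the run `b` with the transitions `ts`. -/
noncomputable def runConds (b j : ℕ) (ts : List (Fin nT)) : List (L.Formula ℕ) :=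
  rename (regVar b 0) σ.initFormula ::
    (links (none, regVar b 0) (symb (k := k) b j ts)).map fun x =>
      rename (linkVar x) (σ.guard x.1.1 x.2.1)

theorem realize_runConds (b j : ℕ) (ts : List (Fin nT)) (v : ℕ → D) :
    (∀ φ ∈ σ.runConds b j ts, φ.Realize v) ↔
      (σ.q₀, v ∘ regVar b 0) = σ.start D ∧
        σ.Valid (σ.start D) ((symb b j ts).map (mapLbl v)) := by
  have h := σ.valid_iff_links v (none, regVar b 0) (symb b j ts)
  rw [runConds, List.forall_mem_cons, realize_rename, realize_initFormula]
  refine and_congr_right fun h0 => ?_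
  rw [← h0]
  refine Iff.trans ?_ h.symm
  simp only [List.forall_mem_map, realize_rename]

/-- Two runs agree on their first `j` input data values and differ at the variables `p` and `q`. -/
noncomputable def misFormula (j : ℕ) (ts₁ ts₂ : List (Fin nT)) (p q : ℕ) : L.Formula ℕ :=
  (rename ![p, q] (Language.Term.equal (.var 0) (.var 1) : L.Formula (Fin 2)).not ::
    (σ.runConds 1 j ts₁ ++ σ.runConds 2 j ts₂)).foldr (· ⊓ ·) ⊤

theorem realize_misFormula (j : ℕ) (ts₁ ts₂ : List (Fin nT)) (p q : ℕ) (v : ℕ → D) :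
    (σ.misFormula j ts₁ ts₂ p q).Realize v ↔ v p ≠ v q ∧
      ((∀ φ ∈ σ.runConds 1 j ts₁, φ.Realize v) ∧ ∀ φ ∈ σ.runConds 2 j ts₂, φ.Realize v) := by
  unfold misFormula Language.Formula.Realize
  rw [Language.BoundedFormula.realize_foldr_inf, List.forall_mem_cons, List.forall_mem_append]
  refine and_congr ?_ Iff.rfl
  refine (realize_rename _ _ _).trans ?_
  rw [Language.Formula.realize_not, Language.Formula.realize_equal]
  rfl

section Computability

variable [Encodable (Σ n, L.Functions n)] [Encodable (Σ n, L.Relations n)]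

theorem primrec_inVar (b : ℕ) : Primrec₂ (inVar b) :=
  Primrec₂.natPair.comp
    (Primrec.ite (Primrec.nat_lt.comp Primrec.snd Primrec.fst) (Primrec.const 0) (Primrec.const b))
    (Primrec₂.natPair.comp Primrec.snd (Primrec.const 0))

theorem primrec_regVar (b : ℕ) : Primrec fun s => (regVar b s : Fin k → ℕ) :=
  Primrec.fin_curry.2 (Primrec₂.natPair.comp (Primrec.const b) (Primrec₂.natPair.comp Primrec.fst
    (Primrec.succ.comp (Primrec.fin_val.comp Primrec.snd)))).to₂

theorem primrec_symb (b : ℕ) : Primrec fun p : ℕ × List (Fin nT) => symb (k := k) b p.1 p.2 :=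
  Primrec.list_mapIdx Primrec.snd
    ((Primrec.snd.comp Primrec.snd).pair (((primrec_inVar b).comp (Primrec.fst.comp Primrec.fst)
      (Primrec.fst.comp Primrec.snd)).pair
      ((primrec_regVar b).comp (Primrec.succ.comp (Primrec.fst.comp Primrec.snd)))))

theorem primrec_guardCode (hL : IsRelConst L) : Primrec fun x : Link nT k ℕ =>
    formulaCode (rename (linkVar x) (σ.guard x.1.1 x.2.1)) :=
  (Primrec.finite_cases (f := fun (c : Option (Fin nT) × Fin nT) (x : Link nT k ℕ) =>
    formulaCode (rename (linkVar x) (σ.guard c.1 c.2)))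
    fun c => primrec_formulaCode_rename hL primrec_linkVar (σ.guard_isQF c.1 c.2)).comp
    (Primrec.id.pair ((Primrec.fst.comp Primrec.fst).pair (Primrec.fst.comp Primrec.snd)))

theorem primrec_runConds (hL : IsRelConst L) (b : ℕ) :
    Primrec fun p : ℕ × List (Fin nT) => (σ.runConds b p.1 p.2).map formulaCode := by
  refine (Primrec.list_cons.comp (Primrec.const (formulaCode (rename (regVar b 0) σ.initFormula)))
    (Primrec.list_map (primrec_links.comp ((Primrec.const (none, regVar b 0)).pair
      (primrec_symb b))) ((σ.primrec_guardCode hL).comp Primrec.snd).to₂)).of_eq fun p => ?_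
  simp [runConds]

theorem primrec_misFormula (hL : IsRelConst L) :
    Primrec fun x : (ℕ × List (Fin nT) × List (Fin nT)) × ℕ × ℕ =>
      formulaCode (σ.misFormula x.1.1 x.1.2.1 x.1.2.2 x.2.1 x.2.2) := by
  have hj := Primrec.fst.comp (Primrec.fst (α := ℕ × List (Fin nT) × List (Fin nT)) (β := ℕ × ℕ))
  have ht := Primrec.snd.comp (Primrec.fst (α := ℕ × List (Fin nT) × List (Fin nT)) (β := ℕ × ℕ))
  have hpq := Primrec.snd (α := ℕ × List (Fin nT) × List (Fin nT)) (β := ℕ × ℕ)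
  have hne : Primrec fun x : (ℕ × List (Fin nT) × List (Fin nT)) × ℕ × ℕ =>
      formulaCode (rename ![x.2.1, x.2.2]
        (Language.Term.equal (.var 0) (.var 1) : L.Formula (Fin 2)).not) := by
    refine primrec_formulaCode_rename hL (fun i => ?_) (.not (.of_isAtomic (.equal _ _)))
    refine Fin.cases ?_ (fun i => ?_) i
    · exact Primrec.fst.comp hpq
    · exact (Primrec.snd.comp hpq).of_eq fun x => by simp
  refine ((primrec_conjCode (L := L)).comp (Primrec.list_cons.comp hne (Primrec.list_append.comp
    ((σ.primrec_runConds hL 1).comp (hj.pair (Primrec.fst.comp ht)))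
    ((σ.primrec_runConds hL 2).comp (hj.pair (Primrec.snd.comp ht)))))).of_eq fun x => ?_
  rw [misFormula, formulaCode_conj, List.map_cons, List.map_append]

end Computability

section Symbolic

variable {σ}

@[simp] theorem length_symb (b j : ℕ) (ts : List (Fin nT)) : (symb (k := k) b j ts).length = ts.length := by
  simp [symb]

/-- The variables of a step depend on its position only, so the prolongation does not affect those
of the run itself. -/
theorem exists_symb_append (b j : ℕ) (t t' : List (Fin nT)) :
    ∃ e : List (Lbl nT k ℕ), symb b j (t ++ t') = symb b j t ++ e ∧ trs e = t' := by
  refine ⟨_, List.mapIdx_append, ?_⟩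
  refine List.ext_getElem (by simp) fun s h1 h2 => ?_
  simp [trs]

@[simp] theorem trs_symb (b j : ℕ) (ts : List (Fin nT)) : trs (symb (k := k) b j ts) = ts := by
  refine List.ext_getElem (by simp) fun s h1 h2 => ?_
  simp [trs, symb]

theorem ins_symb_take (b : ℕ) {j : ℕ} {ts : List (Fin nT)} (h : j ≤ ts.length) :
    (ins (symb (k := k) b j ts)).take j = (List.range j).map fun s => Nat.pair 0 (Nat.pair s 0) := by
  refine List.ext_getElem (by simp [h]) fun s h1 h2 => ?_
  have : s < j := by simpa using h2
  simp [ins, symb, inVar, this]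

/-- The data value at the variable with the parameters `s` and `r` in a run. -/
def runVal (d₀ : D) (r₀ : Fin k → D) (e : List (Lbl nT k D)) (s : ℕ) : ℕ → D
  | 0 => e[s]?.elim d₀ fun l => l.2.1
  | r + 1 => if h : r < k then ((r₀ :: e.map fun l => l.2.2)[s]?).elim d₀ (· ⟨r, h⟩) else d₀

/-- Two concrete runs can be read as one valuation because the variables that they share, the first
`j` inputs, receive equal values. -/
theorem exists_valuation (d₀ : D) (r₀ : Fin k → D) {e₁ e₂ : List (Lbl nT k D)} {j : ℕ}
    (h : ∀ s < j, (ins e₁)[s]? = (ins e₂)[s]?) :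
    ∃ v : ℕ → D, v ∘ regVar 1 0 = r₀ ∧ v ∘ regVar 2 0 = r₀ ∧
      (symb 1 j (trs e₁)).map (mapLbl v) = e₁ ∧ (symb 2 j (trs e₂)).map (mapLbl v) = e₂ := by
  -- The block `0` of common inputs is read off from `e₁`; for `e₂` the agreement of the inputs is
  -- used.
  let v : ℕ → D := fun n => runVal d₀ r₀ (if n.unpair.1 = 2 then e₂ else e₁) n.unpair.2.unpair.1
    n.unpair.2.unpair.2
  have hv : ∀ b s r, v (Nat.pair b (Nat.pair s r)) = runVal d₀ r₀ (if b = 2 then e₂ else e₁) s r :=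
    fun b s r => by simp [v]
  have hin : ∀ (e : List (Lbl nT k D)) s (hs : s < e.length), runVal d₀ r₀ e s 0 = e[s].2.1 := by
    intro e s hs
    simp [runVal, hs]
  have hreg : ∀ (e : List (Lbl nT k D)) s (hs : s < e.length) (r : Fin k),
      runVal d₀ r₀ e (s + 1) (r + 1) = e[s].2.2 r := by
    intro e s hs r
    simp [runVal, hs]
  have h0 : ∀ b, v ∘ regVar b 0 = r₀ := by
    intro b
    funext r
    simp [hv, regVar, runVal]
  refine ⟨v, h0 1, h0 2, ?_, ?_⟩
  · refine List.ext_getElem (by simp) fun s h1 h2 => Prod.ext ?_ (Prod.ext ?_ (funext fun r => ?_))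
    · simp [symb, mapLbl, trs]
    · have : (if s < j then 0 else 1) ≠ 2 := by split <;> omega
      simp [symb, mapLbl, inVar, hv, this, hin _ _ h2]
    · simp [symb, mapLbl, regVar, hv, hreg _ _ h2]
  · refine List.ext_getElem (by simp) fun s h1 h2 => Prod.ext ?_ (Prod.ext ?_ (funext fun r => ?_))
    · simp [symb, mapLbl, trs]
    · by_cases hs : s < j
      · have h3 := h s hs
        rw [List.getElem?_eq_getElem (l := ins e₂) (by simpa using h2)] at h3
        obtain ⟨h4, h5⟩ := List.getElem?_eq_some_iff.1 h3
        have h6 : s < e₁.length := by simpa using h4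
        simp only [ins, List.getElem_map] at h5
        simp [symb, mapLbl, inVar, hv, hs, hin _ _ h6, h5]
      · simp [symb, mapLbl, inVar, hv, hs, hin _ _ h2]
    · simp [symb, mapLbl, regVar, hv, hreg _ _ h2]

end Symbolic

end RegSys

end DataWord

/-! ### Mismatches are decidable. -/

namespace DataWord

namespace RegSys

variable {L : Language} {Q D : Type*} [L.Structure D] {nT k : ℕ} (σ : RegSys L Q nT k)

/-- Mismatches in terms of transitions and satisfiability. -/
def SymbMis (D : Type*) [L.Structure D] (K : ℕ) (a : ℕ × List (Fin nT) × ℕ)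
    (u w : List (Fin nT) × List (Fin nT)) : Prop :=
  ((a.2.1.length ≤ a.1 ∧ u.1.take a.2.1.length = a.2.1) ∧ (a.1 ≤ u.1.length ∧ a.1 ≤ w.1.length) ∧
    K ≤ σ.visits u.2 ∧ K ≤ σ.visits w.2) ∧
  ∃ p, (σ.outs (symb 1 a.1 u.1))[a.2.2]? = some p ∧
  ∃ q, (σ.outs (symb 2 a.1 w.1))[a.2.2]? = some q ∧
  ∃ v : ℕ → D, (σ.misFormula a.1 (u.1 ++ u.2) (w.1 ++ w.2) p q).Realize v

/-- Pairs of lists of length at most `B`. -/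
def listPairs {β : Type*} (l : List β) (B : ℕ) : List (List β × List β) :=
  (allLists l B).flatMap fun e => (allLists l B).map fun e' => (e, e')

variable {σ}

theorem SymbMis.mis {K : ℕ} {a : ℕ × List (Fin nT) × ℕ} {u w : List (Fin nT) × List (Fin nT)}
    (h : σ.SymbMis D K a u w) : σ.Mis D K a.1 a.2.1 a.2.2 := by
  obtain ⟨⟨⟨-, h1⟩, ⟨h2, h3⟩, h4, h5⟩, p, hp, q, hq, v, hv⟩ := h
  rw [realize_misFormula, realize_runConds, realize_runConds] at hv
  obtain ⟨hne, ⟨-, hv1⟩, -, hv2⟩ := hv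
  obtain ⟨e₁, he₁, ht₁⟩ := exists_symb_append (k := k) 1 a.1 u.1 u.2
  obtain ⟨e₂, he₂, ht₂⟩ := exists_symb_append (k := k) 2 a.1 w.1 w.2
  rw [he₁, List.map_append] at hv1
  rw [he₂, List.map_append] at hv2
  refine ⟨_, _, _, _, v p, v q, ⟨hv1, by simpa using h2, by simpa [ht₁] using h4, ?_⟩,
    ⟨hv2, by simpa using h3, by simpa [ht₂] using h5, ?_⟩, ?_, ?_, hne⟩
  · rw [outs_map, List.getElem?_map, hp]; rfl
  · rw [outs_map, List.getElem?_map, hq]; rfl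
  · rw [trs_map, trs_symb, List.prefix_iff_eq_take, h1]
  · rw [ins_map, ins_map, ← List.map_take, ← List.map_take, ins_symb_take _ h2, ins_symb_take _ h3]

theorem mem_listPairs {β : Type*} {l : List β} (hl : ∀ b, b ∈ l) {B : ℕ} {e e' : List β}
    (he : e.length ≤ B) (he' : e'.length ≤ B) : (e, e') ∈ listPairs l B :=
  List.mem_flatMap.2 ⟨e, mem_allLists hl he, List.mem_map.2 ⟨e', mem_allLists hl he', rfl⟩⟩

/-- Short witnesses provide transition sequences from an explicit finite list, and their data values
provide the satisfying valuation. -/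
theorem Mis.exists_symbMis {K B : ℕ} (hB : ∀ (j : ℕ) (τ : List (Fin nT)) (i : ℕ), τ.length ≤ j →
      σ.Mis D K j τ i → ∃ (e₁ e₁' e₂ e₂' : List (Lbl nT k D)) (a b : D), σ.Half K j i e₁ e₁' a ∧
        σ.Half K j i e₂ e₂' b ∧ τ <+: trs e₁ ∧ (ins e₁).take j = (ins e₂).take j ∧ a ≠ b ∧
        ∀ e ∈ [e₁, e₁', e₂, e₂'], e.length ≤ j + (i + 1) * B)
    {a : ℕ × List (Fin nT) × ℕ} (ha : a.2.1.length ≤ a.1) (h : σ.Mis D K a.1 a.2.1 a.2.2) :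
    ∃ u ∈ listPairs (List.finRange nT) (a.1 + (a.2.2 + 1) * B),
      ∃ w ∈ listPairs (List.finRange nT) (a.1 + (a.2.2 + 1) * B), σ.SymbMis D K a u w := by
  obtain ⟨j, τ, i⟩ := a
  obtain ⟨e₁, e₁', e₂, e₂', x, y, h1, h2, h3, h4, h5, h6⟩ := hB j τ i ha h
  simp only [List.mem_cons, List.not_mem_nil, or_false, forall_eq_or_imp, forall_eq] at h6
  have h4' : ∀ s < j, (ins (e₁ ++ e₁'))[s]? = (ins (e₂ ++ e₂'))[s]? := by
    intro s hs
    have := congrArg (·[s]?) h4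
    simp only [List.getElem?_take, if_pos hs] at this
    rw [ins_append, ins_append, List.getElem?_append_left (by simpa using hs.trans_le h1.le_length),
      List.getElem?_append_left (by simpa using hs.trans_le h2.le_length), this]
  obtain ⟨v, v1, v2, v3, v4⟩ := exists_valuation x (σ.start D).2 h4'
  rw [trs_append] at v3 v4
  have key : ∀ (b : ℕ) (e e' : List (Lbl nT k D)),
      (symb b j (trs e ++ trs e')).map (mapLbl v) = e ++ e' →
      (symb b j (trs e)).map (mapLbl v) = e := by
    intro b e e' he
    obtain ⟨r, hr, -⟩ := exists_symb_append (k := k) b j (trs e) (trs e')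
    rw [hr, List.map_append] at he
    exact (List.append_inj he (by simp)).1
  have hout : ∀ (b : ℕ) (e e' : List (Lbl nT k D)) z, σ.Half K j i e e' z →
      (symb b j (trs e ++ trs e')).map (mapLbl v) = e ++ e' →
      ∃ p, (σ.outs (symb b j (trs e)))[i]? = some p ∧ v p = z := by
    intro b e e' z hz he
    have := hz.outs
    rw [← key b e e' he, outs_map, List.getElem?_map, Option.map_eq_some_iff] at this
    exact this
  obtain ⟨p, hp, hpv⟩ := hout 1 e₁ e₁' x h1 v3
  obtain ⟨q, hq, hqv⟩ := hout 2 e₂ e₂' y h2 v4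
  refine ⟨(trs e₁, trs e₁'), mem_listPairs (List.mem_finRange ·) (by simpa using h6.1)
    (by simpa using h6.2.1), (trs e₂, trs e₂'), mem_listPairs (List.mem_finRange ·)
    (by simpa using h6.2.2.1) (by simpa using h6.2.2.2),
    ⟨⟨ha, (List.prefix_iff_eq_take.1 h3).symm⟩, ⟨by simpa using h1.le_length,
      by simpa using h2.le_length⟩, h1.visits, h2.visits⟩, p, hp, q, hq, v, ?_⟩
  rw [realize_misFormula, realize_runConds, realize_runConds, v1, v2, v3, v4, hpv, hqv]
  exact ⟨h5, ⟨rfl, h1.valid⟩, rfl, h2.valid⟩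

variable (σ)

section Computability

variable [Encodable (Σ n, L.Functions n)] [Encodable (Σ n, L.Relations n)]

theorem primrec_listPairs {β : Type*} [Primcodable β] (l : List β) : Primrec (listPairs l) :=
  Primrec.list_flatMap (primrec_allLists l) (Primrec.list_map ((primrec_allLists l).comp Primrec.fst)
    (Primrec.pair (Primrec.snd.comp Primrec.fst) Primrec.snd).to₂).to₂

theorem primrec_outs_symb (b : ℕ) : Primrec fun p : (ℕ × List (Fin nT)) × ℕ =>
    (σ.outs (symb (k := k) b p.1.1 p.1.2))[p.2]? :=
  Primrec.list_getElem?.comp (σ.primrec_outs.comp ((primrec_symb b).comp Primrec.fst)) Primrec.snd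

/-- The length of the common input, a sequence of transitions, a position of the output, and the
transitions of two runs. -/
abbrev MisInput (nT : ℕ) : Type :=
  ((ℕ × List (Fin nT) × ℕ) × (List (Fin nT) × List (Fin nT))) × (List (Fin nT) × List (Fin nT))

theorem computablePred_symbMis (hL : IsRelConst L) (hsat : DecidableSat L D) (K : ℕ) :
    ComputablePred fun x : MisInput nT => σ.SymbMis D K x.1.1 x.1.2 x.2 := by
  have a : Primrec fun x : MisInput nT => x.1.1 := Primrec.fst.comp Primrec.fst
  have j : Primrec fun x : MisInput nT => x.1.1.1 := Primrec.fst.comp a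
  have τ : Primrec fun x : MisInput nT => x.1.1.2.1 := Primrec.fst.comp (Primrec.snd.comp a)
  have i : Primrec fun x : MisInput nT => x.1.1.2.2 := Primrec.snd.comp (Primrec.snd.comp a)
  have u : Primrec fun x : MisInput nT => x.1.2 := Primrec.snd.comp Primrec.fst
  have w : Primrec fun x : MisInput nT => x.2 := Primrec.snd
  have u1 := Primrec.fst.comp u
  have u2 := Primrec.snd.comp u
  have w1 := Primrec.fst.comp w
  have w2 := Primrec.snd.comp w
  have len := Primrec.list_length (α := Fin nT)
  have vis := σ.primrec_visits
  refine ComputablePred.and (ComputablePred.and (ComputablePred.and ?_ ?_) (ComputablePred.and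
    (ComputablePred.and ?_ ?_) (ComputablePred.and ?_ ?_))) ?_
  · exact .le (len.comp τ).to_comp j.to_comp
  · exact .eq (Primrec.list_take.comp (len.comp τ) u1).to_comp τ.to_comp
  · exact .le j.to_comp (len.comp u1).to_comp
  · exact .le j.to_comp (len.comp w1).to_comp
  · exact .le (Computable.const K) (vis.comp u2).to_comp
  · exact .le (Computable.const K) (vis.comp w2).to_comp
  · have g1 : Primrec fun x : MisInput nT => ((x.1.1.1, x.1.2.1), x.1.1.2.2) := (j.pair u1).pair i
    have o1 := (σ.primrec_outs_symb 1).comp g1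
    have g2 : Primrec fun x : MisInput nT => ((x.1.1.1, x.2.1), x.1.1.2.2) := (j.pair w1).pair i
    have o2 := (σ.primrec_outs_symb 2).comp g2
    refine ComputablePred.exists_mem_option (p := fun x p =>
      ∃ q, (σ.outs (symb 2 x.1.1.1 x.2.1))[x.1.1.2.2]? = some q ∧ ∃ v : ℕ → D,
        (σ.misFormula x.1.1.1 (x.1.2.1 ++ x.1.2.2) (x.2.1 ++ x.2.2) p q).Realize v) ?_ o1.to_comp
    refine ComputablePred.exists_mem_option (p := fun (x : MisInput nT × ℕ) q => ∃ v : ℕ → D,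
        (σ.misFormula x.1.1.1.1 (x.1.1.2.1 ++ x.1.1.2.2) (x.1.2.1 ++ x.1.2.2) x.2 q).Realize v) ?_
        (o2.to_comp.comp Computable.fst)
    have f : Primrec fun y : (MisInput nT × ℕ) × ℕ => y.1.1 := Primrec.fst.comp Primrec.fst
    have pq : Primrec fun y : (MisInput nT × ℕ) × ℕ => (y.1.2, y.2) :=
      (Primrec.snd.comp Primrec.fst).pair Primrec.snd
    have t1 : Primrec fun x : MisInput nT => x.1.2.1 ++ x.1.2.2 := Primrec.list_append.comp u1 u2
    have t2 : Primrec fun x : MisInput nT => x.2.1 ++ x.2.2 := Primrec.list_append.comp w1 w2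
    have t : Primrec fun x : MisInput nT => (x.1.1.1, x.1.2.1 ++ x.1.2.2, x.2.1 ++ x.2.2) := j.pair (t1.pair t2)
    have g := (t.comp f).pair pq
    have h := ((σ.primrec_misFormula hL).comp g).to_comp
    exact hsat.computablePred h

/-- A bounded search over transition sequences with a satisfiability test for each. The condition on
the length of `τ` is what the bound on witnesses requires. -/
theorem computablePred_mis [Finite Q] (hL : IsRelConst L) (hD : Oligomorphic L D)
    (hsat : DecidableSat L D) (K : ℕ) :
    ComputablePred fun a : ℕ × List (Fin nT) × ℕ =>
      a.2.1.length ≤ a.1 ∧ σ.Mis D K a.1 a.2.1 a.2.2 := by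
  obtain ⟨B, hB⟩ := exists_mis_bound σ hD K
  have hpairs : Primrec fun a : ℕ × List (Fin nT) × ℕ =>
      listPairs (List.finRange nT) (a.1 + (a.2.2 + 1) * B) :=
    (primrec_listPairs _).comp (Primrec.nat_add.comp Primrec.fst (Primrec.nat_mul.comp
      (Primrec.succ.comp (Primrec.snd.comp Primrec.snd)) (Primrec.const B)))
  refine (ComputablePred.exists_mem_list (p := fun a u =>
    ∃ w ∈ listPairs (List.finRange nT) (a.1 + (a.2.2 + 1) * B), σ.SymbMis D K a u w) ?_
    hpairs.to_comp).of_eq fun a => ?_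
  · exact ComputablePred.exists_mem_list (p := fun (x : (ℕ × List (Fin nT) × ℕ) ×
      (List (Fin nT) × List (Fin nT))) w => σ.SymbMis D K x.1 x.2 w)
      (σ.computablePred_symbMis hL hsat K) (hpairs.to_comp.comp Computable.fst)
  · constructor
    · rintro ⟨u, -, w, -, h⟩
      exact ⟨h.1.1.1, h.mis⟩
    · rintro ⟨h1, h2⟩
      exact h2.exists_symbMis hB h1

end Computability

end RegSys

end DataWord

/-! ### Searching for certified output letters. -/

namespace DataWord

theorem _root_.Computable.decode_bind {α β γ : Type*} [Primcodable α] [Primcodable β]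
    [Primcodable γ] {c : α → ℕ} (hc : Computable c) {g : α → β → Option γ}
    (hg : Computable fun p : α × β => g p.1 p.2) :
    Computable fun a => (Encodable.decode (c a)).bind (g a) :=
  Computable.option_bind (Computable.decode.comp hc) hg

namespace RegSys

variable {L : Language} {Q D : Type*} [L.Structure D] {nT k : ℕ} (σ : RegSys L Q nT k)
  {ρ : Representation L D} (ν : Naming ρ)

/-- A run, a prolongation of the run, and a length of the input. -/
abbrev Cand (nT k : ℕ) : Type := List (Lbl nT k ℕ) × List (Lbl nT k ℕ) × ℕ

/-- Names of the initial contents of the registers. -/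
def startNames (ρ : Representation L D) : Fin k → ℕ :=
  fun r => Encodable.encode (ρ.enc (σ.init r : D))

/-- The run certifies that its output at position `i` is the output of `f` at position `i` for all
inputs that start with the letters named by `u`. -/
def Certifies (K : ℕ) (κ : List (Fin nT) → List (Fin nT)) (u : List ℕ) (i : ℕ)
    (x : Cand nT k) : Prop :=
  (x.2.2 ≤ u.length ∧ x.2.2 ≤ x.1.length) ∧ (ins x.1).take x.2.2 = u.take x.2.2 ∧
    K ≤ σ.visits (trs x.2.1) ∧
    (∀ l ∈ links (none, σ.startNames ρ) (x.1 ++ x.2.1),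
      (σ.guard l.1.1 l.2.1).Realize (ν.val ∘ linkVar l)) ∧
    ¬ (((κ ((trs x.1).take x.2.2)).length ≤ x.2.2) ∧
      σ.Mis D K x.2.2 (κ ((trs x.1).take x.2.2)) i)

open Classical in
/-- The letter at position `i` of the output that a run certifies. -/
noncomputable def certified (K : ℕ) (κ : List (Fin nT) → List (Fin nT)) (a : List ℕ × ℕ × ℕ)
    (x : Cand nT k) : Option (List (Fin ρ.size)) :=
  bif decide (σ.Certifies ν K κ a.1 a.2.1 x) then
    (σ.outs x.1)[a.2.1]?.map fun p => ρ.enc (ν.val p)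
  else none

/-- The search for a letter at position `i` of the output. -/
noncomputable def search (K : ℕ) (κ : List (Fin nT) → List (Fin nT)) (a : List ℕ × ℕ × ℕ) :
    Option (List (Fin ρ.size)) :=
  (Primcodable.toEncodable.decode (α := Cand nT k) a.2.2.unpair.1).bind (σ.certified ν K κ a)

variable {σ ν} {K : ℕ} {κ : List (Fin nT) → List (Fin nT)} {f : (ℕ → D) →. (ℕ → D)}

theorem search_eq_some {a : List ℕ × ℕ × ℕ} {w : List (Fin ρ.size)}
    (h : σ.search ν K κ a = some w) :
    ∃ x : Cand nT k, σ.Certifies ν K κ a.1 a.2.1 x ∧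
      ∃ p, (σ.outs x.1)[a.2.1]? = some p ∧ ρ.enc (ν.val p) = w := by
  classical
  obtain ⟨x, -, hx⟩ := Option.bind_eq_some_iff.1 h
  unfold certified at hx
  by_cases hc : σ.Certifies ν K κ a.1 a.2.1 x
  · rw [decide_eq_true hc, cond_true, Option.map_eq_some_iff] at hx
    exact ⟨x, hc, hx⟩
  · rw [decide_eq_false hc] at hx
    simp at hx

theorem val_comp_startNames : (σ.q₀, ν.val ∘ σ.startNames ρ) = σ.start D :=
  Prod.ext rfl (funext fun _ => ν.val_encode _)

/-- A wrong letter would make the certifying run and a long prefix of an accepting run on `x` a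
mismatch. No continuity is needed. -/
theorem search_sound (hκ : ∀ l, κ l <+: l) (hf : σ.DefinesFun f) {x y : ℕ → D} (hy : y ∈ f x)
    {j i c : ℕ} {w : List (Fin ρ.size)}
    (h : σ.search ν K κ (letterCodes ρ.enc x j, i, c) = some w) : w = ρ.enc (y i) := by
  obtain ⟨⟨e, e', n⟩, ⟨⟨h1, h2⟩, h3, h4, h5, h6⟩, p, hp, rfl⟩ := search_eq_some h
  simp only [length_letterCodes] at h1 h2 h3 h4 h5 h6 hp
  -- The length condition, present in `Certifies` for the sake of decidability, holds automatically.
  have hlen : (κ ((trs e).take n)).length ≤ n :=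
    (hκ _).length_le.trans (List.length_take_le _ _)
  have hmis : ¬ σ.Mis D K n (κ ((trs e).take n)) i := fun hm => h6 ⟨hlen, hm⟩
  clear h6
  by_contra hne
  obtain ⟨g, hg, rfl, hw⟩ := hf.exists_run hy
  obtain ⟨N, hN, g', hg'⟩ := hg.exists_half hw K n i
  have hv := (σ.valid_iff_links ν.val (none, σ.startNames ρ) (e ++ e')).2 h5
  simp only [Option.elim_none, val_comp_startNames, List.map_append] at hv
  refine hmis ⟨e.map (mapLbl ν.val), e'.map (mapLbl ν.val), pre g N, g', ν.val p, y i,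
    ⟨hv, by simpa using h2, by simpa using h4, ?_⟩, hg', ?_, ?_, fun h => hne (h ▸ rfl)⟩
  · rw [outs_map, List.getElem?_map, hp]; rfl
  · rw [trs_map]
    exact (hκ _).trans (List.take_prefix _ _)
  · rw [ins_map, ← List.map_take, h3, ins_pre_take hN, letterCodes, ← List.map_take, List.take_range,
      min_eq_left h1, List.map_map]
    exact List.map_congr_left fun s _ => ν.val_encode _

/-- A long prefix of the accepting run, written with names, is itself a certificate. Only `j`
letters of the input are checked, so it stays valid when more have been read, and the counters
`Nat.pair c N` return to it for every `N`. -/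
theorem search_complete {e : ℕ → Lbl nT k D} (he : σ.Accepts (σ.start D) e)
    {y : ℕ → D} (hw : σ.Writes e y) {i j : ℕ} (h : ¬ σ.Mis D K j (κ (trs (pre e j))) i) :
    ∃ c, ∀ N, ∀ j' ≥ j,
      σ.search ν K κ (letterCodes ρ.enc (inWord e) j', i, Nat.pair c N) ≠ none := by
  obtain ⟨n, hn, e', hhalf⟩ := he.exists_half hw K j i
  let nm : D → ℕ := fun d => Encodable.encode (ρ.enc d)
  have hnm : ν.val ∘ nm = id := funext fun d => ν.val_encode d
  have hmap : ∀ l : List (Lbl nT k D), (l.map (mapLbl nm)).map (mapLbl ν.val) = l := by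
    intro l
    rw [List.map_map]
    convert List.map_id l using 2
    funext a
    simp only [mapLbl, Function.comp_apply, ← Function.comp_assoc, hnm]
    exact Prod.ext rfl (Prod.ext (ν.val_encode _) rfl)
  let x : Cand nT k := ((pre e n).map (mapLbl nm), e'.map (mapLbl nm), j)
  refine ⟨Primcodable.toEncodable.encode x, fun N j' hj' => ?_⟩
  have hcert : σ.Certifies ν K κ (letterCodes ρ.enc (inWord e) j') i x := by
    refine ⟨⟨by simpa [x] using hj', by simpa [x] using hn⟩, ?_, by simpa [x] using hhalf.visits,
      ?_, fun hm => h ?_⟩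
    · simp only [x]
      rw [ins_map, ← List.map_take, ins_pre_take hn, letterCodes, ← List.map_take, List.take_range,
        min_eq_left hj', pre, List.map_map]
      rfl
    · refine (σ.valid_iff_links ν.val (none, σ.startNames ρ) _).1 ?_
      simp only [x, Option.elim_none, val_comp_startNames, List.map_append, hmap]
      exact hhalf.valid
    · have := hm.2
      simp only [x, trs_map] at this
      rwa [trs_pre, pre_take _ hn, ← trs_pre] at this
  have hout : (σ.outs x.1)[i]? = some (nm (y i)) := by
    simp only [x]
    rw [outs_map, List.getElem?_map, hhalf.outs]
    rfl
  simp [search, certified, hcert, hout]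

section Computability

variable (σ ν) [Encodable (Σ n, L.Functions n)] [Encodable (Σ n, L.Relations n)]

theorem computablePred_guards (hL : IsRelConst L) : ComputablePred fun e : List (Lbl nT k ℕ) =>
    ∀ l ∈ links (none, σ.startNames ρ) e,
      (σ.guard l.1.1 l.2.1).Realize (ν.val ∘ linkVar l) := by
  have h : ComputablePred fun l : Link nT k ℕ =>
      (σ.guard l.1.1 l.2.1).Realize (ν.val ∘ linkVar l) :=
    (ComputablePred.finite_cases
      (p := fun (c : Option (Fin nT) × Fin nT) (l : Link nT k ℕ) =>
        (σ.guard c.1 c.2).Realize (ν.val ∘ linkVar l))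
      fun c => ν.computablePred_realize hL (fun x => (primrec_linkVar x).to_comp)
        (σ.guard_isQF c.1 c.2)).comp
      (Primrec.id.pair ((Primrec.fst.comp Primrec.fst).pair (Primrec.fst.comp Primrec.snd))).to_comp
  refine (ComputablePred.exists_mem_list
    (p := fun (_ : List (Lbl nT k ℕ)) l => ¬ (σ.guard l.1.1 l.2.1).Realize (ν.val ∘ linkVar l))
    (h.not.comp Computable.snd) (l := fun e => links (none, σ.startNames ρ) e)
    (primrec_links.comp ((Primrec.const _).pair Primrec.id)).to_comp).not.of_eq fun e => ?_
  push Not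
  rfl

theorem computablePred_certifies [Finite Q] (hL : IsRelConst L) (hD : Oligomorphic L D)
    (hsat : DecidableSat L D) (K : ℕ) {κ : List (Fin nT) → List (Fin nT)} (hκ : Primrec κ) :
    ComputablePred fun a : (List ℕ × ℕ) × Cand nT k => σ.Certifies ν K κ a.1.1 a.1.2 a.2 := by
  have u : Primrec fun a : (List ℕ × ℕ) × Cand nT k => a.1.1 := Primrec.fst.comp Primrec.fst
  have i : Primrec fun a : (List ℕ × ℕ) × Cand nT k => a.1.2 := Primrec.snd.comp Primrec.fst
  have e : Primrec fun a : (List ℕ × ℕ) × Cand nT k => a.2.1 := Primrec.fst.comp Primrec.snd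
  have e' : Primrec fun a : (List ℕ × ℕ) × Cand nT k => a.2.2.1 :=
    Primrec.fst.comp (Primrec.snd.comp Primrec.snd)
  have j : Primrec fun a : (List ℕ × ℕ) × Cand nT k => a.2.2.2 :=
    Primrec.snd.comp (Primrec.snd.comp Primrec.snd)
  have τ : Primrec fun a : (List ℕ × ℕ) × Cand nT k => κ ((trs a.2.1).take a.2.2.2) :=
    hκ.comp (Primrec.list_take.comp j (primrec_trs.comp e))
  refine ((ComputablePred.le j.to_comp (Primrec.list_length.comp u).to_comp).and
    (ComputablePred.le j.to_comp (Primrec.list_length.comp e).to_comp)).and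
    (ComputablePred.and ?_ (ComputablePred.and ?_ (ComputablePred.and ?_ ?_)))
  · exact .eq (Primrec.list_take.comp j (primrec_ins.comp e)).to_comp
      (Primrec.list_take.comp j u).to_comp
  · exact .le (Computable.const K) (σ.primrec_visits.comp (primrec_trs.comp e')).to_comp
  · exact (σ.computablePred_guards ν hL).comp (Primrec.list_append.comp e e').to_comp
  · exact ((σ.computablePred_mis hL hD hsat K).comp (j.pair (τ.pair i)).to_comp).not

theorem computable_certified [Finite Q] (hL : IsRelConst L) (hD : Oligomorphic L D)
    (hsat : DecidableSat L D) (K : ℕ) {κ : List (Fin nT) → List (Fin nT)} (hκ : Primrec κ) :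
    Computable fun b : (List ℕ × ℕ × ℕ) × Cand nT k => σ.certified ν K κ b.1 b.2 := by
  classical
  have u : Primrec fun b : (List ℕ × ℕ × ℕ) × Cand nT k => b.1.1 := Primrec.fst.comp Primrec.fst
  have i : Primrec fun b : (List ℕ × ℕ × ℕ) × Cand nT k => b.1.2.1 :=
    Primrec.fst.comp (Primrec.snd.comp Primrec.fst)
  have hx : Primrec fun b : (List ℕ × ℕ × ℕ) × Cand nT k => b.2 := Primrec.snd
  have g : Primrec fun b : (List ℕ × ℕ × ℕ) × Cand nT k => ((b.1.1, b.1.2.1), b.2) :=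
    (u.pair i).pair hx
  have c := ((σ.computablePred_certifies ν hL hD hsat K hκ).comp g.to_comp).decide
  have e := σ.primrec_outs.comp (Primrec.fst.comp hx)
  have o := (Primrec.list_getElem?.comp e i).to_comp
  have h := Computable.option_map o (ν.computable.comp Computable.snd).to₂
  exact Computable.cond c h (Computable.const none)

theorem computable_search [Finite Q] (hL : IsRelConst L) (hD : Oligomorphic L D)
    (hsat : DecidableSat L D) (K : ℕ) {κ : List (Fin nT) → List (Fin nT)} (hκ : Primrec κ) :
    Computable (σ.search ν K κ) := by
  have h : Computable fun a : List ℕ × ℕ × ℕ => a.2.2.unpair.1 := Computable.fst.comp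
    (Computable.unpair.comp (Computable.snd.comp Computable.snd))
  exact Computable.decode_bind h (σ.computable_certified ν hL hD hsat K hκ)

end Computability

end RegSys

end DataWord

/-! ### Correctness of the letter-by-letter algorithm. -/

namespace DataWord

section Online

variable {n : ℕ} {D : Type*} {chk : List ℕ × ℕ × ℕ → Option (List (Fin n))} {rd : ℕ × ℕ → Bool}
  {enc : D → List (Fin n)} {x y : ℕ → D}

/-- The run of an online algorithm. -/
def letterRun (chk : List ℕ × ℕ × ℕ → Option (List (Fin n))) (rd : ℕ × ℕ → Bool)
    (enc : D → List (Fin n)) (x : ℕ → D) (k : ℕ) : LetterCfg n :=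
  (letterStep chk rd enc x)^[k] ⟨0, 0, 0, []⟩

theorem letterRun_succ (k : ℕ) : letterRun chk rd enc x (k + 1) =
    letterStep chk rd enc x (letterRun chk rd enc x k) :=
  Function.iterate_succ_apply' _ _ _

theorem letterStep_some {c : LetterCfg n} {w : List (Fin n)}
    (h : chk (letterCodes enc x c.read, c.written, c.counter) = some w) :
    letterStep chk rd enc x c =
      ⟨c.read, c.written + 1, 0, c.out ++ (w.map some ++ [none])⟩ := by
  simp [letterStep, h]

theorem letterStep_none {c : LetterCfg n}
    (h : chk (letterCodes enc x c.read, c.written, c.counter) = none) :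
    letterStep chk rd enc x c =
      ⟨if rd (c.read, c.written) then c.read + 1 else c.read, c.written, c.counter + 1, c.out⟩ := by
  simp [letterStep, h]

/-- The letters found by `chk` are correct. -/
def Sound (chk : List ℕ × ℕ × ℕ → Option (List (Fin n))) (enc : D → List (Fin n))
    (x y : ℕ → D) : Prop :=
  ∀ j i c w, chk (letterCodes enc x j, i, c) = some w → w = enc (y i)

/-- The letter number `i` is eventually found when `j` letters have been read. -/
def Finds (chk : List ℕ × ℕ × ℕ → Option (List (Fin n))) (enc : D → List (Fin n))
    (x : ℕ → D) (i j : ℕ) : Prop :=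
  ∃ c, ∀ N, ∀ j' ≥ j, chk (letterCodes enc x j', i, Nat.pair c N) ≠ none

theorem Sound.out_eq (h : Sound chk enc x y) (k : ℕ) :
    (letterRun chk rd enc x k).out = encPrefix enc y (letterRun chk rd enc x k).written := by
  induction k with
  | zero => rfl
  | succ k ih =>
    rw [letterRun_succ]
    cases hc : chk (letterCodes enc x (letterRun chk rd enc x k).read,
      (letterRun chk rd enc x k).written, (letterRun chk rd enc x k).counter) with
    | none => rw [letterStep_none hc]; exact ih
    | some w =>
      rw [letterStep_some hc, encPrefix_succ, ← ih, h _ _ _ _ hc]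

/-- If the letter were never written, the counter would run through all large numbers, while reading
stops only at a point where the letter can be found, or goes on for ever and passes such a point. -/
theorem exists_written (hfalse : ∀ i j, rd (j, i) = false → Finds chk enc x i j)
    (hfind : ∀ i, ∃ j, Finds chk enc x i j) (i : ℕ) :
    ∃ k, (letterRun chk rd enc x k).written = i := by
  induction i with
  | zero => exact ⟨0, rfl⟩
  | succ i ih =>
    obtain ⟨k, hk⟩ := ih
    by_contra! hne
    let c := letterRun chk rd enc x k
    have hnone : ∀ m, (letterRun chk rd enc x (k + m)).written = i →
        chk (letterCodes enc x (letterRun chk rd enc x (k + m)).read,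
          (letterRun chk rd enc x (k + m)).written,
          (letterRun chk rd enc x (k + m)).counter) = none := by
      intro m hm
      by_contra hc
      obtain ⟨w, hw⟩ := Option.ne_none_iff_exists'.1 hc
      refine hne (k + m + 1) ?_
      rw [letterRun_succ, letterStep_some hw]
      exact congrArg (· + 1) hm
    have hinv : ∀ m, (letterRun chk rd enc x (k + m)).written = i ∧
        (letterRun chk rd enc x (k + m)).counter = c.counter + m := by
      intro m
      induction m with
      | zero => exact ⟨hk, rfl⟩
      | succ m ih =>
        rw [← Nat.add_assoc, letterRun_succ, letterStep_none (hnone m ih.1)]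
        exact ⟨ih.1, congrArg (· + 1) ih.2⟩
    have hread : ∀ m, (letterRun chk rd enc x (k + m + 1)).read =
        if rd ((letterRun chk rd enc x (k + m)).read, i) then
          (letterRun chk rd enc x (k + m)).read + 1 else (letterRun chk rd enc x (k + m)).read := by
      intro m
      rw [letterRun_succ, letterStep_none (hnone m (hinv m).1), (hinv m).1]
    have hmono : ∀ m d, (letterRun chk rd enc x (k + m)).read ≤
        (letterRun chk rd enc x (k + (m + d))).read := by
      intro m d
      induction d with
      | zero => exact le_rfl
      | succ d ih =>
        refine ih.trans ?_
        have := hread (m + d)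
        rw [← Nat.add_assoc m d 1, ← Nat.add_assoc k (m + d) 1, this]
        split <;> omega
    have hM : ∃ M, Finds chk enc x i (letterRun chk rd enc x (k + M)).read := by
      by_cases h : ∃ m, rd ((letterRun chk rd enc x (k + m)).read, i) = false
      · obtain ⟨m, hm⟩ := h
        exact ⟨m, hfalse _ _ hm⟩
      · simp only [not_exists, Bool.not_eq_false] at h
        obtain ⟨j, d, hd⟩ := hfind i
        refine ⟨j, d, fun N j' hj' => hd N j' (le_trans ?_ hj')⟩
        have : ∀ m, m ≤ (letterRun chk rd enc x (k + m)).read := by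
          intro m
          induction m with
          | zero => exact Nat.zero_le _
          | succ m ih => rw [← Nat.add_assoc, hread, if_pos (h m)]; omega
        exact this j
    obtain ⟨M, d, hd⟩ := hM
    -- The second component is chosen so large that the counter takes this value only after enough
    -- letters have been read.
    obtain ⟨m, hm⟩ := Nat.exists_eq_add_of_le (Nat.right_le_pair d (c.counter + M))
    have h1 := hinv (M + m)
    have h2 := hnone (M + m) h1.1
    rw [h1.1, h1.2, ← Nat.add_assoc c.counter, ← hm] at h2
    exact hd _ _ (hmono M m) h2

/-- If no letter is read when the modulus forbids it, then the modulus is respected. -/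
theorem exists_written_of_modulus {m : ℕ → ℕ}
    (hrd : ∀ i j, rd (j, i) = true → ∀ i' > i, j < m i')
    {i k : ℕ} (hk : (letterRun chk rd enc x k).written = i + 1) :
    ∃ k, (letterRun chk rd enc x k).written = i + 1 ∧
      (letterRun chk rd enc x k).read ≤ m (i + 1) := by
  -- The bound covers all positions not yet written, not just the next one, because `m` need not be
  -- monotone.
  have hinv : ∀ k, ∀ i > (letterRun chk rd enc x k).written,
      (letterRun chk rd enc x k).read ≤ m i := by
    intro k
    induction k with
    | zero => exact fun _ _ => Nat.zero_le _
    | succ k ih =>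
      rw [letterRun_succ]
      cases hc : chk (letterCodes enc x (letterRun chk rd enc x k).read,
        (letterRun chk rd enc x k).written, (letterRun chk rd enc x k).counter) with
      | none =>
        rw [letterStep_none hc]
        intro i hi
        simp only at hi ⊢
        split
        · exact hrd _ _ ‹_› i hi
        · exact ih i hi
      | some w =>
        rw [letterStep_some hc]
        exact fun i hi => ih i (lt_trans (Nat.lt_succ_self _) hi)
  induction k with
  | zero => exact absurd hk (Nat.succ_ne_zero i).symm
  | succ k ih =>
    cases hc : chk (letterCodes enc x (letterRun chk rd enc x k).read,
      (letterRun chk rd enc x k).written, (letterRun chk rd enc x k).counter) with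
    | none =>
      rw [letterRun_succ, letterStep_none hc] at hk
      exact ih hk
    | some w =>
      refine ⟨k + 1, hk, ?_⟩
      rw [letterRun_succ, letterStep_some hc] at hk ⊢
      exact hinv k _ (hk ▸ Nat.lt_succ_self _)

theorem exists_machine_of_search {f : (ℕ → D) →. (ℕ → D)} (hchk : Computable chk)
    (hrd : Computable rd) (hsound : ∀ x, ∀ y ∈ f x, Sound chk enc x y)
    (hfalse : ∀ x, ∀ y ∈ f x, ∀ i j, rd (j, i) = false → Finds chk enc x i j)
    (hfind : ∀ x, ∀ y ∈ f x, ∀ i, ∃ j, Finds chk enc x i j) :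
    ∃ M : Machine n, M.Computes enc f ∧ ∀ m : ℕ → ℕ,
      (∀ i j, rd (j, i) = true → ∀ i' > i, j < m i') →
      ∀ i x, (f x).Dom → M.OutputLengthGE enc x (m i) i := by
  obtain ⟨M, hM⟩ := exists_machine_of_online hchk hrd
  refine ⟨M, fun x y hy => ⟨fun t => ?_, fun l => ?_⟩, fun m hm i x hx => ?_⟩
  · obtain ⟨k, hk⟩ := (hM enc x).2 t
    have h := (hsound x y hy).out_eq (rd := rd) k
    exact ⟨_, h ▸ hk⟩
  · obtain ⟨k, hk⟩ := exists_written (hfalse x y hy) (hfind x y hy) l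
    obtain ⟨t, -, ht⟩ := (hM enc x).1 k
    have h := (hsound x y hy).out_eq (rd := rd) k
    rw [hk] at h
    exact ⟨t, (ht.trans h).symm ▸ List.prefix_rfl⟩
  · obtain ⟨y, hy⟩ := Part.dom_iff_mem.1 hx
    cases i with
    | zero => exact ⟨0, Nat.zero_le _, Nat.zero_le _⟩
    | succ i =>
      obtain ⟨k, hk⟩ := exists_written (hfalse x y hy) (hfind x y hy) (i + 1)
      obtain ⟨k, hk, hr⟩ := exists_written_of_modulus hm hk
      obtain ⟨t, ht, ht'⟩ := (hM enc x).1 k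
      refine ⟨t, ht.le.trans (encPrefix_prefix enc x hr).length_le, ?_⟩
      rw [ht']
      refine Eq.ge ?_
      exact ((congrArg (List.count none) ((hsound x y hy).out_eq k)).trans
        (count_encPrefix y _)).trans hk

end Online

/-! ### Continuity implies computability, in the three versions. -/

namespace RegSys

variable {L : Language} [Encodable (Σ n, L.Functions n)] [Encodable (Σ n, L.Relations n)]
  {Q D : Type*} [Finite Q] [Nonempty D] [L.Structure D] {nT k : ℕ} {σ : RegSys L Q nT k}
  {f : (ℕ → D) →. (ℕ → D)}

/-- Here `κ` is the identity: a certificate excludes mismatches only with runs that share its own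
first `j` transitions. A letter is read after every failed attempt. -/
theorem isComputable_of_isContinuous (hL : IsRelConst L) (hD : Oligomorphic L D)
    (hsat : DecidableSat L D) (ρ : Representation L D) (hf : σ.DefinesFun f)
    (hc : IsContinuous f) : IsComputable ρ f := by
  obtain ⟨ν⟩ := nonempty_naming ρ
  obtain ⟨K, hK⟩ := exists_live_bound (D := D) σ hD
  have hsearch := σ.computable_search ν hL hD hsat K Primrec.id
  obtain ⟨M, hM, -⟩ := exists_machine_of_search (enc := ρ.enc) (f := f) hsearch
    (Computable.const true)
    (fun x y hy j i c w h => search_sound (fun _ => List.prefix_rfl) hf hy h)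
    (fun x y hy i j h => by simp at h) fun x y hy i => by
      obtain ⟨e, he, rfl, hw⟩ := hf.exists_run hy
      obtain ⟨j, hj⟩ := exists_not_mis hD hK hf hc he i
      exact ⟨j, search_complete he hw hj⟩
  exact ⟨M, hM⟩

theorem computablePred_mis_nil (hL : IsRelConst L) (hD : Oligomorphic L D)
    (hsat : DecidableSat L D) (K : ℕ) :
    ComputablePred fun a : ℕ × ℕ => σ.Mis D K a.1 [] a.2 :=
  ((σ.computablePred_mis hL hD hsat K).comp (Computable.fst.pair
    ((Computable.const []).pair Computable.snd))).of_eq fun a => by simp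

/-- With `κ` constantly `[]` the absence of mismatches depends only on `j` and `i`, so it also
decides when to read: without a mismatch the letter can be found from what is known, and with one
every modulus permits reading. The machine does not depend on `m` itself, which may be
non-computable. -/
theorem isMComputable_of_isMContinuous (hL : IsRelConst L) (hD : Oligomorphic L D)
    (hsat : DecidableSat L D) (ρ : Representation L D) (hf : σ.DefinesFun f) {m : ℕ → ℕ}
    (hm : IsMContinuous f m) : IsMComputable ρ f m := by
  classical
  obtain ⟨ν⟩ := nonempty_naming ρ
  obtain ⟨K, hK⟩ := exists_live_bound (D := D) σ hD
  rw [isMContinuous_iff hK hf] at hm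
  have hsearch := σ.computable_search ν hL hD hsat K (κ := fun _ => []) (Primrec.const [])
  have hfind : ∀ x, ∀ y ∈ f x, ∀ i j, ¬ σ.Mis D K j [] i →
      Finds (σ.search ν K fun _ => []) ρ.enc x i j := by
    intro x y hy i j h
    obtain ⟨e, he, rfl, hw⟩ := hf.exists_run hy
    exact search_complete he hw h
  obtain ⟨M, hM, hM'⟩ := exists_machine_of_search (enc := ρ.enc) (f := f) hsearch
    (computablePred_mis_nil (σ := σ) hL hD hsat K).decide
    (fun x y hy j i c w h => search_sound (fun _ => List.nil_prefix) hf hy h)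
    (fun x y hy i j h => hfind x y hy i j (of_decide_eq_false h))
    (fun x y hy i => ⟨m (i + 1), hfind x y hy i _ (hm (i + 1) i (Nat.lt_succ_self i))⟩)
  refine ⟨M, hM, hM' m fun i j hij i' hi' => ?_⟩
  by_contra hle
  exact hm i' i hi' ((of_decide_eq_true hij).mono (not_lt.1 hle))

/-- The given modulus only ensures that the search for the least mismatch-free length terminates;
the result of that search is the computable modulus. -/
theorem isUniformlyComputable_of_isUniformlyContinuous (hL : IsRelConst L)
    (hD : Oligomorphic L D) (hsat : DecidableSat L D) (ρ : Representation L D)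
    (hf : σ.DefinesFun f) (hc : IsUniformlyContinuous f) : IsUniformlyComputable ρ f := by
  classical
  obtain ⟨K, hK⟩ := exists_live_bound (D := D) σ hD
  obtain ⟨m, hm⟩ := hc
  rw [isMContinuous_iff hK hf] at hm
  have hP : ComputablePred fun p : ℕ × ℕ => ∀ i' < p.1, ¬ σ.Mis D K p.2 [] i' :=
    ComputablePred.forall_lt (p := fun (p : ℕ × ℕ) i' => ¬ σ.Mis D K p.2 [] i')
      ((computablePred_mis_nil hL hD hsat K).comp
        ((Computable.snd.comp Computable.fst).pair Computable.snd)).not Computable.fst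
  have hex : ∀ i, ∃ j, ∀ i' < i, ¬ σ.Mis D K j [] i' := fun i => ⟨m i, hm i⟩
  refine ⟨_, Computable.find (P := fun i j => ∀ i' < i, ¬ σ.Mis D K j [] i') hP hex,
    isMComputable_of_isMContinuous hL hD hsat ρ hf ?_⟩
  rw [isMContinuous_iff hK hf]
  exact fun i => Nat.find_spec (hex i)

end RegSys

end DataWord

theorem mainTheorem4 {L : FirstOrder.Language} [Finite L.Symbols]
    [Encodable (Σ n, L.Functions n)] [Encodable (Σ n, L.Relations n)]
    (hL : DataWord.IsRelConst L)
    {D : Type*} [Countable D] [Infinite D] [L.Structure D]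
    (hD : DataWord.Oligomorphic L D) (hdec : DataWord.DecidableStructure L D)
    (ρ : DataWord.Representation L D)
    {Q R : Type*} [Finite Q] [Finite R] (T : DataWord.NRT L Q R)
    (f : (ℕ → D) →. (ℕ → D)) (hf : T.Defines f) (m : ℕ → ℕ) :
    (DataWord.IsComputable ρ f ↔ DataWord.IsContinuous f) ∧
    (DataWord.IsUniformlyComputable ρ f ↔ DataWord.IsUniformlyContinuous f) ∧
    (DataWord.IsMComputable ρ f m ↔ DataWord.IsMContinuous f m) := by
  have := T.finite_Δ.to_subtype
  obtain ⟨nT, ⟨eT⟩⟩ := Finite.exists_equiv_fin T.Δ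
  obtain ⟨k, ⟨eR⟩⟩ := Finite.exists_equiv_fin R
  have h := T.definesFun_toRegSys eT eR hf
  exact ⟨⟨fun h' => h'.isContinuous,
      DataWord.RegSys.isComputable_of_isContinuous hL hD hdec.2 ρ h⟩,
    ⟨fun h' => h'.isUniformlyContinuous,
      DataWord.RegSys.isUniformlyComputable_of_isUniformlyContinuous hL hD hdec.2 ρ h⟩,
    ⟨fun h' => h'.isMContinuous,
      DataWord.RegSys.isMComputable_of_isMContinuous hL hD hdec.2 ρ h⟩⟩
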